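/- Let $K$ be an abelian Lie group (finite-dimensional, real, with countably many connected components), and write $\hat K$ for its Pontryagin dual. An alternating bicharacter is a map $e\colon K\times K\to U(1)$ that is a homomorphism in each variable separately and satisfies $e(k,k)=1$ for all $k\in K$; it is non-degenerate if $l\mapsto e(\cdot,l)$ is an isomorphism of topological groups $K\to\hat K$. (1) Let $e\colon K\times K\to U(1)$ be a non-degenerate alternating bicharacter. Then there exist an abelian Lie group $A$ (with countably many connected components) and an isomorphism of topological groups $\phi\colon A\times\hat A\to K$ such that $$e(\phi(x,\chi),\phi(x',\chi'))=\chi'(x)\,\chi(x')^{-1}\qquad\text{for all }x,x'\in A,\ \chi,\chi'\in\hat A.$$ (2) Consequently every Heisenberg group whose phase space is an abelian Lie group is isomorphic to a standard Heisenberg group. That is, let $G$ be a locally compact Hausdorff group and $1\to U(1)\xrightarrow{i}G\xrightarrow{\pi}K\to 1$ a central extension of topological groups ($i$ is continuous, and $\pi$ is continuous and open) such that the bicharacter $e$ of $K$ determined by $i(e(\pi(g),\pi(h)))=ghg^{-1}h^{-1}$ is non-degenerate. Then there exist an abelian Lie group $A$ (with countably many connected components), an isomorphism of topological groups $\phi\colon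 A\times\hat A\to K$, and an isomorphism of topological groups $\Psi\colon H(A)\to G$ with $\Psi(zI)=i(z)$ and $\pi(\Psi(zT_xM_\chi))=\phi(x,\chi)$ for all $z\in U(1)$, $x\in A$, $\chi\in\hat A$. Here $H(A)=\{zT_xM_\chi : z\in U(1),\ x\in A,\ \chi\in\hat A\}$ is the standard Heisenberg group of $A$, a group of unitary operators on $L^2(A)$ (with respect to Haar measure) with the strong operator topology, where, writing $A$ additively, $T_xf(y)=f(y-x)$ and $M_\chi f(y)=\chi(y)f(y)$. -/

import Mathlib

open MeasureTheory
open scoped Manifold ContDiff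

/-- A topological group is a (finite-dimensional, real) Lie group with countably many connected
components: it is Hausdorff, has countably many components, and admits an atlas modelled on some
`ℝⁿ` for which multiplication and inversion are smooth. -/
structure IsLieGroup (G : Type*) [Group G] [TopologicalSpace G] : Prop where
  t2 : T2Space G
  countable_components : Countable (ConnectedComponents G)
  exists_smooth_structure : ∃ (n : ℕ) (_ : ChartedSpace (EuclideanSpace ℝ (Fin n)) G),
    LieGroup (𝓡 n) ∞ G

section Bicharacter

variable {K : Type*} [CommGroup K] [TopologicalSpace K]

/-- `e` is a homomorphism in each variable separately, and `e (k, k) = 1` for all `k`. -/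
structure IsAlternatingBicharacter (e : K → K → Circle) : Prop where
  mul_left : ∀ k k' l, e (k * k') l = e k l * e k' l
  mul_right : ∀ k l l', e k (l * l') = e k l * e k l'
  alternating : ∀ k, e k k = 1

/-- `l ↦ e (·, l)` is an isomorphism of topological groups from `K` onto its Pontryagin dual
(in particular each `e (·, l)` is continuous). -/
def IsNondegenerateBicharacter (e : K → K → Circle) : Prop :=
  ∃ flat : K ≃ₜ* PontryaginDual K, ∀ k l, flat l k = e k l

end Bicharacter

section CentralExtension

variable {G K : Type*} [Group G] [TopologicalSpace G] [CommGroup K] [TopologicalSpace K]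

/-- The short exact sequence `1 → U(1) → G → K → 1` is a central extension of topological groups:
the image of `U(1)` is central, the inclusion is continuous, and `K` carries the quotient
topology. -/
structure IsTopologicalCentralExtension (S : GroupExtension Circle G K) : Prop where
  central : ∀ z g, S.inl z * g = g * S.inl z
  continuous_inl : Continuous S.inl
  isOpenQuotientMap_rightHom : IsOpenQuotientMap S.rightHom

/-- `e` is the commutator form of the extension: the commutator of `g` and `h` in `G` is the
element `e (π g, π h)` of `U(1)`. -/
def IsCommutatorForm (S : GroupExtension Circle G K) (e : K → K → Circle) : Prop :=
  ∀ g h, S.inl (e (S.rightHom g) (S.rightHom h)) = g * h * g⁻¹ * h⁻¹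

/-- The extension is a Heisenberg group with phase space `K`: it is a central extension of
topological groups whose commutator form is non-degenerate. -/
structure IsHeisenbergGroup (S : GroupExtension Circle G K) : Prop where
  isTopologicalCentralExtension : IsTopologicalCentralExtension S
  nondegenerate : ∃ e : K → K → Circle, IsCommutatorForm S e ∧ IsNondegenerateBicharacter e

end CentralExtension

namespace Heisenberg

noncomputable section

variable (A : Type*) [CommGroup A] [TopologicalSpace A] [IsTopologicalGroup A]
  [LocallyCompactSpace A] [MeasurableSpace A] [BorelSpace A]

/-- `L²(A)` with respect to Haar measure. -/
abbrev L2 := Lp ℂ 2 (Measure.haar : Measure A)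

variable {A}

/-- Multiplication by a scalar `z ∈ U(1)` as a unitary operator. -/
def scalar (z : Circle) : L2 A ≃ₗᵢ[ℂ] L2 A where
  toFun f := (z : ℂ) • f
  invFun f := ((z⁻¹ : Circle) : ℂ) • f
  map_add' f g := smul_add _ f g
  map_smul' c f := smul_comm _ c f
  left_inv f := by
    change ((z⁻¹ : Circle) : ℂ) • (z : ℂ) • f = f
    rw [smul_smul, ← Circle.coe_mul, inv_mul_cancel, Circle.coe_one, one_smul]
  right_inv f := by
    change (z : ℂ) • ((z⁻¹ : Circle) : ℂ) • f = f
    rw [smul_smul, ← Circle.coe_mul, mul_inv_cancel, Circle.coe_one, one_smul]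
  norm_map' f := by
    change ‖(z : ℂ) • f‖ = ‖f‖
    rw [norm_smul, Circle.norm_coe, one_mul]

/-- The translation operator `(T_x f)(y) = f (x⁻¹ y)`. -/
def translation (x : A) : L2 A ≃ₗᵢ[ℂ] L2 A where
  toFun := Lp.compMeasurePreserving (x⁻¹ * ·) (measurePreserving_mul_left Measure.haar x⁻¹)
  invFun := Lp.compMeasurePreserving (x * ·) (measurePreserving_mul_left Measure.haar x)
  map_add' f g := map_add _ f g
  map_smul' c f := (Lp.compMeasurePreservingₗ ℂ (x⁻¹ * ·)
    (measurePreserving_mul_left Measure.haar x⁻¹)).map_smul c f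
  left_inv f := by
    rw [← Lp.compMeasurePreserving_comp_apply]
    have h : (x⁻¹ * ·) ∘ (x * ·) = (id : A → A) := funext fun y => inv_mul_cancel_left x y
    simp only [h]
    exact Lp.compMeasurePreserving_id_apply f
  right_inv f := by
    rw [← Lp.compMeasurePreserving_comp_apply]
    have h : (x * ·) ∘ (x⁻¹ * ·) = (id : A → A) := funext fun y => mul_inv_cancel_left x y
    simp only [h]
    exact Lp.compMeasurePreserving_id_apply f
  norm_map' f := Lp.norm_compMeasurePreserving f _

theorem memLp_modulation (χ : PontryaginDual A) (f : L2 A) :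
    MemLp (fun y => (χ y : ℂ) * f y) 2 Measure.haar := by
  have hc : Continuous fun y => (χ y : ℂ) := continuous_subtype_val.comp (map_continuous χ)
  refine (Lp.memLp f).of_le (hc.aestronglyMeasurable.mul (Lp.aestronglyMeasurable f)) ?_
  exact Filter.Eventually.of_forall fun y => by
    rw [norm_mul, Circle.norm_coe, one_mul]

/-- The pointwise product `χ f` in `L²(A)`. -/
def modulationFun (χ : PontryaginDual A) (f : L2 A) : L2 A :=
  (memLp_modulation χ f).toLp

theorem coeFn_modulationFun (χ : PontryaginDual A) (f : L2 A) :
    modulationFun χ f =ᵐ[Measure.haar] fun y => (χ y : ℂ) * f y :=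
  MemLp.coeFn_toLp _

theorem modulationFun_mul (χ χ' : PontryaginDual A) (f : L2 A) :
    modulationFun χ (modulationFun χ' f) = modulationFun (χ * χ') f := by
  apply Lp.ext
  filter_upwards [coeFn_modulationFun χ (modulationFun χ' f), coeFn_modulationFun χ' f,
    coeFn_modulationFun (χ * χ') f] with y h1 h2 h3
  rw [h1, h2, h3, ← mul_assoc, ← Circle.coe_mul]
  rfl

theorem modulationFun_one (f : L2 A) : modulationFun 1 f = f := by
  apply Lp.ext
  filter_upwards [coeFn_modulationFun 1 f] with y h1
  rw [h1, PontryaginDual.one_apply, Circle.coe_one, one_mul]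

/-- The modulation operator `(M_χ f)(y) = χ(y) f(y)`. -/
def modulation (χ : PontryaginDual A) : L2 A ≃ₗᵢ[ℂ] L2 A where
  toFun := modulationFun χ
  invFun := modulationFun χ⁻¹
  map_add' f g := by
    apply Lp.ext
    filter_upwards [coeFn_modulationFun χ (f + g), coeFn_modulationFun χ f,
      coeFn_modulationFun χ g, Lp.coeFn_add f g,
      Lp.coeFn_add (modulationFun χ f) (modulationFun χ g)] with y h1 h2 h3 h4 h5
    rw [h1, h5, h4, Pi.add_apply, Pi.add_apply, h2, h3, mul_add]
  map_smul' c f := by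
    apply Lp.ext
    filter_upwards [coeFn_modulationFun χ (c • f), coeFn_modulationFun χ f,
      Lp.coeFn_smul c f, Lp.coeFn_smul c (modulationFun χ f)] with y h1 h2 h3 h4
    simp only [RingHom.id_apply]
    rw [h1, h4, h3, Pi.smul_apply, Pi.smul_apply, h2, smul_eq_mul, smul_eq_mul]
    ring
  left_inv f := by rw [modulationFun_mul, inv_mul_cancel, modulationFun_one]
  right_inv f := by rw [modulationFun_mul, mul_inv_cancel, modulationFun_one]
  norm_map' f := by
    have h : ∀ᵐ y ∂Measure.haar, ‖modulationFun χ f y‖ = ‖f y‖ := by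
      filter_upwards [coeFn_modulationFun χ f] with y h1
      rw [h1, norm_mul, Circle.norm_coe, one_mul]
    exact le_antisymm (Lp.norm_le_norm_of_ae_le (h.mono fun y hy => hy.le))
      (Lp.norm_le_norm_of_ae_le (h.mono fun y hy => hy.ge))

theorem coeFn_scalar (z : Circle) (f : L2 A) :
    scalar z f =ᵐ[Measure.haar] fun y => (z : ℂ) * f y :=
  Lp.coeFn_smul (z : ℂ) f

theorem coeFn_translation (x : A) (f : L2 A) :
    translation x f =ᵐ[Measure.haar] fun y => f (x⁻¹ * y) :=
  Lp.coeFn_compMeasurePreserving f (measurePreserving_mul_left Measure.haar x⁻¹)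

theorem coeFn_modulation (χ : PontryaginDual A) (f : L2 A) :
    modulation χ f =ᵐ[Measure.haar] fun y => (χ y : ℂ) * f y :=
  coeFn_modulationFun χ f

/-- The unitary operator `z T_x M_χ`. -/
def operator (z : Circle) (x : A) (χ : PontryaginDual A) : L2 A ≃ₗᵢ[ℂ] L2 A :=
  scalar z * translation x * modulation χ

theorem coeFn_operator (z : Circle) (x : A) (χ : PontryaginDual A) (f : L2 A) :
    operator z x χ f =ᵐ[Measure.haar] fun y => (z : ℂ) * ((χ (x⁻¹ * y) : ℂ) * f (x⁻¹ * y)) := by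
  have hq := (measurePreserving_mul_left (Measure.haar : Measure A) x⁻¹).quasiMeasurePreserving
  filter_upwards [coeFn_scalar z (translation x (modulation χ f)),
    coeFn_translation x (modulation χ f), hq.ae (coeFn_modulation χ f)] with y h1 h2 h3
  change scalar z (translation x (modulation χ f)) y = _
  rw [h1, h2, h3]

theorem operator_mul (z z' : Circle) (x x' : A) (χ χ' : PontryaginDual A) :
    operator z x χ * operator z' x' χ' = operator (z * z' * χ x') (x * x') (χ * χ') := by
  ext1 f
  apply Lp.ext
  have hq := (measurePreserving_mul_left (Measure.haar : Measure A) x⁻¹).quasiMeasurePreserving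
  filter_upwards [coeFn_operator z x χ (operator z' x' χ' f), hq.ae (coeFn_operator z' x' χ' f),
    coeFn_operator (z * z' * χ x') (x * x') (χ * χ') f] with y h1 h2 h3
  change operator z x χ (operator z' x' χ' f) y = _
  have hy : x⁻¹ * y = x' * ((x * x')⁻¹ * y) := by
    rw [mul_inv_rev, mul_assoc, mul_inv_cancel_left]
  have hy' : x'⁻¹ * (x⁻¹ * y) = (x * x')⁻¹ * y := by rw [mul_inv_rev, mul_assoc]
  have hmul : (χ * χ') ((x * x')⁻¹ * y) = χ ((x * x')⁻¹ * y) * χ' ((x * x')⁻¹ * y) := rfl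
  have hχ : χ (x⁻¹ * y) = χ x' * χ ((x * x')⁻¹ * y) := by rw [hy, map_mul]
  rw [h1, h2, h3, hy', hmul, hχ]
  simp only [Circle.coe_mul]
  ring

theorem operator_one : operator (1 : Circle) (1 : A) 1 = 1 := by
  ext1 f
  apply Lp.ext
  filter_upwards [coeFn_operator (1 : Circle) (1 : A) 1 f] with y h
  rw [h]
  simp

/-- The strong operator topology: `U ↦ U f` is continuous for every `f`, and the topology is the
coarsest with this property. -/
instance strongOperatorTopology : TopologicalSpace (L2 A ≃ₗᵢ[ℂ] L2 A) :=
  TopologicalSpace.induced (fun U (f : L2 A) => U f) inferInstance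

variable (A)

/-- The standard Heisenberg group associated to `A`: the group of all unitary operators
`z T_x M_χ` on `L²(A)`, with `z ∈ U(1)`, `x ∈ A` and `χ` in the dual of `A`. -/
def standardGroup : Subgroup (L2 A ≃ₗᵢ[ℂ] L2 A) where
  carrier := {U | ∃ (z : Circle) (x : A) (χ : PontryaginDual A), U = operator z x χ}
  mul_mem' := by
    rintro _ _ ⟨z, x, χ, rfl⟩ ⟨z', x', χ', rfl⟩
    exact ⟨_, _, _, operator_mul z z' x x' χ χ'⟩
  one_mem' := ⟨1, 1, 1, operator_one.symm⟩
  inv_mem' := by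
    rintro _ ⟨z, x, χ, rfl⟩
    refine ⟨z⁻¹ * χ x, x⁻¹, χ⁻¹, inv_eq_of_mul_eq_one_right ?_⟩
    rw [operator_mul, ← operator_one]
    simp

variable {A}

/-- The element `z T_x M_χ` of the standard Heisenberg group. -/
def element (z : Circle) (x : A) (χ : PontryaginDual A) : standardGroup A :=
  ⟨operator z x χ, z, x, χ, rfl⟩

end

end Heisenberg

-- The building blocks are the dual pairs (ℝ, ℝ), (ℤ, U(1)) and (ℤ/n, ℤ/n). If `A` and `B` map to
-- isotropic subgroups of `K` and pair under `e` as a group and its dual, then `K` is the product of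
-- `A × B` with the common annihilator `H` of the two images, and `e` stays non-degenerate on `H`
-- (`exists_orthogonal_complement`). It remains to keep finding such pairs while something
-- decreases.
--
-- The Lie structure enters only through an open continuous homomorphism `E` from a vector space `V`
-- to `K` (`IsLieGroup.exists_exponential`). The induction is on dim `V`
-- (`hasPolarization_of_openHom`). Write e(E v, k) = exp(2πi l_k(v)) with l_k linear. If l_{E w}(v)
-- is not identically zero, two rays in `V` give a pair (ℝ, ℝ). Otherwise E(V) is an open isotropic
-- subgroup; it lies in its own annihilator, which is the dual of a discrete group, so E(V) is
-- compact and the forms l_k form a discrete group. If that group is nonzero, there are v and k such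
-- that all forms are integral at v and l_k(v) = 1; then the circle through v is dual to the copy of
-- ℤ generated by k⁻¹. If it is zero, `E` is trivial, so `K` is discrete, and being isomorphic to
-- its compact dual it is finite; there an element of maximal order yields (ℤ/n, ℤ/n), by induction
-- on cardinality.
--
-- For the Heisenberg group, the two isotropic factors of `K` lift to homomorphisms σ, τ into `G`.
-- This property (`HasLifts`) passes to products, so it is enough to treat ℝ, ℤ, U(1) and ℤ/n; the
-- substantial case is ℝ, where a cocycle is trivialised by averaging its logarithm
-- (`exists_lift_real`). The isomorphism is zT_xM_χ ↦ i(z)σ(x)τ(χ). It is a homeomorphism because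
-- the strong operator topology on H(A) is the product topology: the Weyl commutation relations
-- recover (x, χ) from the operator (`tendsto_of_tendsto_operator`).

universe u v

/-! ### The exponential map of a commutative Lie group -/

section LieExponential

open Filter Topology Set

variable {n : ℕ} {G : Type*} [CommGroup G] [TopologicalSpace G]
  [ChartedSpace (EuclideanSpace ℝ (Fin n)) G]

/-- In the chart at the identity, multiplication has derivative `(x, y) ↦ x + y`. -/
theorem hasFDerivAt_chart_mul [LieGroup (𝓡 n) ∞ G] :
    HasFDerivAt (fun p : EuclideanSpace ℝ (Fin n) × EuclideanSpace ℝ (Fin n) =>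
        extChartAt (𝓡 n) (1 : G)
          ((extChartAt (𝓡 n) (1 : G)).symm p.1 * (extChartAt (𝓡 n) (1 : G)).symm p.2))
      (ContinuousLinearMap.fst ℝ _ _ + ContinuousLinearMap.snd ℝ _ _)
      (extChartAt (𝓡 n) (1 : G) 1, extChartAt (𝓡 n) (1 : G) 1) := by
  have : IsManifold (𝓡 n) ∞ G := inferInstance
  set φ := extChartAt (𝓡 n) (1 : G) with hφ
  set c := φ 1 with hc
  set μ : EuclideanSpace ℝ (Fin n) × EuclideanSpace ℝ (Fin n) → EuclideanSpace ℝ (Fin n) :=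
    fun p => φ (φ.symm p.1 * φ.symm p.2) with hμ
  have hsymm1 : φ.symm c = 1 := extChartAt_to_inv (I := 𝓡 n) (1 : G)
  have hsm : ContMDiffAt 𝓘(ℝ, EuclideanSpace ℝ (Fin n)) (𝓡 n) ∞ φ.symm c :=
    (contMDiffOn_extChartAt_symm (I := 𝓡 n) (1 : G)).contMDiffAt
      (extChartAt_target_mem_nhds (I := 𝓡 n) (1 : G))
  have hd : DifferentiableAt ℝ μ (c, c) := by
    have h1 : ContMDiffAt 𝓘(ℝ, EuclideanSpace ℝ (Fin n) × EuclideanSpace ℝ (Fin n)) (𝓡 n) ∞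
        (fun p : EuclideanSpace ℝ (Fin n) × EuclideanSpace ℝ (Fin n) => φ.symm p.1) (c, c) :=
      ContMDiffAt.comp (c, c) (g := φ.symm) hsm contDiff_fst.contMDiff.contMDiffAt
    have h2 : ContMDiffAt 𝓘(ℝ, EuclideanSpace ℝ (Fin n) × EuclideanSpace ℝ (Fin n)) (𝓡 n) ∞
        (fun p : EuclideanSpace ℝ (Fin n) × EuclideanSpace ℝ (Fin n) => φ.symm p.2) (c, c) :=
      ContMDiffAt.comp (c, c) (g := φ.symm) hsm contDiff_snd.contMDiff.contMDiffAt
    have h3 := h1.mul h2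
    have h4 : ContMDiffAt (𝓡 n) 𝓘(ℝ, EuclideanSpace ℝ (Fin n)) ∞ φ
        (φ.symm (c, c).1 * φ.symm (c, c).2) := by
      simp only [hsymm1, mul_one]
      exact contMDiffAt_extChartAt
    have h5 := ContMDiffAt.comp (c, c) h4 h3
    exact (contMDiffAt_iff_contDiffAt.1 h5).differentiableAt (by simp)
  have hnear : ∀ᶠ x in 𝓝 c, φ (φ.symm x) = x := by
    filter_upwards [extChartAt_target_mem_nhds (I := 𝓡 n) (1 : G)] with x hx
    exact φ.right_inv hx
  -- The derivative is determined by its restrictions to the two axes, where multiplication by the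
  -- identity is the identity map.
  have hp1 : HasFDerivAt (fun x => μ (x, c)) (ContinuousLinearMap.id ℝ _) c := by
    refine (hasFDerivAt_id c).congr_of_eventuallyEq ?_
    filter_upwards [hnear] with x hx
    simp [hμ, hsymm1, hx]
  have hp2 : HasFDerivAt (fun x => μ (c, x)) (ContinuousLinearMap.id ℝ _) c := by
    refine (hasFDerivAt_id c).congr_of_eventuallyEq ?_
    filter_upwards [hnear] with x hx
    simp [hμ, hsymm1, hx]
  have hD := hd.hasFDerivAt
  have e1 := hp1.unique (HasFDerivAt.comp (f := fun x => (x, c)) c hD (hasFDerivAt_prodMk_left c c))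
  have e2 := hp2.unique
    (HasFDerivAt.comp (f := fun x => (c, x)) c hD (hasFDerivAt_prodMk_right c c))
  convert hD using 1
  refine ContinuousLinearMap.ext fun p => ?_
  obtain ⟨a, b⟩ := p
  have ha := DFunLike.congr_fun e1 a
  have hb := DFunLike.congr_fun e2 b
  simp only [ContinuousLinearMap.coe_id', id_eq, ContinuousLinearMap.comp_apply,
    ContinuousLinearMap.inl_apply, ContinuousLinearMap.inr_apply] at ha hb
  rw [show (a, b) = (a, (0 : EuclideanSpace ℝ (Fin n))) + (0, b) by simp, map_add, map_add,
    ← ha, ← hb]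
  simp

variable [LieGroup (𝓡 n) ∞ G]

theorem hasFDerivAt_chart_mul_of_eq_one {X : Type*} [NormedAddCommGroup X] [NormedSpace ℝ X]
    {f g : X → G} {x : X} {f' g' : X →L[ℝ] EuclideanSpace ℝ (Fin n)}
    (hf1 : f x = 1) (hg1 : g x = 1) (hf : ContinuousAt f x) (hg : ContinuousAt g x)
    (hf' : HasFDerivAt (fun t => extChartAt (𝓡 n) (1 : G) (f t)) f' x)
    (hg' : HasFDerivAt (fun t => extChartAt (𝓡 n) (1 : G) (g t)) g' x) :
    HasFDerivAt (fun t => extChartAt (𝓡 n) (1 : G) (f t * g t)) (f' + g') x := by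
  have h := hasFDerivAt_chart_mul (n := n) (G := G)
  have hs := extChartAt_source_mem_nhds (I := 𝓡 n) (1 : G)
  have h0 : (extChartAt (𝓡 n) (1 : G) 1, extChartAt (𝓡 n) (1 : G) 1) =
    (extChartAt (𝓡 n) (1 : G) (f x), extChartAt (𝓡 n) (1 : G) (g x)) := by rw [hf1, hg1]
  rw [h0] at h
  have h2 := HasFDerivAt.comp x h (hf'.prodMk hg')
  have h3 : (ContinuousLinearMap.fst ℝ (EuclideanSpace ℝ (Fin n)) (EuclideanSpace ℝ (Fin n)) +
      ContinuousLinearMap.snd ℝ _ _).comp (f'.prod g') = f' + g' := by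
    ext1 t; simp
  rw [h3] at h2
  refine h2.congr_of_eventuallyEq ?_
  have hfs : ∀ᶠ t in 𝓝 x, f t ∈ (extChartAt (𝓡 n) (1 : G)).source :=
    hf.eventually_mem (by rw [hf1]; exact hs)
  have hgs : ∀ᶠ t in 𝓝 x, g t ∈ (extChartAt (𝓡 n) (1 : G)).source :=
    hg.eventually_mem (by rw [hg1]; exact hs)
  filter_upwards [hfs, hgs] with t h4 h5
  simp only [Function.comp]
  rw [(extChartAt (𝓡 n) (1 : G)).left_inv h4, (extChartAt (𝓡 n) (1 : G)).left_inv h5]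

/-- Left translations preserve a left-invariant field. This supplies integral curves of one common
duration through all points. -/
theorem isMIntegralCurveOn_mul_left {v : GroupLieAlgebra (𝓡 n) G} {γ : ℝ → G} {s : Set ℝ} (g : G)
    (hγ : IsMIntegralCurveOn γ (mulInvariantVectorField (I := 𝓡 n) v) s) :
    IsMIntegralCurveOn (fun t => g * γ t) (mulInvariantVectorField (I := 𝓡 n) v) s := by
  intro t ht
  have hd : ∀ a b : G, MDifferentiableAt (𝓡 n) (𝓡 n) (fun x : G => a * x) b := fun a b =>
    (contMDiff_mul_left (I := 𝓡 n) (n := ∞)).contMDiffAt.mdifferentiableAt (by simp)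
  have h1 := HasMFDerivAt.comp_hasMFDerivWithinAt t (hd g (γ t)).hasMFDerivAt (hγ t ht)
  refine h1.congr_mfderiv ?_
  have h2 : mfderiv (𝓡 n) (𝓡 n) (fun x : G => g * γ t * x) 1 =
      (mfderiv (𝓡 n) (𝓡 n) (fun x : G => g * x) (γ t * 1)).comp
        (mfderiv (𝓡 n) (𝓡 n) (fun x : G => γ t * x) 1) := by
    rw [← mfderiv_comp (I' := 𝓡 n) (1 : G) (hd g _) (hd _ _)]
    congr 1
    ext x
    simp [mul_assoc]
  -- The tangent spaces at `γ t * 1` and `γ t` are not syntactically the same type, so derivatives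
  -- are compared in the model space.
  have h3 : ∀ b, b = γ t → (mfderiv (𝓡 n) (𝓡 n) (fun x : G => g * x) b :
      EuclideanSpace ℝ (Fin n) →L[ℝ] EuclideanSpace ℝ (Fin n)) =
      mfderiv (𝓡 n) (𝓡 n) (fun x : G => g * x) (γ t) := by
    rintro _ rfl
    rfl
  have h4 : (mfderiv (𝓡 n) (𝓡 n) (fun x : G => g * γ t * x) 1 :
      EuclideanSpace ℝ (Fin n) →L[ℝ] EuclideanSpace ℝ (Fin n)) v =
      (mfderiv (𝓡 n) (𝓡 n) (fun x : G => g * x) (γ t) :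
        EuclideanSpace ℝ (Fin n) →L[ℝ] EuclideanSpace ℝ (Fin n))
        ((mfderiv (𝓡 n) (𝓡 n) (fun x : G => γ t * x) 1 :
          EuclideanSpace ℝ (Fin n) →L[ℝ] EuclideanSpace ℝ (Fin n)) v) := by
    rw [← h3 _ (mul_one (γ t))]
    exact DFunLike.congr_fun h2 v
  refine ContinuousLinearMap.ext_ring ?_
  refine Eq.trans ?_ (congrArg (fun w => (1 : ℝ) • w) h4).symm
  change (mfderiv (𝓡 n) (𝓡 n) (fun x : G => g * x) (γ t) :
        EuclideanSpace ℝ (Fin n) →L[ℝ] EuclideanSpace ℝ (Fin n)) ((1 : ℝ) • _) = _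
  rw [map_smul]
  rfl

/-- One-parameter subgroups with prescribed velocity exist. -/
theorem exists_oneParameterSubgroup [T2Space G] (v : EuclideanSpace ℝ (Fin n)) :
    ∃ γ : ℝ → G, Continuous γ ∧ (∀ s t, γ (s + t) = γ s * γ t) ∧
      HasFDerivAt (fun t => extChartAt (𝓡 n) (1 : G) (γ t))
        ((1 : ℝ →L[ℝ] ℝ).smulRight v) 0 := by
  have : LieGroup (𝓡 n) (minSmoothness ℝ 3) G :=
    LieGroup.of_le (n := ∞) (by
      simp only [minSmoothness_of_isRCLikeNormedField]
      exact WithTop.coe_le_coe.2 (le_top : (3 : ℕ∞) ≤ ⊤))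
  have : IsManifold (𝓡 n) 1 G := IsManifold.of_le (n := ∞) (by exact_mod_cast le_top)
  let X : (g : G) → TangentSpace (𝓡 n) g :=
    mulInvariantVectorField (I := 𝓡 n) (G := G) (v : GroupLieAlgebra (𝓡 n) G)
  have hX : ContMDiff (𝓡 n) ((𝓡 n).prod 𝓘(ℝ, EuclideanSpace ℝ (Fin n))) 1
      (fun g : G => (⟨g, X g⟩ : TangentBundle (𝓡 n) G)) := by
    have := contMDiff_mulInvariantVectorField (I := 𝓡 n) (G := G) (v : GroupLieAlgebra (𝓡 n) G)
    exact this.of_le (by simp only [minSmoothness_of_isRCLikeNormedField]; norm_num)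
  obtain ⟨γ₀, hγ₀, hi⟩ := exists_isMIntegralCurveAt_of_contMDiffAt_boundaryless (t₀ := 0)
    (hX.contMDiffAt (x := (1 : G)))
  obtain ⟨ε, hε, hi⟩ := isMIntegralCurveAt_iff'.1 hi
  have hball : Metric.ball (0 : ℝ) ε = Ioo (-ε) ε := by rw [Real.ball_eq_Ioo]; simp
  rw [hball] at hi
  -- Translates of the local curve exist through every point for the same time `ε`, so the integral
  -- curve through 1 is global.
  obtain ⟨γ, hγ1, hγ⟩ := exists_isMIntegralCurve_of_isMIntegralCurveOn hX hε
    (fun x => ⟨fun t => x * γ₀ t, by simp [hγ₀], isMIntegralCurveOn_mul_left x hi⟩) 1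
  refine ⟨γ, ?_, ?_, ?_⟩
  · exact continuous_iff_continuousAt.2 fun t => (hγ t).continuousAt
  · intro s t
    have h1 : IsMIntegralCurve (fun t => γ s * γ t) X := by
      rw [isMIntegralCurve_iff_isMIntegralCurveOn] at hγ ⊢
      exact isMIntegralCurveOn_mul_left (γ s) hγ
    have h2 : IsMIntegralCurve (γ ∘ (· + s)) X := hγ.comp_add s
    -- Both sides of the homomorphism law are integral curves through `γ s`, hence equal by
    -- uniqueness.
    have h3 := isMIntegralCurve_Ioo_eq_of_contMDiff_boundaryless (t₀ := 0) hX h1 h2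
      (by simp [hγ1])
    have := congrFun h3 t
    simp only [Function.comp] at this
    rw [this, add_comm]
  · have h := (hγ 0).2
    have hv : ∀ g : G, g = 1 → (X g : EuclideanSpace ℝ (Fin n)) = v := by
      rintro g rfl
      have h1 : (fun x : G => 1 * x) = id := by ext; simp
      have h2 : ∀ f : G → G, f = id → (mfderiv (𝓡 n) (𝓡 n) f (1 : G) :
          EuclideanSpace ℝ (Fin n) →L[ℝ] EuclideanSpace ℝ (Fin n)) =
          ContinuousLinearMap.id ℝ _ := by
        rintro _ rfl
        exact mfderiv_id
      exact DFunLike.congr_fun (h2 _ h1) v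
    have h0 : HasFDerivWithinAt (writtenInExtChartAt 𝓘(ℝ, ℝ) (𝓡 n) 0 γ)
      ((1 : ℝ →L[ℝ] ℝ).smulRight v) (range 𝓘(ℝ, ℝ)) (extChartAt 𝓘(ℝ, ℝ) (0 : ℝ) 0) := by
      rw [← hv _ hγ1]
      exact h
    simp only [writtenInExtChartAt, hγ1, extChartAt_model_space_eq_id, modelWithCornersSelf_coe,
      range_id, hasFDerivWithinAt_univ, PartialEquiv.refl_coe, PartialEquiv.refl_symm, id_eq,
      Function.comp_id] at h0
    exact h0

/-- A point of a commutative Lie group that is close to the identity is reached by any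
homomorphism from the tangent space whose derivative at `0` is the identity. -/
theorem mem_nhds_one_image_of_hasFDerivAt_id [T2Space G] {E : EuclideanSpace ℝ (Fin n) → G}
    (hE : Continuous E) (hadd : ∀ v w, E (v + w) = E v * E w)
    (hE' : HasFDerivAt (fun t => extChartAt (𝓡 n) (1 : G) (E t)) (ContinuousLinearMap.id ℝ _) 0)
    {U : Set (EuclideanSpace ℝ (Fin n))} (hU : U ∈ 𝓝 0) : E '' U ∈ 𝓝 1 := by
  set φ := extChartAt (𝓡 n) (1 : G) with hφ
  set c := φ 1 with hc
  have htg : IsTopologicalGroup G := topologicalGroup_of_lieGroup (𝓡 n) ∞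
  have hE0 : E 0 = 1 := by simpa using hadd 0 0
  have hsymm1 : φ.symm c = 1 := extChartAt_to_inv (I := 𝓡 n) (1 : G)
  have hsymmc : ContinuousAt φ.symm c := continuousAt_extChartAt_symm (I := 𝓡 n) (1 : G)
  have hnear : ∀ᶠ x in 𝓝 c, φ (φ.symm x) = x := by
    filter_upwards [extChartAt_target_mem_nhds (I := 𝓡 n) (1 : G)] with x hx
    exact φ.right_inv hx
  have hshift : Tendsto (fun x => c + x) (𝓝 0) (𝓝 c) := by
    have : Continuous fun x : EuclideanSpace ℝ (Fin n) => c + x := by fun_prop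
    simpa using this.tendsto 0
  have hf1 : ContinuousAt (fun x => φ.symm (c + x)) 0 := by
    have : Tendsto (fun x => φ.symm (c + x)) (𝓝 0) (𝓝 (φ.symm c)) := hsymmc.tendsto.comp hshift
    simpa [ContinuousAt] using this
  have hd1 : HasFDerivAt (fun x => φ (φ.symm (c + x))) (ContinuousLinearMap.id ℝ _) 0 := by
    refine ((hasFDerivAt_id (0 : EuclideanSpace ℝ (Fin n))).const_add c).congr_of_eventuallyEq ?_
    exact hshift.eventually hnear
  have hd2 : HasFDerivAt (fun x => φ (E (-x))) (-ContinuousLinearMap.id ℝ _) 0 := by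
    have h1 : HasFDerivAt (fun t => φ (E t)) (ContinuousLinearMap.id ℝ _)
      (-(0 : EuclideanSpace ℝ (Fin n))) := by simpa using hE'
    have h2 := HasFDerivAt.comp (f := fun x : EuclideanSpace ℝ (Fin n) => -x) 0 h1
      (hasFDerivAt_id _).neg
    rw [ContinuousLinearMap.id_comp] at h2
    exact h2
  have hcE : ContinuousAt (fun x => E (-x)) 0 := (hE.comp continuous_neg).continuousAt
  -- `E` is only known to be differentiable at 0, so successive approximation replaces the inverse
  -- function theorem. The error made when the point with coordinate `x` is approximated by `E x`
  -- has derivative id − id = 0, so in the chart it is at most half as long as `x`.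
  have hd := hasFDerivAt_chart_mul_of_eq_one (by simp [hsymm1]) (by simp [hE0]) hf1 hcE hd1 hd2
  rw [add_neg_cancel] at hd
  have hlit := hd.isLittleO.bound (c := 1 / 2) (by norm_num)
  have hsrc : ∀ᶠ x in 𝓝 (0 : EuclideanSpace ℝ (Fin n)),
      φ.symm (c + x) * E (-x) ∈ φ.source := by
    refine (hf1.mul hcE).eventually_mem ?_
    have h1 : φ.symm (c + 0) * E (-0) = 1 := by rw [add_zero, hsymm1, neg_zero, hE0, mul_one]
    change φ.source ∈ 𝓝 (φ.symm (c + 0) * E (-0))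
    rw [h1]
    exact extChartAt_source_mem_nhds (I := 𝓡 n) (1 : G)
  obtain ⟨r, hr, hball⟩ := Metric.eventually_nhds_iff.1 (hlit.and hsrc)
  obtain ⟨ρ, hρ, hρU⟩ := Metric.mem_nhds_iff.1 hU
  -- The corrections will sum to at most `2 * ‖x‖`, so `ρ / 4` keeps the total inside the ball of
  -- radius `ρ`.
  set δ := min r (ρ / 4) with hδ
  have hδ0 : 0 < δ := lt_min hr (by linarith)
  set g : EuclideanSpace ℝ (Fin n) → EuclideanSpace ℝ (Fin n) :=
    fun x => φ (φ.symm (c + x) * E (-x)) - c with hg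
  have hgb : ∀ x, ‖x‖ < δ → ‖g x‖ ≤ 1 / 2 * ‖x‖ := by
    intro x hx
    have := (hball (y := x) (by rw [dist_zero_right]; exact hx.trans_le (min_le_left _ _))).1
    rw [← hφ, add_zero, neg_zero, hE0, mul_one, hsymm1, ← hc] at this
    simpa only [hg, zero_apply, sub_zero] using this
  have hgs : ∀ x, ‖x‖ < δ → φ.symm (c + g x) = φ.symm (c + x) * E (-x) := by
    intro x hx
    have := (hball (y := x) (by rw [dist_zero_right]; exact hx.trans_le (min_le_left _ _))).2
    simp only [hg, add_sub_cancel]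
    exact φ.left_inv this
  have key : ∀ x, ‖x‖ < δ → φ.symm (c + x) ∈ E '' U := by
    intro x hx
    have hb : ∀ m, ‖g^[m] x‖ ≤ (1 / 2) ^ m * ‖x‖ := by
      intro m
      induction m with
      | zero => simp
      | succ m ih =>
        rw [Function.iterate_succ_apply']
        have h1 : ‖g^[m] x‖ < δ := by
          refine (ih.trans ?_).trans_lt hx
          exact mul_le_of_le_one_left (norm_nonneg _) (pow_le_one₀ (by norm_num) (by norm_num))
        calc _ ≤ 1 / 2 * ‖g^[m] x‖ := hgb _ h1
          _ ≤ 1 / 2 * ((1 / 2) ^ m * ‖x‖) := by gcongr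
          _ = _ := by ring
    have hlt : ∀ m, ‖g^[m] x‖ < δ := fun m =>
      ((hb m).trans (mul_le_of_le_one_left (norm_nonneg _)
        (pow_le_one₀ (by norm_num) (by norm_num)))).trans_lt hx
    have hsum : Summable fun m => g^[m] x :=
      Summable.of_norm_bounded ((summable_geometric_of_lt_one (by norm_num)
        (by norm_num : (1 / 2 : ℝ) < 1)).mul_right ‖x‖) hb
    -- After `m` corrections, `g^[m] x` is the coordinate of the remaining error; it tends to 0,
    -- which leaves `E` of the full sum.
    have hstep : ∀ m, φ.symm (c + x) =
        φ.symm (c + g^[m] x) * E (∑ i ∈ Finset.range m, g^[i] x) := by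
      intro m
      induction m with
      | zero => simp [hE0]
      | succ m ih =>
        rw [ih, Function.iterate_succ_apply', hgs _ (hlt m), Finset.sum_range_succ,
          add_comm (∑ i ∈ Finset.range m, g^[i] x), hadd, mul_assoc, ← mul_assoc (E _), ← hadd]
        simp [hE0]
    have hl1 : Tendsto (fun m => φ.symm (c + g^[m] x)) atTop (𝓝 1) := by
      have := hf1.tendsto.comp hsum.tendsto_atTop_zero
      simpa [hsymm1, Function.comp_def] using this
    have hl2 := (hE.tendsto _).comp hsum.hasSum.tendsto_sum_nat
    have hl3 := hl1.mul hl2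
    have hconst : Tendsto (fun _ : ℕ => φ.symm (c + x)) atTop (𝓝 (φ.symm (c + x))) :=
      tendsto_const_nhds
    refine ⟨∑' m, g^[m] x, hρU ?_, ?_⟩
    · rw [mem_ball_zero_iff]
      have h1 : ‖∑' m, g^[m] x‖ ≤ 2 * ‖x‖ := by
        refine tsum_of_norm_bounded ?_ hb
        exact (hasSum_geometric_two).mul_right ‖x‖
      have := min_le_right r (ρ / 4)
      linarith
    · rw [one_mul] at hl3
      refine tendsto_nhds_unique hl3 ?_
      refine hconst.congr fun m => ?_
      simp only [Function.comp]
      exact hstep m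
  have hφc : ContinuousAt φ 1 := continuousAt_extChartAt (I := 𝓡 n) (1 : G)
  filter_upwards [extChartAt_source_mem_nhds (I := 𝓡 n) (1 : G),
    hφc.preimage_mem_nhds (Metric.ball_mem_nhds c hδ0)] with k hk1 hk2
  have := key (φ k - c) (by simpa [dist_eq_norm] using hk2)
  rwa [add_sub_cancel, φ.left_inv hk1] at this

end LieExponential

open Topology in
-- Translation moves openness at 0 to every other point.
theorem isOpenMap_of_add_of_image_mem_nhds {V G : Type*} [AddCommGroup V] [TopologicalSpace V]
    [IsTopologicalAddGroup V] [Group G] [TopologicalSpace G] [IsTopologicalGroup G]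
    {E : V → G} (hadd : ∀ v w, E (v + w) = E v * E w)
    (h : ∀ U ∈ 𝓝 (0 : V), E '' U ∈ 𝓝 1) : IsOpenMap E := by
  refine isOpenMap_iff_nhds_le.2 fun v => ?_
  intro s hs
  have h1 : (fun w => v + w) ⁻¹' (E ⁻¹' s) ∈ 𝓝 (0 : V) := by
    have : ContinuousAt (fun w => v + w) 0 := by fun_prop
    refine this.preimage_mem_nhds ?_
    simpa using hs
  have h2 := h _ h1
  have h3 : (fun g => (E v)⁻¹ * g) ⁻¹' (E '' ((fun w => v + w) ⁻¹' (E ⁻¹' s))) ∈ 𝓝 (E v) := by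
    have : ContinuousAt (fun g => (E v)⁻¹ * g) (E v) := by fun_prop
    refine this.preimage_mem_nhds ?_
    simpa using h2
  filter_upwards [h3] with g hg
  obtain ⟨w, hw, hw'⟩ := hg
  have : E (v + w) = g := by rw [hadd, hw', mul_inv_cancel_left]
  rw [← this]
  exact hw

/-- A commutative Lie group is covered near the identity by an open continuous homomorphism from a
Euclidean space. -/
theorem IsLieGroup.exists_exponential {K : Type*} [CommGroup K] [TopologicalSpace K]
    (hK : IsLieGroup K) : IsTopologicalGroup K ∧
    ∃ (n : ℕ) (E : EuclideanSpace ℝ (Fin n) → K), Continuous E ∧ IsOpenMap E ∧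
      ∀ v w, E (v + w) = E v * E w := by
  have := hK.t2
  obtain ⟨n, _, hL⟩ := hK.exists_smooth_structure
  have htg : IsTopologicalGroup K := topologicalGroup_of_lieGroup (𝓡 n) ∞
  refine ⟨htg, n, ?_⟩
  -- The exponential is the product of the one-parameter subgroups along the coordinate axes;
  -- commutativity makes it a homomorphism.
  choose γ hγc hγa hγd using fun i : Fin n =>
    exists_oneParameterSubgroup (G := K) (EuclideanSpace.single i (1 : ℝ))
  have hγ0 : ∀ i, γ i 0 = 1 := fun i => by simpa using hγa i 0 0
  have hcont : ∀ i, Continuous fun t : EuclideanSpace ℝ (Fin n) => γ i (t i) := fun i =>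
    (hγc i).comp (by fun_prop)
  have hadd : ∀ v w : EuclideanSpace ℝ (Fin n),
      ∏ i, γ i ((v + w) i) = (∏ i, γ i (v i)) * ∏ i, γ i (w i) := fun v w => by
    simp [hγa, Finset.prod_mul_distrib]
  have hc : Continuous fun t : EuclideanSpace ℝ (Fin n) => ∏ i, γ i (t i) :=
    continuous_finsetProd _ fun i _ => hcont i
  refine ⟨fun t => ∏ i, γ i (t i), hc,
    isOpenMap_of_add_of_image_mem_nhds hadd fun U hU =>
      mem_nhds_one_image_of_hasFDerivAt_id hc hadd ?_ hU, hadd⟩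
  have hd : ∀ s : Finset (Fin n), HasFDerivAt (fun t : EuclideanSpace ℝ (Fin n) =>
      extChartAt (𝓡 n) (1 : K) (∏ i ∈ s, γ i (t i)))
      (∑ i ∈ s, (EuclideanSpace.proj (𝕜 := ℝ) i : EuclideanSpace ℝ (Fin n) →L[ℝ] ℝ).smulRight
        (EuclideanSpace.single i (1 : ℝ))) 0 := by
    intro s
    induction s using Finset.induction_on with
    | empty => simpa using hasFDerivAt_const _ _
    | insert i s hi ih =>
      simp only [Finset.prod_insert hi, Finset.sum_insert hi]
      refine hasFDerivAt_chart_mul_of_eq_one (by simp [hγ0]) (by simp [hγ0])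
        (hcont i).continuousAt (continuous_finsetProd _ fun i _ => hcont i).continuousAt ?_ ih
      have h1 : HasFDerivAt (fun t => extChartAt (𝓡 n) (1 : K) (γ i t))
        ((1 : ℝ →L[ℝ] ℝ).smulRight (EuclideanSpace.single i (1 : ℝ)))
        ((EuclideanSpace.proj (𝕜 := ℝ) i : EuclideanSpace ℝ (Fin n) →L[ℝ] ℝ) 0) := by
        simpa using hγd i
      have h2 := h1.comp 0 (EuclideanSpace.proj (𝕜 := ℝ) i :
        EuclideanSpace ℝ (Fin n) →L[ℝ] ℝ).hasFDerivAt
      refine h2.congr_fderiv (ContinuousLinearMap.ext fun t => ?_)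
      simp
  convert hd Finset.univ using 1
  refine ContinuousLinearMap.ext fun t => ?_
  ext j
  simp [Finset.sum_apply, Pi.single_apply]

/-! ### Algebra of alternating bicharacters -/

section Bicharacter

variable {K : Type*} [CommGroup K] {e : K → K → Circle}

namespace IsAlternatingBicharacter

/-- The homomorphism `e (·, l)`. -/
noncomputable def leftHom (he : IsAlternatingBicharacter e) (l : K) : K →* Circle :=
  MonoidHom.mk' (fun k => e k l) fun k m => he.mul_left k m l

/-- The homomorphism `e (k, ·)`. -/
noncomputable def rightHom (he : IsAlternatingBicharacter e) (k : K) : K →* Circle :=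
  MonoidHom.mk' (fun l => e k l) fun l m => he.mul_right k l m

theorem one_left (he : IsAlternatingBicharacter e) (l : K) : e 1 l = 1 := (he.leftHom l).map_one

theorem inv_left (he : IsAlternatingBicharacter e) (k l : K) : e k⁻¹ l = (e k l)⁻¹ :=
  (he.leftHom l).map_inv k

theorem inv_right (he : IsAlternatingBicharacter e) (k l : K) : e k l⁻¹ = (e k l)⁻¹ :=
  (he.rightHom k).map_inv l

theorem pow_left (he : IsAlternatingBicharacter e) (k l : K) (n : ℕ) : e (k ^ n) l = e k l ^ n :=
  (he.leftHom l).map_pow k n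

theorem pow_right (he : IsAlternatingBicharacter e) (k l : K) (n : ℕ) : e k (l ^ n) = e k l ^ n :=
  (he.rightHom k).map_pow l n

theorem zpow_left (he : IsAlternatingBicharacter e) (k l : K) (n : ℤ) : e (k ^ n) l = e k l ^ n :=
  (he.leftHom l).map_zpow k n

theorem zpow_right (he : IsAlternatingBicharacter e) (k l : K) (n : ℤ) :
    e k (l ^ n) = e k l ^ n :=
  (he.rightHom k).map_zpow l n

theorem swap (he : IsAlternatingBicharacter e) (k l : K) : e l k = (e k l)⁻¹ := by
  have h := he.alternating (k * l)
  rw [he.mul_left, he.mul_right, he.mul_right, he.alternating, he.alternating, one_mul,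
    mul_one] at h
  exact eq_inv_of_mul_eq_one_right h

theorem restrict (he : IsAlternatingBicharacter e) (H : Subgroup K) :
    IsAlternatingBicharacter fun k l : H => e k l :=
  ⟨fun k m l => he.mul_left k m l, fun k l m => he.mul_right k l m, fun k => he.alternating k⟩

end IsAlternatingBicharacter

end Bicharacter

/-! ### Pontryagin duals of products -/

namespace PontryaginDual

/-- The dual of a product is the product of the duals. -/
noncomputable def prodEquiv (A B : Type*) [CommGroup A] [TopologicalSpace A] [CommGroup B]
    [TopologicalSpace B] :
    (PontryaginDual A × PontryaginDual B) ≃ₜ* PontryaginDual (A × B) where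
  toFun p := map (ContinuousMonoidHom.fst A B) p.1 * map (ContinuousMonoidHom.snd A B) p.2
  invFun χ := (map (ContinuousMonoidHom.inl A B) χ, map (ContinuousMonoidHom.inr A B) χ)
  left_inv p := by
    refine Prod.ext (PontryaginDual.ext fun a => ?_) (PontryaginDual.ext fun b => ?_)
    · change p.1 a * p.2 1 = p.1 a
      rw [_root_.map_one, mul_one]
    · change p.1 1 * p.2 b = p.2 b
      rw [_root_.map_one, one_mul]
  right_inv χ := by
    refine PontryaginDual.ext fun a => ?_
    change χ (a.1, 1) * χ (1, a.2) = χ a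
    rw [← _root_.map_mul, Prod.mk_mul_mk, mul_one, one_mul]
  map_mul' p q := by
    simp only [Prod.fst_mul, Prod.snd_mul, _root_.map_mul]
    exact mul_mul_mul_comm _ _ _ _
  continuous_toFun := by
    exact ((map_continuous _).comp continuous_fst).mul ((map_continuous _).comp continuous_snd)
  continuous_invFun := (map_continuous _).prodMk (map_continuous _)

end PontryaginDual

/-! ### Elementary groups, liftable homomorphisms and orthogonal splitting -/

/-- The group is the product of a Euclidean space and a countable discrete group. -/
def IsEuclideanTimesDiscrete (A : Type) [CommGroup A] [TopologicalSpace A] : Prop :=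
  ∃ (V : Type) (_ : NormedAddCommGroup V) (_ : NormedSpace ℝ V) (_ : FiniteDimensional ℝ V)
    (D : Type) (_ : CommGroup D) (_ : TopologicalSpace D) (_ : DiscreteTopology D)
    (_ : Countable D), Nonempty (A ≃ₜ* Multiplicative V × D)

theorem IsEuclideanTimesDiscrete.prod {A B : Type} [CommGroup A] [TopologicalSpace A]
    [CommGroup B] [TopologicalSpace B] (hA : IsEuclideanTimesDiscrete A)
    (hB : IsEuclideanTimesDiscrete B) : IsEuclideanTimesDiscrete (A × B) := by
  obtain ⟨V, _, _, _, D, _, _, _, _, ⟨f⟩⟩ := hA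
  obtain ⟨W, _, _, _, D', _, _, _, _, ⟨g⟩⟩ := hB
  refine ⟨V × W, inferInstance, inferInstance, inferInstance, D × D', inferInstance,
    inferInstance, inferInstance, inferInstance, ⟨?_⟩⟩
  exact
    { toFun := fun p => (Multiplicative.ofAdd ((f p.1).1.toAdd, (g p.2).1.toAdd),
        ((f p.1).2, (g p.2).2))
      invFun := fun q => (f.symm (Multiplicative.ofAdd q.1.toAdd.1, q.2.1),
        g.symm (Multiplicative.ofAdd q.1.toAdd.2, q.2.2))
      left_inv := fun p => by simp
      right_inv := fun q => by simp
      map_mul' := fun p q => by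
        simp only [Prod.fst_mul, Prod.snd_mul, map_mul]
        rfl
      continuous_toFun := by
        have h1 : Continuous fun p : A × B => f p.1 := (map_continuous f).comp continuous_fst
        have h2 : Continuous fun p : A × B => g p.2 := (map_continuous g).comp continuous_snd
        exact (continuous_ofAdd.comp ((continuous_toAdd.comp h1.fst).prodMk
          (continuous_toAdd.comp h2.fst))).prodMk (h1.snd.prodMk h2.snd)
      continuous_invFun := by
        have h1 : Continuous fun q : Multiplicative (V × W) × (D × D') => q.1.toAdd :=
          continuous_toAdd.comp continuous_fst
        exact ((map_continuous f.symm).comp ((continuous_ofAdd.comp h1.fst).prodMk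
          continuous_snd.fst)).prodMk ((map_continuous g.symm).comp
            ((continuous_ofAdd.comp h1.snd).prodMk continuous_snd.snd)) }

/-- Homomorphisms from `A` with commuting lifts can be lifted along topological central extensions
by the circle. -/
def HasLifts (A : Type) [CommGroup A] [TopologicalSpace A] : Prop :=
  ∀ (K : Type u) (G : Type v) [CommGroup K] [TopologicalSpace K] [IsTopologicalGroup K] [Group G]
    [TopologicalSpace G] [IsTopologicalGroup G] [T2Space G] [LocallyCompactSpace G]
    (S : GroupExtension Circle G K), IsTopologicalCentralExtension S → ∀ α : A →ₜ* K,
    (∀ a b g h, S.rightHom g = α a → S.rightHom h = α b → Commute g h) →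
    ∃ σ : A →ₜ* G, ∀ a, S.rightHom (σ a) = α a

/-- The product of the two lifts is multiplicative because, by hypothesis, any lifts of elements in
the image of `α` commute. -/
theorem HasLifts.prod {A B : Type} [CommGroup A] [TopologicalSpace A]
    [CommGroup B] [TopologicalSpace B] (hA : HasLifts.{u, v} A) (hB : HasLifts.{u, v} B) :
    HasLifts.{u, v} (A × B) := by
  intro K G _ _ _ _ _ _ _ _ S hS α hα
  obtain ⟨σ, hσ⟩ := hA K G S hS (α.comp (ContinuousMonoidHom.inl A B))
    fun a b g h hg hh => hα _ _ g h hg hh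
  obtain ⟨τ, hτ⟩ := hB K G S hS (α.comp (ContinuousMonoidHom.inr A B))
    fun a b g h hg hh => hα _ _ g h hg hh
  refine ⟨⟨MonoidHom.mk' (fun p => σ p.1 * τ p.2) fun p q => ?_, ?_⟩, fun p => ?_⟩
  · have hc : Commute (τ p.2) (σ q.1) := hα _ _ _ _ (hτ _) (hσ _)
    simp only [Prod.fst_mul, Prod.snd_mul, map_mul]
    rw [mul_assoc, ← mul_assoc (σ q.1), ← hc.eq]
    simp only [mul_assoc]
  · exact ((map_continuous σ).comp continuous_fst).mul ((map_continuous τ).comp continuous_snd)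
  · change S.rightHom (σ p.1 * τ p.2) = α p
    rw [map_mul, hσ, hτ]
    change α (p.1, 1) * α (1, p.2) = α p
    rw [← map_mul, Prod.mk_mul_mk, mul_one, one_mul]

/-- `K` is, with its bicharacter, of the form `A × Â` for an elementary group `A`; homomorphisms
from `A` and from its dual `B` can be lifted along extensions by the circle. -/
def HasPolarization {K : Type u} [CommGroup K] [TopologicalSpace K] (e : K → K → Circle) : Prop :=
  ∃ (A B : Type) (_ : CommGroup A) (_ : TopologicalSpace A) (_ : IsTopologicalGroup A)
    (_ : CommGroup B) (_ : TopologicalSpace B) (_ : IsTopologicalGroup B)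
    (δ : B ≃ₜ* PontryaginDual A) (φ : A × B ≃ₜ* K), IsEuclideanTimesDiscrete A ∧
    HasLifts.{u, v} A ∧ HasLifts.{u, v} B ∧
    ∀ x y b c, e (φ (x, b)) (φ (y, c)) = δ c x * (δ b y)⁻¹

/-- A dual pair of isotropic subgroups splits off as an orthogonal direct factor. -/
theorem exists_orthogonal_complement {K : Type u} [CommGroup K] [TopologicalSpace K]
    [IsTopologicalGroup K] {e : K → K → Circle} (he : IsAlternatingBicharacter e)
    (hn : IsNondegenerateBicharacter e) {A B : Type} [CommGroup A] [TopologicalSpace A]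
    [IsTopologicalGroup A] [CommGroup B] [TopologicalSpace B] [IsTopologicalGroup B]
    (δ : B ≃ₜ* PontryaginDual A) (δ' : A ≃ₜ* PontryaginDual B) (hδ : ∀ a b, δ' a b = δ b a)
    (hA : IsEuclideanTimesDiscrete A) (hlA : HasLifts.{u, v} A) (hlB : HasLifts.{u, v} B)
    (α : A →ₜ* K) (β : B →ₜ* K) (hαβ : ∀ a b, e (α a) (β b) = δ b a)
    (hα : ∀ a a', e (α a) (α a') = 1) (hβ : ∀ b b', e (β b) (β b') = 1) :
    ∃ (H : Subgroup K) (r : K →ₜ* H), Function.Surjective r ∧ IsOpenMap r ∧ (∀ a, r (α a) = 1) ∧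
      (∀ b, r (β b) = 1) ∧ IsNondegenerateBicharacter (fun k l : H => e k l) ∧
      (HasPolarization.{u, v} (fun k l : H => e k l) → HasPolarization.{u, v} e) := by
  obtain ⟨flat, hflat⟩ := hn
  -- `pA k` and `pB k` are the elements of `A` and `B` representing the characters `e (k, β ·)` and
  -- `e (α ·, k)`. The inversion appears because `flat` puts `k` in the second slot.
  let pA : K →ₜ* A := (ContinuousMonoidHom.inv A).comp ((δ'.symm : PontryaginDual B →ₜ* A).comp
    ((PontryaginDual.map β).comp (flat : K →ₜ* PontryaginDual K)))
  let pB : K →ₜ* B := (δ.symm : PontryaginDual A →ₜ* B).comp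
    ((PontryaginDual.map α).comp (flat : K →ₜ* PontryaginDual K))
  have hpA : ∀ k b, δ b (pA k) = e k (β b) := by
    intro k b
    change δ b (δ'.symm (PontryaginDual.map β (flat k)))⁻¹ = _
    rw [map_inv, ← hδ, ContinuousMulEquiv.apply_symm_apply, PontryaginDual.map_apply, hflat,
      he.swap, inv_inv]
  have hpB : ∀ k a, δ (pB k) a = e (α a) k := by
    intro k a
    change δ (δ.symm (PontryaginDual.map α (flat k))) a = _
    rw [ContinuousMulEquiv.apply_symm_apply, PontryaginDual.map_apply, hflat]
  have hAext : ∀ a a' : A, (∀ b, δ b a = δ b a') → a = a' := fun a a' h =>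
    δ'.injective (PontryaginDual.ext fun b => by rw [hδ, hδ, h])
  have hBext : ∀ b b' : B, (∀ a, δ b a = δ b' a) → b = b' := fun b b' h =>
    δ.injective (PontryaginDual.ext h)
  have hAα : ∀ a, pA (α a) = a := fun a => hAext _ _ fun b => by rw [hpA, hαβ]
  have hAβ : ∀ b, pA (β b) = 1 := fun b => hAext _ _ fun b' => by rw [hpA, hβ, map_one]
  have hBβ : ∀ b, pB (β b) = b := fun b => hBext _ _ fun a => by rw [hpB, hαβ]
  have hBα : ∀ a, pB (α a) = 1 := fun a => hBext _ _ fun a' => by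
    rw [hpB, hα, map_one, PontryaginDual.one_apply]
  -- This is the common annihilator of the images of `α` and `β`.
  let H : Subgroup K := pA.toMonoidHom.ker ⊓ pB.toMonoidHom.ker
  have hH : ∀ k, k ∈ H ↔ pA k = 1 ∧ pB k = 1 := fun k => Iff.rfl
  have hHα : ∀ k ∈ H, ∀ a, e (α a) k = 1 := fun k hk a => by
    rw [← hpB, ((hH k).1 hk).2, map_one, PontryaginDual.one_apply]
  have hHβ : ∀ k ∈ H, ∀ b, e (β b) k = 1 := fun k hk b => by
    rw [he.swap, ← hpA, ((hH k).1 hk).1, map_one, inv_one]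
  have hmem : ∀ k, k * (α (pA k))⁻¹ * (β (pB k))⁻¹ ∈ H := fun k => by
    rw [hH]
    simp [hAα, hAβ, hBα, hBβ]
  -- The orthogonal projection: it divides out the components of `k` along `α` and `β`.
  let r : K →ₜ* H :=
    ⟨MonoidHom.mk' (fun k => ⟨k * (α (pA k))⁻¹ * (β (pB k))⁻¹, hmem k⟩) fun k l => Subtype.ext (by
          simp only [map_mul, mul_inv, Subgroup.coe_mul]
          rw [mul_mul_mul_comm k l, mul_mul_mul_comm]),
      Continuous.subtype_mk (by fun_prop) hmem⟩
  have hr : ∀ k, (r k : K) = k * (α (pA k))⁻¹ * (β (pB k))⁻¹ := fun k => rfl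
  have hrH : ∀ k (hk : k ∈ H), r k = ⟨k, hk⟩ := fun k hk => Subtype.ext (by
    rw [hr, ((hH k).1 hk).1, ((hH k).1 hk).2]; simp)
  let Φ : (A × B) × H ≃ₜ* K :=
    { toFun := fun p => α p.1.1 * β p.1.2 * p.2
      invFun := fun k => ((pA k, pB k), r k)
      left_inv := by
        rintro ⟨⟨a, b⟩, k, hk⟩
        have h1 : pA (α a * β b * k) = a := by
          rw [map_mul, map_mul, hAα, hAβ, ((hH k).1 hk).1, mul_one, mul_one]
        have h2 : pB (α a * β b * k) = b := by
          rw [map_mul, map_mul, hBα, hBβ, ((hH k).1 hk).2, one_mul, mul_one]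
        refine Prod.ext (Prod.ext h1 h2) (Subtype.ext ?_)
        change α a * β b * k * (α (pA (α a * β b * k)))⁻¹ * (β (pB (α a * β b * k)))⁻¹ = k
        rw [h1, h2, mul_assoc (α a * β b * k), ← mul_inv, mul_assoc, mul_comm k, ← mul_assoc,
          mul_inv_cancel, one_mul]
      right_inv := by
        intro k
        change α (pA k) * β (pB k) * (k * (α (pA k))⁻¹ * (β (pB k))⁻¹) = k
        rw [mul_assoc k, ← mul_inv, mul_comm k, mul_inv_cancel_left]
      map_mul' := by
        rintro ⟨⟨a, b⟩, k⟩ ⟨⟨a', b'⟩, k'⟩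
        simp only [Prod.mk_mul_mk, map_mul, Subgroup.coe_mul]
        rw [mul_mul_mul_comm (α a) (α a'), mul_mul_mul_comm]
      continuous_toFun := by
        have h1 : Continuous fun p : (A × B) × H => α p.1.1 :=
          (map_continuous α).comp continuous_fst.fst
        have h2 : Continuous fun p : (A × B) × H => β p.1.2 :=
          (map_continuous β).comp continuous_fst.snd
        exact (h1.mul h2).mul (continuous_subtype_val.comp continuous_snd)
      continuous_invFun :=
        ((map_continuous pA).prodMk (map_continuous pB)).prodMk (map_continuous r) }
  have her : ∀ k ∈ H, ∀ l, e k (r l) = e k l := by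
    intro k hk l
    rw [hr, he.mul_right, he.mul_right, he.inv_right, he.inv_right, he.swap (α _) k,
      he.swap (β _) k, hHα k hk, hHβ k hk]
    simp
  refine ⟨H, r, fun k => ⟨k, by rw [hrH k k.2]⟩, ?_, fun a => Subtype.ext ?_,
    fun b => Subtype.ext ?_, ?_, ?_⟩
  · have : (r : K → H) = Prod.snd ∘ Φ.symm := rfl
    rw [this]
    exact isOpenMap_snd.comp Φ.symm.toHomeomorph.isOpenMap
  · rw [hr, hAα, hBα]
    simp
  · rw [hr, hAβ, hBβ]
    simp
  -- A character of `H` is pulled back to `K` along `r`, represented there by `flat`, and its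
  -- representative projected to `H`; by `her` the projection does not change the pairing with `H`.
  · let ι : H →ₜ* K := ⟨H.subtype, continuous_subtype_val⟩
    refine ⟨{
      toFun := fun l => PontryaginDual.map ι (flat l)
      invFun := fun χ => r (flat.symm (PontryaginDual.map r χ))
      left_inv := fun l => ?_
      right_inv := fun χ => ?_
      map_mul' := fun k l => ?_
      continuous_toFun := ?_
      continuous_invFun := ?_ }, fun k l => ?_⟩
    · have : flat.symm (PontryaginDual.map r (PontryaginDual.map ι (flat l))) = l := by
        rw [ContinuousMulEquiv.symm_apply_eq]
        refine PontryaginDual.ext fun k => ?_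
        rw [PontryaginDual.map_apply, PontryaginDual.map_apply, hflat, hflat]
        change e (r k) l = e k l
        rw [he.swap l, her l l.2, ← he.swap]
      change r (flat.symm (PontryaginDual.map r (PontryaginDual.map ι (flat l)))) = l
      rw [this, hrH l l.2]
    · refine PontryaginDual.ext fun k => ?_
      rw [PontryaginDual.map_apply, hflat]
      change e k (r _) = χ k
      rw [her k k.2, ← hflat, ContinuousMulEquiv.apply_symm_apply, PontryaginDual.map_apply,
        hrH k k.2]
    · simp only [Subgroup.coe_mul, map_mul]
    · exact (map_continuous _).comp ((map_continuous flat).comp continuous_subtype_val)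
    · exact (map_continuous r).comp ((map_continuous flat.symm).comp (map_continuous _))
    · exact hflat k l
  · rintro ⟨A', B', _, _, _, _, _, _, ε, ψ, hA', hlA', hlB', hψ⟩
    let δ₂ : B × B' ≃ₜ* PontryaginDual (A × A') :=
      { toFun := fun b => PontryaginDual.prodEquiv A A' (δ b.1, ε b.2)
        invFun := fun χ => (δ.symm ((PontryaginDual.prodEquiv A A').symm χ).1,
          ε.symm ((PontryaginDual.prodEquiv A A').symm χ).2)
        left_inv := fun b => by simp
        right_inv := fun χ => by simp
        map_mul' := fun b c => by
          simp only [Prod.fst_mul, Prod.snd_mul, map_mul]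
          exact map_mul (PontryaginDual.prodEquiv A A') (δ b.1, ε b.2) (δ c.1, ε c.2)
        continuous_toFun := (map_continuous _).comp
          (((map_continuous δ).comp continuous_fst).prodMk
            ((map_continuous ε).comp continuous_snd))
        continuous_invFun := by
          have := map_continuous (PontryaginDual.prodEquiv A A').symm
          exact ((map_continuous δ.symm).comp this.fst).prodMk
            ((map_continuous ε.symm).comp this.snd) }
    let φ : (A × A') × (B × B') ≃ₜ* K :=
      { toFun := fun p => Φ ((p.1.1, p.2.1), ψ (p.1.2, p.2.2))
        invFun := fun k => (((Φ.symm k).1.1, (ψ.symm (Φ.symm k).2).1),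
          ((Φ.symm k).1.2, (ψ.symm (Φ.symm k).2).2))
        left_inv := fun p => by simp
        right_inv := fun k => by simp
        map_mul' := fun p q => by
          have h : ψ (p.1.2 * q.1.2, p.2.2 * q.2.2) = ψ (p.1.2, p.2.2) * ψ (q.1.2, q.2.2) :=
            map_mul ψ (p.1.2, p.2.2) (q.1.2, q.2.2)
          change Φ ((p.1.1 * q.1.1, p.2.1 * q.2.1), ψ (p.1.2 * q.1.2, p.2.2 * q.2.2)) = _
          rw [h]
          exact map_mul Φ ((p.1.1, p.2.1), ψ (p.1.2, p.2.2)) ((q.1.1, q.2.1), ψ (q.1.2, q.2.2))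
        continuous_toFun := (map_continuous Φ).comp
          ((continuous_fst.fst.prodMk continuous_snd.fst).prodMk
            ((map_continuous ψ).comp (continuous_fst.snd.prodMk continuous_snd.snd)))
        continuous_invFun := by
          have h1 := map_continuous Φ.symm
          have h2 := (map_continuous ψ.symm).comp h1.snd
          exact (h1.fst.fst.prodMk h2.fst).prodMk (h1.fst.snd.prodMk h2.snd) }
    refine ⟨A × A', B × B', inferInstance, inferInstance, inferInstance, inferInstance,
      inferInstance, inferInstance, δ₂, φ, hA.prod hA', hlA.prod hlA', hlB.prod hlB', ?_⟩
    rintro ⟨x, y⟩ ⟨x', y'⟩ ⟨b, c⟩ ⟨b', c'⟩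
    have h1 : e (ψ (y, c)) (ψ (y', c')) = _ := hψ y y' c c'
    set k := ψ (y, c) with hk
    set k' := ψ (y', c') with hk'
    change e (α x * β b * k) (α x' * β b' * k') = δ b' x * ε c' y * (δ b x' * ε c y')⁻¹
    simp only [he.mul_left, he.mul_right, hα, hβ, hαβ, hHα _ k'.2, hHβ _ k'.2]
    rw [he.swap (α x') k, he.swap (β b') k, he.swap (α x') (β b), hHα _ k.2, hHβ _ k.2, hαβ, h1]
    simp only [inv_one, one_mul, mul_one, mul_inv]
    rw [mul_mul_mul_comm, mul_comm (δ b x')⁻¹]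

/-! ### Topological central extensions by the circle: local sections and lifts of lines -/

section CircleExtension

open Topology Filter Set

theorem GroupExtension.exists_inl_eq {K G : Type*} [Group K] [Group G]
    (S : GroupExtension Circle G K) {g : G} (h : S.rightHom g = 1) : ∃ z, S.inl z = g := by
  have : g ∈ S.inl.range := by rw [S.range_inl_eq_ker_rightHom]; exact h
  exact this

theorem GroupExtension.rightHom_inl_eq_one {K G : Type*} [Group K] [Group G]
    (S : GroupExtension Circle G K) (z : Circle) : S.rightHom (S.inl z) = 1 := by
  have : S.inl z ∈ S.rightHom.ker := by rw [← S.range_inl_eq_ker_rightHom]; exact ⟨z, rfl⟩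
  exact this

/-- A path in a group that starts at the identity extends to the line by translation. -/
theorem continuous_fract_mul_zpow {G : Type*} [Group G] [TopologicalSpace G]
    [IsTopologicalGroup G] {s : ℝ → G}
    (hs : ContinuousOn s (Icc 0 1)) (hs0 : s 0 = 1) :
    Continuous fun t => s (Int.fract t) * s 1 ^ ⌊t⌋ := by
  set T : ℝ → G := fun t => s (Int.fract t) * s 1 ^ ⌊t⌋ with hT
  have hTint : ∀ t (n : ℤ), T (t + n) = T t * s 1 ^ n := fun t n => by
    simp only [hT, Int.fract_add_intCast, Int.floor_add_intCast, zpow_add, mul_assoc]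
  have h1 : ContinuousOn T (Icc 0 1) := by
    refine hs.congr fun t ht => ?_
    rcases ht.2.eq_or_lt with rfl | h
    · simp [hT, hs0]
    · have : ⌊t⌋ = 0 := Int.floor_eq_zero_iff.2 ⟨ht.1, h⟩
      simp [hT, this, Int.fract_eq_self.2 ⟨ht.1, h⟩]
  have h2 : ContinuousOn T (Icc (-1) 0) := by
    have h3 : ContinuousOn (fun t => T (t + 1) * (s 1)⁻¹) (Icc (-1) 0) :=
      (h1.comp (by fun_prop) fun t ht => ⟨by linarith [ht.1], by linarith [ht.2]⟩).mul
        continuousOn_const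
    refine h3.congr fun t _ => ?_
    have := hTint t 1
    rw [Int.cast_one, zpow_one] at this
    simp only [this, mul_inv_cancel_right]
  have h4 : ContinuousOn T (Icc (-1) 1) := by
    have := h2.union_of_isClosed h1 isClosed_Icc isClosed_Icc
    rwa [Icc_union_Icc_eq_Icc (by norm_num) (by norm_num)] at this
  refine continuous_iff_continuousAt.2 fun t => ?_
  have h5 : ContinuousAt (fun u => T (u - ⌊t⌋) * s 1 ^ ⌊t⌋) t := by
    refine ContinuousAt.mul ?_ continuousAt_const
    have h6 : ContinuousAt T (t - ⌊t⌋) := h4.continuousAt (Icc_mem_nhds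
      (by linarith [Int.floor_le t]) (by linarith [Int.lt_floor_add_one t]))
    exact ContinuousAt.comp (f := fun u => u - (⌊t⌋ : ℝ)) h6 (by fun_prop)
  refine h5.congr (Eventually.of_forall fun u => ?_)
  change T (u - ⌊t⌋) * s 1 ^ ⌊t⌋ = T u
  rw [← hTint, sub_add_cancel]

namespace IsTopologicalCentralExtension

variable {K : Type*} {G : Type*} [CommGroup K] [TopologicalSpace K] [Group G] [TopologicalSpace G]
  {S : GroupExtension Circle G K}

theorem inl_commute (hS : IsTopologicalCentralExtension S) (z : Circle) (g : G) :
    Commute (S.inl z) g := hS.central z g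

variable [T2Space G]

theorem isClosedEmbedding_inl (hS : IsTopologicalCentralExtension S) : IsClosedEmbedding S.inl :=
  hS.continuous_inl.isClosedEmbedding S.inl_injective

/-- An element of the extension close to the identity and over the identity is `S.inl z` with `z`
close to the identity. -/
theorem exists_nhds_of_circle_nhds (hS : IsTopologicalCentralExtension S) {W : Set Circle}
    (hW : W ∈ 𝓝 1) : ∃ U : Set G, IsOpen U ∧ 1 ∈ U ∧ ∀ z, S.inl z ∈ U → z ∈ W := by
  obtain ⟨W', hW', hW'o, h1⟩ := mem_nhds_iff.1 hW
  refine ⟨(S.inl '' W'ᶜ)ᶜ, ?_, ?_, ?_⟩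
  · exact (hS.isClosedEmbedding_inl.isClosedMap _ hW'o.isClosed_compl).isOpen_compl
  · rintro ⟨z, hz, hz'⟩
    rw [← map_one S.inl] at hz'
    exact hz (S.inl_injective hz' ▸ h1)
  · intro z hz
    by_contra hzW
    exact hz ⟨z, fun h => hzW (hW' h), rfl⟩

/-- A topological extension by the circle has a continuous equivariant function that does not
vanish at the identity. -/
theorem exists_equivariant [IsTopologicalGroup G] [LocallyCompactSpace G]
    (hS : IsTopologicalCentralExtension S) :
    ∃ f : G → ℂ, Continuous f ∧ f 1 ≠ 0 ∧ ∀ (z : Circle) g, f (S.inl z * g) = z * f g := by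
  have hW : {z : Circle | 0 < (z : ℂ).re} ∈ 𝓝 (1 : Circle) := by
    refine (isOpen_lt continuous_const
      (Complex.continuous_re.comp continuous_subtype_val)).mem_nhds ?_
    change 0 < ((1 : Circle) : ℂ).re
    simp
  obtain ⟨U, hU, h1U, hUW⟩ := hS.exists_nhds_of_circle_nhds hW
  obtain ⟨ψ, hψ1, hψ0, -, hψ⟩ := exists_continuous_one_zero_of_isCompact
    (isCompact_singleton (x := (1 : G))) hU.isClosed_compl (by simpa using h1U)
  have hψ11 : ψ 1 = 1 := hψ1 rfl
  -- The integral over `θ` projects the bump function `ψ` to its Fourier component of weight one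
  -- under the circle action.
  let F : G → ℝ → ℂ := fun g θ => (Circle.exp (-θ) : ℂ) * (ψ (S.inl (Circle.exp θ) * g) : ℂ)
  have hF : Continuous (Function.uncurry F) := by
    have h1 : Continuous fun p : G × ℝ => S.inl (Circle.exp p.2) :=
      hS.continuous_inl.comp (Circle.exp.continuous.comp continuous_snd)
    have h2 : Continuous fun p : G × ℝ => (Circle.exp (-p.2) : ℂ) :=
      continuous_subtype_val.comp (Circle.exp.continuous.comp continuous_snd.neg)
    exact h2.mul (Complex.continuous_ofReal.comp (ψ.continuous.comp (h1.mul continuous_fst)))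
  have hper : ∀ g, Function.Periodic (F g) (2 * Real.pi) := by
    intro g θ
    simp only [F]
    rw [Circle.periodic_exp θ, neg_add, ← sub_eq_add_neg, Circle.periodic_exp.sub_eq]
  refine ⟨fun g => ∫ θ in (-Real.pi)..Real.pi, F g θ, ?_, ?_, ?_⟩
  · exact intervalIntegral.continuous_parametric_intervalIntegral_of_continuous' hF _ _
  · intro h0
    have hFc : Continuous (F 1) := hF.comp (by fun_prop : Continuous fun θ : ℝ => ((1 : G), θ))
    -- The support of `ψ` only meets the circle where the cosine is positive, so at `g = 1` nothing
    -- cancels.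
    have hre : ∀ θ, (F 1 θ).re = Real.cos θ * ψ (S.inl (Circle.exp θ)) := by
      intro θ
      simp only [F, mul_one, Complex.re_mul_ofReal]
      rw [Circle.coe_exp, Complex.exp_ofReal_mul_I_re, Real.cos_neg]
    have h2 : ∫ θ in (-Real.pi)..Real.pi, (F 1 θ).re = 0 := by
      have := Complex.reCLM.intervalIntegral_comp_comm
        (hFc.intervalIntegrable (μ := volume) (-Real.pi) Real.pi)
      simp only [Complex.reCLM_apply] at this
      rw [this]
      simpa using congrArg Complex.re h0
    refine absurd h2 (ne_of_gt ?_)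
    refine intervalIntegral.integral_pos (by linarith [Real.pi_pos])
      (Complex.continuous_re.comp hFc).continuousOn ?_ ⟨0, ⟨by linarith [Real.pi_pos],
        Real.pi_pos.le⟩, ?_⟩
    · intro θ _
      rw [hre]
      by_cases hθ : S.inl (Circle.exp θ) ∈ U
      · have h3 : 0 < ((Circle.exp θ : Circle) : ℂ).re := hUW _ hθ
        rw [Circle.coe_exp, Complex.exp_ofReal_mul_I_re] at h3
        exact mul_nonneg h3.le (hψ _).1
      · have : ψ (S.inl (Circle.exp θ)) = 0 := hψ0 hθ
        rw [this, mul_zero]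
    · rw [hre]
      simp [hψ11]
  · intro z g
    obtain ⟨θ₀, rfl⟩ := Circle.exp_surjective z
    have h1 : ∀ θ, F (S.inl (Circle.exp θ₀) * g) θ = (Circle.exp θ₀ : ℂ) * F g (θ + θ₀) := by
      intro θ
      simp only [F]
      rw [← mul_assoc (S.inl _), ← map_mul, ← Circle.exp_add, ← mul_assoc, ← Circle.coe_mul,
        ← Circle.exp_add]
      congr 4
      ring
    simp only [h1]
    rw [intervalIntegral.integral_const_mul, intervalIntegral.integral_comp_add_right]
    congr 1
    have := (hper g).intervalIntegral_add_eq (-Real.pi + θ₀) (-Real.pi)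
    rw [show -Real.pi + θ₀ + 2 * Real.pi = Real.pi + θ₀ by ring,
      show -Real.pi + 2 * Real.pi = Real.pi by ring] at this
    exact this

/-- A topological central extension by the circle has a local section at the identity. -/
theorem exists_local_section [IsTopologicalGroup G] [LocallyCompactSpace G]
    (hS : IsTopologicalCentralExtension S) :
    ∃ (O : Set K) (s : K → G), IsOpen O ∧ 1 ∈ O ∧ ContinuousOn s O ∧ s 1 = 1 ∧
      ∀ k, S.rightHom (s k) = k := by
  obtain ⟨f, hf, hf1, hfz⟩ := hS.exists_equivariant
  have hPex : ∀ g, ∃ w : Circle, f g ≠ 0 → (w : ℂ) = f g / ‖f g‖ := by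
    intro g
    by_cases h : f g = 0
    · exact ⟨1, fun h' => absurd h h'⟩
    · refine ⟨⟨f g / ‖f g‖, ?_⟩, fun _ => rfl⟩
      change _ ∈ Metric.sphere (0 : ℂ) 1
      rw [mem_sphere_zero_iff_norm, norm_div, Complex.norm_real, norm_norm,
        div_self (norm_ne_zero_iff.2 h)]
  choose P hP using hPex
  have hind : IsInducing (fun z : Circle => (z : ℂ)) := ⟨rfl⟩
  have hPz : ∀ z g, f g ≠ 0 → P (S.inl z * g) = z * P g := by
    intro z g h
    have h' : f (S.inl z * g) ≠ 0 := by rw [hfz]; exact mul_ne_zero z.coe_ne_zero h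
    refine Subtype.ext ?_
    rw [Circle.coe_mul, hP _ h, hP _ h', hfz, norm_mul, Circle.norm_coe, one_mul, mul_div_assoc]
  have hPc : ∀ g, f g ≠ 0 → ContinuousAt P g := by
    intro g h
    refine hind.continuousAt_iff.2 ?_
    have h1 : ContinuousAt (fun g => f g / (‖f g‖ : ℂ)) g :=
      hf.continuousAt.div (Complex.continuous_ofReal.comp hf.norm).continuousAt
        (by simpa using h)
    refine h1.congr ?_
    filter_upwards [hf.continuousAt.eventually_ne h] with x hx
    exact (hP x hx).symm
  -- Dividing `g` by the phase of `f g` gives a map constant on the fibres of the projection where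
  -- `f` does not vanish, hence a local section.
  let q : G → G := fun g => S.inl (P g)⁻¹ * g
  have hqc : ∀ g, f g ≠ 0 → ContinuousAt q g := fun g h =>
    (hS.continuous_inl.continuousAt.comp (hPc g h).inv).mul continuousAt_id
  have hq : ∀ g g', f g ≠ 0 → S.rightHom g = S.rightHom g' → q g' = q g := by
    intro g g' h hgg
    obtain ⟨z, hz⟩ := S.exists_inl_eq (g := g' * g⁻¹) (by
      rw [map_mul, map_inv, hgg, mul_inv_cancel])
    have hg' : g' = S.inl z * g := by rw [hz, inv_mul_cancel_right]
    simp only [q]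
    rw [hg', hPz z g h, ← mul_assoc, ← map_mul, mul_inv_rev, inv_mul_cancel_right]
  let σ : K → G := Function.surjInv S.rightHom_surjective
  have hσ : ∀ k, S.rightHom (σ k) = k := Function.surjInv_eq S.rightHom_surjective
  have hqπ : ∀ g, S.rightHom (q g) = S.rightHom g := fun g => by
    simp only [q, map_mul, S.rightHom_inl_eq_one, one_mul]
  -- The constant factor normalises the section at 1; it does not change the image in `K`, since `q
  -- (σ 1)` lies over 1.
  refine ⟨S.rightHom '' {g | f g ≠ 0}, fun k => q (σ k) * (q (σ 1))⁻¹, ?_, ⟨1, hf1, map_one _⟩,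
    ?_, mul_inv_cancel _, fun k => ?_⟩
  · exact hS.isOpenQuotientMap_rightHom.isOpenMap _ (isOpen_ne_fun hf continuous_const)
  · rintro _ ⟨g, hg, rfl⟩
    refine ContinuousAt.continuousWithinAt ?_
    rw [← hS.isOpenQuotientMap_rightHom.continuousAt_comp_iff]
    refine ContinuousAt.mul ((hqc g hg).congr ?_) continuousAt_const
    filter_upwards [hf.continuousAt.eventually_ne hg] with x hx
    exact (hq x _ hx (hσ _).symm).symm
  · rw [map_mul, map_inv, hqπ, hqπ, hσ, hσ, inv_one, mul_one]

/-- A one-parameter subgroup with commuting lifts lifts to a continuous one-parameter subgroup. -/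
theorem exists_lift_real [IsTopologicalGroup G] [LocallyCompactSpace G]
    (hS : IsTopologicalCentralExtension S)
    {a : ℝ → K} (ha : Continuous a) (hadd : ∀ s t, a (s + t) = a s * a t)
    (hcomm : ∀ s t g h, S.rightHom g = a s → S.rightHom h = a t → Commute g h) :
    ∃ σ : ℝ → G, Continuous σ ∧ (∀ s t, σ (s + t) = σ s * σ t) ∧ ∀ t, S.rightHom (σ t) = a t := by
  obtain ⟨O, s, hO, h1O, hs, hs1, hsπ⟩ := hS.exists_local_section
  have ha0 : a 0 = 1 := by simpa using hadd 0 0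
  -- With arguments below π/2, the four terms of the cocycle identity cannot add up to a nonzero
  -- multiple of 2π, so the identity will hold for the real logarithms.
  have hW : {z : Circle | |Complex.arg z| < Real.pi / 2} ∈ 𝓝 (1 : Circle) := by
    have h1 : ContinuousAt (fun z : Circle => |Complex.arg z|) 1 := by
      have := Complex.continuousAt_arg (x := ((1 : Circle) : ℂ)) (by simp)
      exact (this.comp continuous_subtype_val.continuousAt).abs
    refine h1.eventually_lt continuousAt_const ?_
    simp [Real.pi_pos]
  obtain ⟨U, hU, h1U, hUW⟩ := hS.exists_nhds_of_circle_nhds hW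
  have hN : ∀ᶠ p : (G × G) × (G × G) in 𝓝 ((1, 1), (1, 1)),
      p.1.1 * p.1.2 * p.2.1⁻¹ * p.2.2⁻¹ ∈ U := by
    have : Continuous fun p : (G × G) × (G × G) => p.1.1 * p.1.2 * p.2.1⁻¹ * p.2.2⁻¹ := by
      fun_prop
    refine this.continuousAt.eventually_mem (hU.mem_nhds ?_)
    simpa using h1U
  obtain ⟨N, hN1, hN⟩ : ∃ N ∈ 𝓝 (1 : G), ∀ x ∈ N, ∀ y ∈ N, ∀ z ∈ N, ∀ w ∈ N,
      x * y * z⁻¹ * w⁻¹ ∈ U := by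
    rw [nhds_prod_eq, nhds_prod_eq, eventually_prod_self_iff'] at hN
    obtain ⟨M, hM, hMU⟩ := hN
    obtain ⟨N, hN, hNM⟩ := mem_prod_self_iff.1 hM
    exact ⟨N, hN, fun x hx y hy z hz w hw =>
      hMU (x, y) (hNM ⟨hx, hy⟩) (z, w) (hNM ⟨hz, hw⟩)⟩
  have h1N : (1 : G) ∈ N := mem_of_mem_nhds hN1
  have hnear : ∀ᶠ t in 𝓝 (0 : ℝ), a t ∈ O ∧ s (a t) ∈ N := by
    have h1 : ContinuousAt (fun t => s (a t)) 0 := by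
      refine ContinuousAt.comp (g := s) ?_ ha.continuousAt
      rw [ha0]
      exact hs.continuousAt (hO.mem_nhds h1O)
    refine (ha.continuousAt.eventually_mem (by rw [ha0]; exact hO.mem_nhds h1O)).and
      (h1.eventually_mem ?_)
    rw [ha0, hs1]
    exact hN1
  obtain ⟨ε, hε, hball⟩ := Metric.eventually_nhds_iff.1 hnear
  set δ := ε / 2 with hδ
  have hδ0 : 0 < δ := by positivity
  have hIcc : ∀ t ∈ Icc (0 : ℝ) 1, a (δ * t) ∈ O ∧ s (a (δ * t)) ∈ N := by
    intro t ht
    refine hball ?_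
    rw [Real.dist_eq, sub_zero, abs_of_nonneg (mul_nonneg hδ0.le ht.1)]
    nlinarith [ht.2]
  set s₀ : ℝ → G := fun t => s (a (δ * t)) with hs₀
  have hs₀c : ContinuousOn s₀ (Icc 0 1) :=
    hs.comp (ha.comp (continuous_const.mul continuous_id)).continuousOn fun t ht => (hIcc t ht).1
  have hs₀0 : s₀ 0 = 1 := by simp [hs₀, ha0, hs1]
  set p := s₀ 1 with hp
  have hpN : p ∈ N := (hIcc 1 ⟨zero_le_one, le_rfl⟩).2
  -- The section over a short segment is continued by powers of its endpoint. The resulting cocycle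
  -- is periodic in both variables, so smallness on one period gives smallness everywhere.
  set T : ℝ → G := fun t => s₀ (Int.fract t) * p ^ ⌊t⌋ with hT
  have hTc : Continuous T := continuous_fract_mul_zpow hs₀c hs₀0
  have hTint : ∀ t (n : ℤ), T (t + n) = T t * p ^ n := fun t n => by
    simp only [hT, Int.fract_add_intCast, Int.floor_add_intCast, zpow_add, mul_assoc]
  have hTfr : ∀ t, t ∈ Ico (0 : ℝ) 1 → T t = s₀ t := fun t ht => by
    simp [hT, Int.floor_eq_zero_iff.2 ht, Int.fract_eq_self.2 ht]
  let aHom : Multiplicative ℝ →* K :=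
    { toFun := fun t => a t.toAdd, map_one' := ha0, map_mul' := fun t u => hadd _ _ }
  have hazpow : ∀ (t : ℝ) (n : ℤ), a t ^ n = a (n * t) := fun t n => by
    have := map_zpow aHom (Multiplicative.ofAdd t) n
    rw [← ofAdd_zsmul, zsmul_eq_mul] at this
    exact this.symm
  have hTπ : ∀ t, S.rightHom (T t) = a (δ * t) := by
    intro t
    simp only [hT, hp, hs₀, map_mul, map_zpow, hsπ]
    rw [hazpow, ← hadd, mul_one, mul_comm _ δ, ← mul_add, Int.fract_add_floor]
  clear_value T
  have hpT : ∀ t, Commute p (T t) := fun t => hcomm _ _ _ _ (hsπ _) (hTπ t)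
  have hCex : ∀ q : ℝ × ℝ, ∃ z, S.inl z = T q.1 * T q.2 * (T (q.1 + q.2))⁻¹ := fun q =>
    S.exists_inl_eq (by
      rw [map_mul, map_mul, map_inv, hTπ, hTπ, hTπ, ← hadd, ← mul_add, mul_inv_cancel])
  choose C hC using hCex
  have hCmul : ∀ t u, T t * T u = S.inl (C (t, u)) * T (t + u) := fun t u => by
    rw [hC, inv_mul_cancel_right]
  have hCc : Continuous C := by
    rw [hS.isClosedEmbedding_inl.isInducing.continuous_iff]
    have : (S.inl ∘ C) = fun q : ℝ × ℝ => T q.1 * T q.2 * (T (q.1 + q.2))⁻¹ := funext hC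
    rw [this]
    exact ((hTc.comp continuous_fst).mul (hTc.comp continuous_snd)).mul
      (hTc.comp (continuous_fst.add continuous_snd)).inv
  -- The powers of `p` cancel because `p` commutes with all values of `T`.
  have hCper : ∀ t u (m n : ℤ), C (t + m, u + n) = C (t, u) := by
    intro t u m n
    refine S.inl_injective ?_
    have e1 : t + m + (u + n) = t + u + ((m + n : ℤ) : ℝ) := by push_cast; ring
    have hc : Commute (p ^ m) (T u) := (hpT u).zpow_left m
    rw [hC, hC]
    simp only [e1, hTint]
    rw [mul_assoc (T t), ← mul_assoc (p ^ m), hc.eq, mul_assoc (T u), ← zpow_add, ← mul_assoc,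
      mul_inv_rev, ← mul_assoc, mul_assoc _ (p ^ (m + n)), mul_inv_cancel, mul_one]
  have hCarg : ∀ q, |Complex.arg (C q)| < Real.pi / 2 := by
    rintro ⟨t, u⟩
    have e1 : C (t, u) = C (Int.fract t, Int.fract u) := by
      have := hCper (Int.fract t) (Int.fract u) ⌊t⌋ ⌊u⌋
      rwa [Int.fract_add_floor, Int.fract_add_floor] at this
    rw [e1]
    set t' := Int.fract t
    set u' := Int.fract u
    have ht' : t' ∈ Ico (0 : ℝ) 1 := ⟨Int.fract_nonneg t, Int.fract_lt_one t⟩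
    have hu' : u' ∈ Ico (0 : ℝ) 1 := ⟨Int.fract_nonneg u, Int.fract_lt_one u⟩
    refine hUW _ ?_
    rw [hC]
    simp only [hTfr t' ht', hTfr u' hu']
    by_cases htu : t' + u' < 1
    · have h1 : t' + u' ∈ Ico (0 : ℝ) 1 := ⟨add_nonneg ht'.1 hu'.1, htu⟩
      rw [hTfr _ h1]
      have := hN _ (hIcc t' ⟨ht'.1, ht'.2.le⟩).2 _ (hIcc u' ⟨hu'.1, hu'.2.le⟩).2 _
        (hIcc _ ⟨h1.1, h1.2.le⟩).2 1 h1N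
      rwa [inv_one, mul_one] at this
    -- When the sum passes 1, an extra factor `p` appears; this is why `N` was chosen for products
    -- of four factors.
    · have h1 : t' + u' - 1 ∈ Ico (0 : ℝ) 1 := ⟨by linarith, by linarith [ht'.2, hu'.2]⟩
      have h2 : T (t' + u') = s₀ (t' + u' - 1) * p := by
        have := hTint (t' + u' - 1) 1
        rwa [Int.cast_one, sub_add_cancel, zpow_one, hTfr _ h1] at this
      rw [h2, mul_inv_rev, ← mul_assoc]
      exact hN _ (hIcc t' ⟨ht'.1, ht'.2.le⟩).2 _ (hIcc u' ⟨hu'.1, hu'.2.le⟩).2 _ hpN _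
        (hIcc _ ⟨h1.1, h1.2.le⟩).2
  have hCco : ∀ t u w, C (t, u) * C (t + u, w) = C (u, w) * C (t, u + w) := by
    intro t u w
    refine S.inl_injective (mul_right_cancel (b := T (t + u + w)) ?_)
    rw [map_mul, map_mul, mul_assoc, ← hCmul, ← mul_assoc, ← hCmul, mul_assoc (S.inl _),
      add_assoc, ← hCmul, mul_assoc, hCmul u w, ← mul_assoc, ← mul_assoc,
      (hS.inl_commute (C (u, w)) (T t)).eq]
  set γ : ℝ × ℝ → ℝ := fun q => Complex.arg (C q) with hγ
  have hγc : Continuous γ := continuous_iff_continuousAt.2 fun q => by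
    have h1 : ((C q : Circle) : ℂ) ∈ Complex.slitPlane := by
      rw [Complex.mem_slitPlane_iff_arg]
      refine ⟨fun h => ?_, (C q).coe_ne_zero⟩
      have := hCarg q
      rw [h, abs_of_pos Real.pi_pos] at this
      linarith [Real.pi_pos]
    exact ContinuousAt.comp (f := fun q => ((C q : Circle) : ℂ)) (Complex.continuousAt_arg h1)
      (continuous_subtype_val.comp hCc).continuousAt
  have hγper : ∀ t u, γ (t, u + 1) = γ (t, u) := fun t u => by
    have := hCper t u 0 1
    simp only [Int.cast_zero, add_zero, Int.cast_one] at this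
    simp only [hγ, this]
  have hγco : ∀ t u w, γ (t, u) + γ (t + u, w) = γ (u, w) + γ (t, u + w) := by
    intro t u w
    have h1 : Circle.exp (γ (t, u) + γ (t + u, w)) = Circle.exp (γ (u, w) + γ (t, u + w)) := by
      rw [Circle.exp_add, Circle.exp_add]
      simp only [hγ, Circle.exp_arg, hCco]
    have hb := fun q => abs_lt.1 (hCarg q)
    obtain ⟨m, hm⟩ := Circle.exp_eq_exp.1 h1
    have b1 := hb (t, u)
    have b2 := hb (t + u, w)
    have b3 := hb (u, w)
    have b4 := hb (t, u + w)
    have hm0 : m = 0 := by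
      have hpi := Real.pi_pos
      have h2 : (m : ℝ) * (2 * Real.pi) < 1 * (2 * Real.pi) := by
        simp only [hγ] at hm; linarith
      have h3 : (-1 : ℝ) * (2 * Real.pi) < (m : ℝ) * (2 * Real.pi) := by
        simp only [hγ] at hm; linarith
      have h4 : (m : ℝ) < 1 := lt_of_mul_lt_mul_right h2 (by positivity)
      have h5 : (-1 : ℝ) < m := lt_of_mul_lt_mul_right h3 (by positivity)
      have h6 : m < 1 := by exact_mod_cast h4
      have h7 : -1 < m := by exact_mod_cast h5
      omega
    rw [hm, hm0]
    simp
  -- Averaging the cocycle identity over a period in the last variable exhibits `γ` as the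
  -- coboundary of `η`; periodicity removes the shift by `u`.
  set η : ℝ → ℝ := fun t => ∫ w in (0 : ℝ)..1, γ (t, w) with hη
  have hηc : Continuous η :=
    intervalIntegral.continuous_parametric_intervalIntegral_of_continuous'
      (f := fun t w => γ (t, w)) hγc 0 1
  have hηadd : ∀ t u, γ (t, u) + η (t + u) = η u + η t := by
    intro t u
    have hi : ∀ t, IntervalIntegrable (fun w => γ (t, w)) volume 0 1 := fun t =>
      (hγc.comp (by fun_prop : Continuous fun w : ℝ => (t, w))).intervalIntegrable 0 1
    have hi' : IntervalIntegrable (fun w => γ (t, u + w)) volume 0 1 :=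
      (hγc.comp (by fun_prop : Continuous fun w : ℝ => (t, u + w))).intervalIntegrable 0 1
    have h1 : ∫ w in (0 : ℝ)..1, (γ (t, u) + γ (t + u, w)) =
        ∫ w in (0 : ℝ)..1, (γ (u, w) + γ (t, u + w)) := by simp only [hγco]
    rw [intervalIntegral.integral_add (by simp) (hi _), intervalIntegral.integral_add (hi _) hi',
      intervalIntegral.integral_const, sub_zero, one_smul] at h1
    have h2 : ∫ w in (0 : ℝ)..1, γ (t, u + w) = η t := by
      rw [intervalIntegral.integral_comp_add_left (fun w => γ (t, w)) u, add_zero]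
      have hp : Function.Periodic (fun w => γ (t, w)) 1 := fun w => hγper t w
      have := hp.intervalIntegral_add_eq u 0
      rwa [zero_add] at this
    rw [h2] at h1
    exact h1
  -- Twisting by the negative of `η` cancels the cocycle, and dividing by `δ` undoes the rescaling
  -- of the line.
  refine ⟨fun t => S.inl (Circle.exp (-η (t / δ))) * T (t / δ), ?_, fun t u => ?_, fun t => ?_⟩
  · exact (hS.continuous_inl.comp (Circle.exp.continuous.comp
      (hηc.comp (by fun_prop)).neg)).mul (hTc.comp (by fun_prop))
  · simp only [add_div]
    set t' := t / δ
    set u' := u / δ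
    have h1 : -η t' + -η u' + γ (t', u') = -η (t' + u') := by linarith [hηadd t' u']
    rw [mul_assoc, ← mul_assoc (T t'), ← (hS.inl_commute _ (T t')).eq, mul_assoc, hCmul,
      ← mul_assoc, ← mul_assoc, ← map_mul, ← map_mul]
    rw [← h1, Circle.exp_add, Circle.exp_add]
    simp only [hγ, Circle.exp_arg]
  · rw [map_mul, S.rightHom_inl_eq_one, one_mul, hTπ, mul_div_cancel₀ _ hδ0.ne']

end IsTopologicalCentralExtension

end CircleExtension

/-! ### Lifting from the line, the integers, finite cyclic groups and the circle -/

section Lifts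

open Topology Filter Set

theorem hasLifts_punit : HasLifts.{u, v} PUnit := by
  intro K G _ _ _ _ _ _ _ _ S hS α hα
  refine ⟨1, fun a => ?_⟩
  change S.rightHom 1 = α 1
  rw [map_one, map_one]

theorem hasLifts_real : HasLifts.{u, v} (Multiplicative ℝ) := by
  intro K G _ _ _ _ _ _ _ _ S hS α hα
  obtain ⟨σ, hσ, hadd, hπ⟩ := hS.exists_lift_real (a := fun t => α (Multiplicative.ofAdd t))
    ((map_continuous α).comp continuous_ofAdd) (fun s t => by rw [ofAdd_add, map_mul])
    (fun s t g h => hα _ _ g h)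
  exact ⟨⟨MonoidHom.mk' (fun t => σ t.toAdd) fun s t => hadd _ _, hσ.comp continuous_toAdd⟩,
    fun t => hπ _⟩

theorem hasLifts_int : HasLifts.{u, v} (Multiplicative ℤ) := by
  intro K G _ _ _ _ _ _ _ _ S hS α hα
  obtain ⟨g, hg⟩ := S.rightHom_surjective (α (Multiplicative.ofAdd 1))
  refine ⟨⟨zpowersHom G g, continuous_of_discreteTopology⟩, fun n => ?_⟩
  change S.rightHom (g ^ n.toAdd) = α n
  rw [map_zpow, hg, ← map_zpow, ← ofAdd_zsmul]
  simp

theorem Circle.exists_pow_eq (z : Circle) {n : ℕ} (hn : n ≠ 0) : ∃ w : Circle, w ^ n = z := by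
  obtain ⟨t, rfl⟩ := Circle.exp_surjective z
  refine ⟨Circle.exp (t / n), ?_⟩
  rw [← Circle.exp_natCast_mul, mul_div_cancel₀ _ (by exact_mod_cast hn)]

/-- The circle is divisible: a preimage of the generator has its `n`-th power in the circle, and a
central `n`-th root corrects it to an element of exponent `n`. -/
theorem hasLifts_zmod (n : ℕ) [NeZero n] [TopologicalSpace (ZMod n)] [DiscreteTopology (ZMod n)] :
    HasLifts.{u, v} (Multiplicative (ZMod n)) := by
  intro K G _ _ _ _ _ _ _ _ S hS α hα
  obtain ⟨g, hg⟩ := S.rightHom_surjective (α (Multiplicative.ofAdd 1))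
  have hαn : ∀ m : ℕ, α (Multiplicative.ofAdd 1) ^ m = α (Multiplicative.ofAdd (m : ZMod n)) := by
    intro m
    rw [← map_pow, ← ofAdd_nsmul, nsmul_one]
  obtain ⟨z, hz⟩ := S.exists_inl_eq (g := g ^ n) (by
    rw [map_pow, hg, hαn, ZMod.natCast_self, ofAdd_zero, map_one])
  obtain ⟨w, hw⟩ := Circle.exists_pow_eq z⁻¹ (NeZero.ne n)
  have hpow : (S.inl w * g) ^ n = 1 := by
    rw [(hS.inl_commute w g).mul_pow, ← map_pow, hw, ← hz, ← map_mul, inv_mul_cancel, map_one]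
  refine ⟨⟨MonoidHom.mk' (fun a => (S.inl w * g) ^ a.toAdd.val) fun a b => ?_,
    continuous_of_discreteTopology⟩, fun a => ?_⟩
  · rw [toAdd_mul, ZMod.val_add, ← pow_eq_pow_mod _ hpow, pow_add]
  · change S.rightHom ((S.inl w * g) ^ a.toAdd.val) = α a
    rw [map_pow, map_mul, S.rightHom_inl_eq_one, one_mul, hg, hαn, ZMod.natCast_zmod_val]
    rfl

theorem Circle.isQuotientMap_exp : IsQuotientMap Circle.exp :=
  isLocalHomeomorph_circleExp.isOpenMap.isQuotientMap Circle.exp.continuous Circle.exp_surjective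

/-- A one-parameter subgroup of period `2π` factors through the circle. -/
theorem exists_circleHom {G : Type*} [Group G] [TopologicalSpace G] {τ : ℝ → G}
    (hτ : Continuous τ) (hadd : ∀ s t, τ (s + t) = τ s * τ t) (hpi : τ (2 * Real.pi) = 1) :
    ∃ σ : Circle →ₜ* G, ∀ t, σ (Circle.exp t) = τ t := by
  have hτ0 : τ 0 = 1 := by simpa using hadd 0 0
  let τHom : Multiplicative ℝ →* G :=
    { toFun := fun t => τ t.toAdd, map_one' := hτ0, map_mul' := fun s t => hadd _ _ }
  have hint : ∀ m : ℤ, τ (m * (2 * Real.pi)) = 1 := fun m => by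
    have := map_zpow τHom (Multiplicative.ofAdd (2 * Real.pi)) m
    rw [← ofAdd_zsmul, zsmul_eq_mul] at this
    refine this.trans ?_
    change τ (2 * Real.pi) ^ m = 1
    rw [hpi, one_zpow]
  have hσ : ∀ t, τ (Complex.arg (Circle.exp t)) = τ t := by
    intro t
    obtain ⟨m, hm⟩ := Circle.exp_eq_exp.1 (Circle.exp_arg (Circle.exp t))
    rw [hm, hadd, hint, mul_one]
  refine ⟨⟨MonoidHom.mk' (fun w : Circle => τ (Complex.arg w)) fun w w' => ?_, ?_⟩, hσ⟩
  · obtain ⟨s, rfl⟩ := Circle.exp_surjective w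
    obtain ⟨t, rfl⟩ := Circle.exp_surjective w'
    rw [← Circle.exp_add, hσ, hσ, hσ, hadd]
  · refine Circle.isQuotientMap_exp.continuous_iff.2 ?_
    exact hτ.congr fun t => (hσ t).symm

/-- The lift of the line covering the circle ends, after time 2π, at some `exp θ` in the centre.
Multiplying by a central one-parameter subgroup that undoes `θ` closes it up. -/
theorem hasLifts_circle : HasLifts.{u, v} Circle := by
  intro K G _ _ _ _ _ _ _ _ S hS α hα
  obtain ⟨ρ, hρ, hadd, hπ⟩ := hS.exists_lift_real (a := fun t => α (Circle.exp t))
    ((map_continuous α).comp Circle.exp.continuous) (fun s t => by rw [Circle.exp_add, map_mul])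
    (fun s t g h => hα _ _ g h)
  obtain ⟨z, hz⟩ := S.exists_inl_eq (g := ρ (2 * Real.pi)) (by
    rw [hπ, Circle.exp_two_pi, map_one])
  obtain ⟨θ, rfl⟩ := Circle.exp_surjective z
  have hpi : (2 * Real.pi) ≠ 0 := by positivity
  obtain ⟨σ, hσ⟩ := exists_circleHom
    (τ := fun t => S.inl (Circle.exp (-(θ * (t / (2 * Real.pi))))) * ρ t)
    ((hS.continuous_inl.comp (Circle.exp.continuous.comp (by fun_prop))).mul hρ)
    (fun s t => by
      rw [mul_assoc, ← mul_assoc (ρ s), ← (hS.inl_commute _ (ρ s)).eq, mul_assoc, ← mul_assoc,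
        ← map_mul, ← Circle.exp_add, hadd]
      congr 3
      ring_nf)
    (by rw [div_self hpi, mul_one, ← hz, ← map_mul, ← Circle.exp_add, neg_add_cancel,
      Circle.exp_zero, map_one])
  refine ⟨σ, fun w => ?_⟩
  obtain ⟨t, rfl⟩ := Circle.exp_surjective w
  rw [hσ, map_mul, S.rightHom_inl_eq_one, one_mul, hπ]

end Lifts

/-! ### Characters of vector spaces and the duals of the building blocks -/

section Characters

open Topology Filter Set

/-- A unitary character of a real vector space is the exponential of a linear form. -/
theorem exists_linear_of_character {V : Type*} [NormedAddCommGroup V] [NormedSpace ℝ V]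
    {χ : V → Circle} (hχ : Continuous χ) (hadd : ∀ v w, χ (v + w) = χ v * χ w) :
    ∃ l : V →L[ℝ] ℝ, ∀ v, χ v = Circle.exp (2 * Real.pi * l v) := by
  have h0 : χ 0 = 1 := by simpa using hadd 0 0
  -- The character lifts through the covering of the circle by the line; additivity of the lift
  -- follows from its uniqueness.
  obtain ⟨F, ⟨hF0, hF⟩, huniq⟩ := Circle.isCoveringMap_exp.existsUnique_continuousMap_lifts
    (⟨χ, hχ⟩ : C(V, Circle)) 0 0 (by simp [h0])
  have hFχ : ∀ v, Circle.exp (F v) = χ v := fun v => congrFun hF v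
  have hFadd : ∀ v w, F (v + w) = F v + F w := by
    intro v w
    have h1 := huniq ⟨fun v => F (v + w) - F w, by fun_prop⟩ ⟨by simp, by
      funext v
      change Circle.exp (F (v + w) - F w) = χ v
      rw [Circle.exp_sub, hFχ, hFχ, hadd, mul_div_cancel_right]⟩
    have h2 : F (v + w) - F w = F v := congrArg (fun f : C(V, ℝ) => f v) h1
    linarith
  let L : V →L[ℝ] ℝ := AddMonoidHom.toRealLinearMap
    ⟨⟨F, hF0⟩, hFadd⟩ F.continuous
  refine ⟨(2 * Real.pi)⁻¹ • L, fun v => ?_⟩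
  have hpi : (2 * Real.pi) ≠ 0 := by positivity
  rw [smul_apply, smul_eq_mul, mul_inv_cancel_left₀ hpi]
  exact (hFχ v).symm

/-- A continuous bijective homomorphism onto the Pontryagin dual is a homeomorphism if its source
is `σ`-compact. -/
theorem exists_continuousMulEquiv_pontryaginDual {A B : Type*} [CommGroup A] [TopologicalSpace A]
    [IsTopologicalGroup A] [LocallyCompactSpace A] [CommGroup B] [TopologicalSpace B]
    [IsTopologicalGroup B] [SigmaCompactSpace B] (f : B →* PontryaginDual A) (hf : Continuous f)
    (hb : Function.Bijective f) : ∃ δ : B ≃ₜ* PontryaginDual A, ∀ b, δ b = f b := by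
  -- This is the open mapping theorem for `σ`-compact groups.
  have ho : IsOpenMap f := MonoidHom.isOpenMap_of_sigmaCompact f hb.2 hf
  exact ⟨⟨MulEquiv.ofBijective f hb, hf,
    ((Equiv.ofBijective f hb).toHomeomorphOfContinuousOpen hf ho).symm.continuous⟩, fun _ => rfl⟩

/-- The bimultiplicative pairing `p` as a homomorphism to the dual. -/
noncomputable def pairingHom {A B : Type*} [CommGroup A] [TopologicalSpace A] [CommGroup B]
    (p : B → A → Circle) (hl : ∀ b b' a, p (b * b') a = p b a * p b' a)
    (hr : ∀ b a a', p b (a * a') = p b a * p b a') (hc : ∀ b, Continuous (p b)) :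
    B →* PontryaginDual A :=
  MonoidHom.mk' (fun b => (⟨MonoidHom.mk' (p b) (hr b), hc b⟩ : A →ₜ* Circle)) fun b b' =>
    PontryaginDual.ext fun a => hl b b' a

theorem continuous_pairingHom {A B : Type*} [CommGroup A] [TopologicalSpace A] [CommGroup B]
    [TopologicalSpace B]
    (p : B → A → Circle) (hl : ∀ b b' a, p (b * b') a = p b a * p b' a)
    (hr : ∀ b a a', p b (a * a') = p b a * p b a') (hc : ∀ b, Continuous (p b))
    (hp : Continuous (Function.uncurry p)) : Continuous (pairingHom p hl hr hc) :=
  ContinuousMonoidHom.continuous_of_continuous_uncurry _ hp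

theorem exists_dualEquiv_real :
    ∃ δ : Multiplicative ℝ ≃ₜ* PontryaginDual (Multiplicative ℝ),
      ∀ s t, δ s t = Circle.exp (2 * Real.pi * (s.toAdd * t.toAdd)) := by
  have : LocallyCompactSpace (Multiplicative ℝ) := inferInstanceAs (LocallyCompactSpace ℝ)
  have : SigmaCompactSpace (Multiplicative ℝ) := inferInstanceAs (SigmaCompactSpace ℝ)
  let p : Multiplicative ℝ → Multiplicative ℝ → Circle :=
    fun s t => Circle.exp (2 * Real.pi * (s.toAdd * t.toAdd))
  have hp : Continuous (Function.uncurry p) := Circle.exp.continuous.comp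
    (continuous_const.mul ((continuous_toAdd.comp continuous_fst).mul
      (continuous_toAdd.comp continuous_snd)))
  let f := pairingHom p
    (fun b b' a => by simp only [p, toAdd_mul, add_mul, mul_add, Circle.exp_add])
    (fun b b' a => by simp only [p, toAdd_mul, mul_add, Circle.exp_add])
    (fun b => hp.comp (by fun_prop : Continuous fun a => (b, a)))
  have hfp : ∀ s t, f s t = p s t := fun _ _ => rfl
  have hpi := Real.pi_pos
  suffices hb : Function.Bijective f by
    obtain ⟨δ, hδ⟩ := exists_continuousMulEquiv_pontryaginDual f
      (continuous_pairingHom _ _ _ _ hp) hb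
    exact ⟨δ, fun s t => by rw [hδ]; rfl⟩
  refine ⟨?_, ?_⟩
  · refine (injective_iff_map_eq_one f).2 fun s hs => ?_
    by_contra hne
    have hs0 : s.toAdd ≠ 0 := fun h => hne (toAdd_eq_zero.1 h)
    -- This argument makes the pairing `exp π`, which is −1.
    have h1 : f s (Multiplicative.ofAdd (1 / (2 * s.toAdd))) = 1 := by
      rw [hs, PontryaginDual.one_apply]
    have h2 : Circle.exp Real.pi = 1 := by
      rw [← h1, hfp]
      simp only [p, toAdd_ofAdd]
      congr 1
      field_simp
    obtain ⟨m, hm⟩ := Circle.exp_eq_one.1 h2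
    have h3 : (1 : ℝ) = 2 * m := by
      have : Real.pi * 1 = Real.pi * (2 * m) := by linarith
      exact mul_left_cancel₀ hpi.ne' this
    have h4 : (1 : ℤ) = 2 * m := by exact_mod_cast h3
    omega
  · intro χ
    obtain ⟨l, hl⟩ := exists_linear_of_character (χ := fun t => χ (Multiplicative.ofAdd t))
      ((map_continuous χ).comp continuous_ofAdd) (fun s t => by rw [ofAdd_add, map_mul])
    refine ⟨Multiplicative.ofAdd (l 1), PontryaginDual.ext fun t => ?_⟩
    rw [hfp]
    refine Eq.trans ?_ (hl t.toAdd).symm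
    simp only [p, toAdd_ofAdd]
    have : l t.toAdd = t.toAdd * l 1 := by
      rw [← smul_eq_mul, ← map_smul, smul_eq_mul, mul_one]
    rw [this, mul_comm (l 1)]

theorem exists_dualEquiv_int_circle :
    ∃ (δ : Circle ≃ₜ* PontryaginDual (Multiplicative ℤ))
      (δ' : Multiplicative ℤ ≃ₜ* PontryaginDual Circle),
      (∀ z n, δ z n = z ^ n.toAdd) ∧ ∀ n z, δ' n z = z ^ n.toAdd := by
  have : LocallyCompactSpace (Multiplicative ℤ) := inferInstanceAs (LocallyCompactSpace ℤ)
  have : SigmaCompactSpace (Multiplicative ℤ) := inferInstanceAs (SigmaCompactSpace ℤ)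
  let f : Circle →* PontryaginDual (Multiplicative ℤ) :=
    pairingHom (fun z n => z ^ n.toAdd) (fun z z' n => mul_zpow _ _ _)
      (fun z n n' => zpow_add _ _ _)
      (fun z => continuous_of_discreteTopology)
  let g : Multiplicative ℤ →* PontryaginDual Circle :=
    pairingHom (fun n z => z ^ n.toAdd) (fun n n' z => zpow_add _ _ _)
      (fun n z z' => mul_zpow _ _ _)
      (fun n => continuous_zpow _)
  have hfc : Continuous f := continuous_pairingHom _ _ _ _
    (continuous_prod_of_discrete_right.2 fun n => continuous_zpow n.toAdd)
  suffices hb : Function.Bijective f ∧ Function.Bijective g by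
    obtain ⟨δ, hδ⟩ := exists_continuousMulEquiv_pontryaginDual f hfc hb.1
    obtain ⟨δ', hδ'⟩ := exists_continuousMulEquiv_pontryaginDual g
      continuous_of_discreteTopology hb.2
    exact ⟨δ, δ', fun z n => by rw [hδ]; rfl, fun n z => by rw [hδ']; rfl⟩
  refine ⟨⟨?_, ?_⟩, ⟨?_, ?_⟩⟩
  · refine (injective_iff_map_eq_one f).2 fun z hz => ?_
    have h1 : f z (Multiplicative.ofAdd 1) = 1 := by rw [hz, PontryaginDual.one_apply]
    change z ^ (1 : ℤ) = 1 at h1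
    simpa using h1
  · intro χ
    refine ⟨χ (Multiplicative.ofAdd 1), PontryaginDual.ext fun n => ?_⟩
    change χ (Multiplicative.ofAdd 1) ^ n.toAdd = χ n
    rw [← map_zpow, ← ofAdd_zsmul]
    simp
  · refine (injective_iff_map_eq_one g).2 fun n hn => ?_
    -- `exp 1` has infinite order because π is irrational, so it separates the integers.
    have h1 : g n (Circle.exp 1) = 1 := by rw [hn, PontryaginDual.one_apply]
    change Circle.exp 1 ^ n.toAdd = 1 at h1
    rw [← Circle.exp_intCast_mul, mul_one] at h1
    obtain ⟨m, hm⟩ := Circle.exp_eq_one.1 h1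
    by_contra hne
    have hn0 : n.toAdd ≠ 0 := fun h => hne (toAdd_eq_zero.1 h)
    have hm0 : (m : ℝ) ≠ 0 := by
      rintro h
      rw [h, zero_mul] at hm
      exact hn0 (by exact_mod_cast hm)
    refine irrational_pi ⟨(n.toAdd : ℚ) / (2 * m), ?_⟩
    push_cast
    rw [hm]
    field_simp
  · intro χ
    obtain ⟨l, hl⟩ := exists_linear_of_character (χ := fun t => χ (Circle.exp t))
      ((map_continuous χ).comp Circle.exp.continuous) (fun s t => by rw [Circle.exp_add, map_mul])
    have hl' : ∀ t, l t = t * l 1 := fun t => by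
      rw [← smul_eq_mul, ← map_smul, smul_eq_mul, mul_one]
    -- Triviality at 2π forces the slope of `l` to be an integer divided by 2π; that integer is the
    -- exponent sought.
    have h1 : Circle.exp (2 * Real.pi * l (2 * Real.pi)) = 1 := by
      rw [← hl, Circle.exp_two_pi, map_one]
    obtain ⟨m, hm⟩ := Circle.exp_eq_one.1 h1
    have hpi : (2 * Real.pi) ≠ 0 := by positivity
    have hm' : l (2 * Real.pi) = m := mul_left_cancel₀ hpi (hm.trans (mul_comm _ _))
    rw [hl'] at hm'
    refine ⟨Multiplicative.ofAdd m, PontryaginDual.ext fun z => ?_⟩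
    obtain ⟨t, rfl⟩ := Circle.exp_surjective z
    rw [hl]
    change Circle.exp t ^ m = _
    rw [← Circle.exp_intCast_mul, ← hm', hl' t]
    congr 1
    ring

theorem exists_dualEquiv_zmod (n : ℕ) [NeZero n] [TopologicalSpace (ZMod n)]
    [DiscreteTopology (ZMod n)] :
    ∃ δ : Multiplicative (ZMod n) ≃ₜ* PontryaginDual (Multiplicative (ZMod n)),
      ∀ a b, δ a b = ZMod.toCircle (a.toAdd * b.toAdd) := by
  have : DiscreteTopology (Multiplicative (ZMod n)) := inferInstanceAs (DiscreteTopology (ZMod n))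
  have : Finite (Multiplicative (ZMod n)) := inferInstanceAs (Finite (ZMod n))
  let f : Multiplicative (ZMod n) →* PontryaginDual (Multiplicative (ZMod n)) :=
    pairingHom (fun a b => ZMod.toCircle (a.toAdd * b.toAdd))
      (fun a a' b => by simp only [toAdd_mul, add_mul, AddChar.map_add_eq_mul])
      (fun a b b' => by simp only [toAdd_mul, mul_add, AddChar.map_add_eq_mul])
      (fun a => continuous_of_discreteTopology)
  suffices hb : Function.Bijective f by
    obtain ⟨δ, hδ⟩ := exists_continuousMulEquiv_pontryaginDual f continuous_of_discreteTopology hb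
    exact ⟨δ, fun s t => by rw [hδ]; rfl⟩
  refine ⟨?_, ?_⟩
  · refine (injective_iff_map_eq_one f).2 fun a ha => ?_
    have h1 : f a (Multiplicative.ofAdd 1) = 1 := by rw [ha, PontryaginDual.one_apply]
    change ZMod.toCircle (a.toAdd * 1) = 1 at h1
    rw [mul_one, ← AddChar.map_zero_eq_one (ZMod.toCircle (N := n))] at h1
    exact toAdd_eq_zero.1 (ZMod.injective_toCircle h1)
  · intro χ
    have hχ : ∀ b, χ b = χ (Multiplicative.ofAdd 1) ^ b.toAdd.val := fun b => by
      rw [← map_pow, ← ofAdd_nsmul, nsmul_one, ZMod.natCast_zmod_val]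
      rfl
    have h1 : χ (Multiplicative.ofAdd 1) ^ n = 1 := by
      rw [← map_pow, ← ofAdd_nsmul, nsmul_one, ZMod.natCast_self, ofAdd_zero, map_one]
    obtain ⟨t, ht⟩ := Circle.exp_surjective (χ (Multiplicative.ofAdd 1))
    rw [← ht, ← Circle.exp_natCast_mul] at h1
    obtain ⟨m, hm⟩ := Circle.exp_eq_one.1 h1
    have hn : (n : ℝ) ≠ 0 := by exact_mod_cast NeZero.ne n
    have h2 : ZMod.toCircle (m : ZMod n) = χ (Multiplicative.ofAdd 1) := by
      rw [← ht]
      refine Circle.ext ?_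
      rw [ZMod.toCircle_intCast, Circle.coe_exp]
      have : t = m * (2 * Real.pi) / n := by rw [← hm]; field_simp
      rw [this]
      congr 1
      push_cast
      ring
    refine ⟨Multiplicative.ofAdd (m : ZMod n), PontryaginDual.ext fun b => ?_⟩
    change ZMod.toCircle ((m : ZMod n) * b.toAdd) = χ b
    rw [hχ b, ← h2, ← AddChar.map_nsmul_eq_pow, nsmul_eq_mul, ZMod.natCast_zmod_val, mul_comm]

end Characters

/-! ### Basic examples of elementary groups -/

section Elementary

theorem isEuclideanTimesDiscrete_of_discrete (D : Type) [CommGroup D] [TopologicalSpace D]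
    [DiscreteTopology D] [Countable D] : IsEuclideanTimesDiscrete D :=
  ⟨Fin 0 → ℝ, inferInstance, inferInstance, inferInstance, D, inferInstance, inferInstance,
    inferInstance, inferInstance,
    ⟨{ toFun := fun d => (1, d)
       invFun := Prod.snd
       left_inv := fun _ => rfl
       right_inv := fun p => Prod.ext (Multiplicative.toAdd.injective (Subsingleton.elim _ _)) rfl
       map_mul' := fun d d' => by rw [Prod.mk_mul_mk, one_mul]
       continuous_toFun := by fun_prop
       continuous_invFun := continuous_snd }⟩⟩

theorem isEuclideanTimesDiscrete_real : IsEuclideanTimesDiscrete (Multiplicative ℝ) :=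
  ⟨ℝ, inferInstance, inferInstance, inferInstance, PUnit, inferInstance, inferInstance,
    inferInstance, inferInstance,
    ⟨{ toFun := fun d => (d, 1)
       invFun := Prod.fst
       left_inv := fun _ => rfl
       right_inv := fun p => Prod.ext rfl (Subsingleton.elim _ _)
       map_mul' := fun d d' => by rw [Prod.mk_mul_mk, one_mul]
       continuous_toFun := by fun_prop
       continuous_invFun := continuous_fst }⟩⟩

end Elementary

/-! ### Polarization of finite groups -/

section Finite

theorem hasPolarization_of_subsingleton {K : Type u} [CommGroup K] [TopologicalSpace K]
    [Subsingleton K] {e : K → K → Circle} (he : IsAlternatingBicharacter e) :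
    HasPolarization.{u, v} e := by
  have : Subsingleton (PontryaginDual PUnit) := ⟨fun χ ψ => PontryaginDual.ext fun a => by
    rw [Subsingleton.elim a 1, map_one, map_one]⟩
  let δ : PUnit ≃ₜ* PontryaginDual PUnit :=
    { toFun := fun _ => 1
      invFun := fun _ => 1
      left_inv := fun _ => rfl
      right_inv := fun _ => Subsingleton.elim _ _
      map_mul' := fun _ _ => (one_mul 1).symm
      continuous_toFun := continuous_const
      continuous_invFun := continuous_const }
  let φ : PUnit × PUnit ≃ₜ* K :=
    { toFun := fun _ => 1
      invFun := fun _ => 1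
      left_inv := fun _ => rfl
      right_inv := fun _ => Subsingleton.elim _ _
      map_mul' := fun _ _ => (one_mul 1).symm
      continuous_toFun := continuous_const
      continuous_invFun := continuous_const }
  refine ⟨PUnit, PUnit, inferInstance, inferInstance, inferInstance, inferInstance, inferInstance,
    inferInstance, δ, φ, isEuclideanTimesDiscrete_of_discrete _, hasLifts_punit, hasLifts_punit,
    fun x x' b b' => ?_⟩
  change e 1 1 = (1 : PontryaginDual PUnit) x * ((1 : PontryaginDual PUnit) x')⁻¹
  rw [he.one_left, PontryaginDual.one_apply, inv_one, mul_one]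

/-- An element of maximal order pairs with some element to a primitive root of unity. -/
theorem exists_pairing_eq_toCircle {K : Type*} [CommGroup K] [TopologicalSpace K] [Finite K]
    {e : K → K → Circle} (he : IsAlternatingBicharacter e) (hn : IsNondegenerateBicharacter e)
    {n : ℕ} [NeZero n] {x : K} (hx : orderOf x = n) :
    ∃ y, e x y = ZMod.toCircle (1 : ZMod n) := by
  obtain ⟨flat, hflat⟩ := hn
  let Q : Subgroup Circle := (he.rightHom x).range
  have : Finite Q := Set.finite_range (he.rightHom x)
  have hxn : x ^ n = 1 := hx ▸ pow_orderOf_eq_one x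
  -- `Q` is the group of values of `e (x, ·)`. By non-degeneracy its order kills `x`, so it has at
  -- least `n` elements; as it lies among the `n`-th roots of unity, it contains all of them.
  have hd : n ∣ Nat.card Q := by
    rw [← hx]
    refine orderOf_dvd_of_pow_eq_one ?_
    have h1 : ∀ y, e (x ^ Nat.card Q) y = 1 := fun y => by
      rw [he.pow_left]
      have h2 : (⟨e x y, y, rfl⟩ : Q) ^ Nat.card Q = 1 := pow_card_eq_one'
      exact congrArg Subtype.val h2
    refine flat.injective (PontryaginDual.ext fun k => ?_)
    rw [hflat, he.swap, h1, map_one, PontryaginDual.one_apply, inv_one]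
  have hle : n ≤ Nat.card Q := Nat.le_of_dvd Nat.card_pos hd
  have hsub : (Q : Set Circle) ⊆ Set.range (ZMod.toCircle (N := n)) := by
    rintro _ ⟨y, rfl⟩
    change e x y ∈ _
    have h1 : e x y ^ n = 1 := by rw [← he.pow_left, hxn, he.one_left]
    obtain ⟨t, ht⟩ := Circle.exp_surjective (e x y)
    rw [← ht, ← Circle.exp_natCast_mul] at h1
    obtain ⟨m, hm⟩ := Circle.exp_eq_one.1 h1
    have hn : (n : ℝ) ≠ 0 := by exact_mod_cast NeZero.ne n
    refine ⟨(m : ZMod n), ?_⟩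
    rw [← ht]
    refine Circle.ext ?_
    rw [ZMod.toCircle_intCast, Circle.coe_exp]
    have : t = m * (2 * Real.pi) / n := by rw [← hm]; field_simp
    rw [this]
    congr 1
    push_cast
    ring
  have heq : (Q : Set Circle) = Set.range (ZMod.toCircle (N := n)) := by
    refine Set.eq_of_subset_of_ncard_le hsub ?_ (Set.finite_range _)
    refine le_trans ?_ hle
    rw [← Set.image_univ]
    refine (Set.ncard_image_le Set.finite_univ).trans ?_
    rw [Set.ncard_univ, Nat.card_zmod]
  have h1 : ZMod.toCircle (1 : ZMod n) ∈ (Q : Set Circle) := heq ▸ ⟨1, rfl⟩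
  exact h1

/-- The homomorphism from `ℤ/n` sending `1` to an element of order dividing `n`. -/
noncomputable def zmodHom {K : Type*} [CommGroup K] [TopologicalSpace K] (n : ℕ) [NeZero n] (x : K)
    (hx : x ^ n = 1) : Multiplicative (ZMod n) →ₜ* K :=
  ⟨MonoidHom.mk' (fun a => x ^ a.toAdd.val) fun a b => by
    rw [toAdd_mul, ZMod.val_add, ← pow_eq_pow_mod _ hx, pow_add],
    (have : DiscreteTopology (Multiplicative (ZMod n)) :=
      inferInstanceAs (DiscreteTopology (ZMod n))
     continuous_of_discreteTopology)⟩

theorem hasPolarization_of_finite (m : ℕ) : ∀ (K : Type u) [CommGroup K] [TopologicalSpace K]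
    [IsTopologicalGroup K] [Finite K] (e : K → K → Circle),
    IsAlternatingBicharacter e → IsNondegenerateBicharacter e → Nat.card K ≤ m →
    HasPolarization.{u, v} e := by
  induction m with
  | zero =>
    intro K _ _ _ _ e he hn hm
    have : 0 < Nat.card K := Nat.card_pos
    omega
  | succ m ih =>
    intro K _ _ _ _ e he hn hm
    rcases subsingleton_or_nontrivial K with hK | hK
    · exact hasPolarization_of_subsingleton he
    -- Taking the order of `x` to be the exponent guarantees that its partner `y` also satisfies `y
    -- ^ n = 1`, so both define homomorphisms from ℤ/n.
    obtain ⟨x, hx⟩ := Monoid.exists_orderOf_eq_exponent (G := K) Monoid.ExponentExists.of_finite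
    set n := Monoid.exponent K with hndef
    have hn0 : n ≠ 0 := Monoid.exponent_ne_zero_of_finite
    have : NeZero n := ⟨hn0⟩
    obtain ⟨y, hy⟩ := exists_pairing_eq_toCircle he hn hx
    have hpow : ∀ k : K, k ^ n = 1 := Monoid.pow_exponent_eq_one
    obtain ⟨δ, hδ⟩ := exists_dualEquiv_zmod n
    have : DiscreteTopology (Multiplicative (ZMod n)) :=
      inferInstanceAs (DiscreteTopology (ZMod n))
    have : Countable (Multiplicative (ZMod n)) := inferInstanceAs (Countable (ZMod n))
    obtain ⟨H, r, hr, -, hrx, -, hnH, hpol⟩ := exists_orthogonal_complement he hn δ δ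
      (fun a b => by rw [hδ, hδ, mul_comm])
      (isEuclideanTimesDiscrete_of_discrete _) (hasLifts_zmod n) (hasLifts_zmod n)
      (zmodHom n x (hpow x)) (zmodHom n y (hpow y))
      (fun a b => by
        change e (x ^ a.toAdd.val) (y ^ b.toAdd.val) = _
        rw [he.pow_left, he.pow_right, hy, hδ, ← pow_mul, ← AddChar.map_nsmul_eq_pow, nsmul_one,
          Nat.cast_mul, ZMod.natCast_zmod_val, ZMod.natCast_zmod_val])
      (fun a b => by
        change e (x ^ a.toAdd.val) (x ^ b.toAdd.val) = _
        rw [he.pow_left, he.pow_right, he.alternating, one_pow, one_pow])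
      (fun a b => by
        change e (y ^ a.toAdd.val) (y ^ b.toAdd.val) = _
        rw [he.pow_left, he.pow_right, he.alternating, one_pow, one_pow])
    refine hpol (ih H _ (he.restrict H) hnH ?_)
    have hx1 : x ≠ 1 := by
      intro h
      rw [h, orderOf_one] at hx
      obtain ⟨k, hk⟩ := exists_ne (1 : K)
      refine hk ?_
      have := hpow k
      rwa [← hx, pow_one] at this
    have hrx1 : r x = 1 := by
      have h1 : (zmodHom n x (hpow x)) (Multiplicative.ofAdd ((1 : ℕ) : ZMod n)) = x := by
        change x ^ ((1 : ℕ) : ZMod n).val = x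
        rw [ZMod.val_natCast, ← pow_eq_pow_mod _ (hpow x), pow_one]
      rw [← h1]
      exact hrx _
    -- The projection onto `H` kills the nontrivial element `x`.
    have hlt : Nat.card H < Nat.card K := by
      cases nonempty_fintype K
      have : Fintype H := Fintype.ofFinite H
      rw [Nat.card_eq_fintype_card, Nat.card_eq_fintype_card]
      refine Fintype.card_lt_of_surjective_not_injective r hr fun hinj => hx1 (hinj ?_)
      rw [hrx1, map_one]
    omega

end Finite

/-! ### Compactness and finiteness from self-duality -/

section Compact

open Topology Set

variable {K : Type*} [CommGroup K] [TopologicalSpace K] {e : K → K → Circle}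

/-- The dual of a discrete group is compact, and here it is isomorphic to the group itself. -/
theorem finite_of_discreteTopology_of_nondegenerate [DiscreteTopology K]
    (hn : IsNondegenerateBicharacter e) : Finite K := by
  obtain ⟨flat, -⟩ := hn
  have : CompactSpace K := flat.symm.toHomeomorph.compactSpace
  exact finite_of_compact_of_discrete

/-- The annihilator of an open subgroup is compact. -/
theorem isCompact_annihilator [IsTopologicalGroup K] (hn : IsNondegenerateBicharacter e)
    {H : Subgroup K} (hH : IsOpen (H : Set K)) : IsCompact {k | ∀ h ∈ H, e h k = 1} := by
  obtain ⟨flat, hflat⟩ := hn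
  have : DiscreteTopology (K ⧸ H) := QuotientGroup.discreteTopology hH
  let q : K →ₜ* K ⧸ H := ⟨QuotientGroup.mk' H, continuous_quot_mk⟩
  have h1 : IsCompact (range (PontryaginDual.map q)) := isCompact_range (map_continuous _)
  -- The annihilator corresponds to the characters factoring through the discrete quotient by `H`,
  -- whose dual is compact.
  have h2 : {k | ∀ h ∈ H, e h k = 1} = flat.symm '' range (PontryaginDual.map q) := by
    ext k
    constructor
    · intro hk
      have hker : ∀ h ∈ H, flat k h = 1 := fun h hh => by rw [hflat]; exact hk h hh
      let χ : (K ⧸ H) →* Circle := QuotientGroup.lift H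
        (MonoidHom.mk' (flat k) fun a b => map_mul _ a b) hker
      let χ' : PontryaginDual (K ⧸ H) := (⟨χ, continuous_of_discreteTopology⟩ : (K ⧸ H) →ₜ* Circle)
      refine ⟨flat k, ⟨χ', PontryaginDual.ext fun x => rfl⟩, flat.symm_apply_apply k⟩
    · rintro ⟨_, ⟨χ, rfl⟩, rfl⟩ h hh
      rw [← hflat, ContinuousMulEquiv.apply_symm_apply, PontryaginDual.map_apply]
      have : q h = 1 := (QuotientGroup.eq_one_iff h).2 hh
      rw [this, map_one]
  rw [h2]
  exact h1.image (map_continuous flat.symm)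

end Compact

/-! ### Logarithms of the bicharacter along the exponential map -/

section Exponential

open Topology Set

variable {K : Type u} [CommGroup K] {e : K → K → Circle}
  {V : Type} [NormedAddCommGroup V] [NormedSpace ℝ V] {E : V → K}

theorem linear_eq_of_exp_eq {l l' : V →L[ℝ] ℝ}
    (h : ∀ v, Circle.exp (2 * Real.pi * l v) = Circle.exp (2 * Real.pi * l' v)) : l = l' := by
  by_contra hne
  obtain ⟨v, hv⟩ : ∃ v, l v - l' v ≠ 0 := by
    by_contra! h0
    exact hne (ContinuousLinearMap.ext fun v => sub_eq_zero.1 (h0 v))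
  -- At this multiple of `v` the two forms differ by 1/2, which is not an integer.
  have h1 := h ((1 / (2 * (l v - l' v))) • v)
  obtain ⟨m, hm⟩ := Circle.exp_eq_exp.1 h1
  rw [map_smul, map_smul, smul_eq_mul, smul_eq_mul] at hm
  have h2 : 2 * Real.pi * (1 / (2 * (l v - l' v)) * (l v - l' v)) = 2 * Real.pi * m := by linarith
  have h3 := mul_left_cancel₀ (by positivity : (2 * Real.pi) ≠ 0) h2
  have h4 : (1 : ℝ) = 2 * m := by
    rw [← h3]
    field_simp
  have h5 : (1 : ℤ) = 2 * m := by exact_mod_cast h4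
  omega

/-- The sum l(E w)v + l(E v)w is always an integer, since `e` is alternating. Replacing w by w/n
shows that it is divisible by every n ≥ 1, so it vanishes. No continuity of `l` in `k` is needed. -/
theorem log_bicharacter_antisymm (he : IsAlternatingBicharacter e)
    (hadd : ∀ v w, E (v + w) = E v * E w) {l : K → (V →L[ℝ] ℝ)}
    (hladd : ∀ k k', l (k * k') = l k + l k')
    (hl : ∀ v k, e (E v) k = Circle.exp (2 * Real.pi * l k v)) (v w : V) :
    l (E w) v = -l (E v) w := by
  have hE0 : E 0 = 1 := by simpa using hadd 0 0
  have hnsmul : ∀ (n : ℕ) w, l (E ((n : ℝ) • w)) = (n : ℝ) • l (E w) := by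
    intro n w
    induction n with
    | zero =>
      have h1 := hladd 1 1
      rw [mul_one] at h1
      simpa [hE0] using h1
    | succ n ih => rw [Nat.cast_succ, add_smul, one_smul, hadd, hladd, ih, add_smul, one_smul]
  have hint : ∀ v w, ∃ m : ℤ, l (E w) v + l (E v) w = m := by
    intro v w
    have h1 : Circle.exp (2 * Real.pi * (l (E w) v + l (E v) w)) = 1 := by
      rw [mul_add, Circle.exp_add, ← hl, ← hl, he.swap (E v) (E w), mul_inv_cancel]
    obtain ⟨m, hm⟩ := Circle.exp_eq_one.1 h1
    exact ⟨m, mul_left_cancel₀ (by positivity : (2 * Real.pi) ≠ 0) (hm.trans (mul_comm _ _))⟩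
  obtain ⟨m, hm⟩ := hint v w
  -- One `n` exceeding `|m|` suffices, since its only multiple of absolute value less than `n` is 0.
  set n : ℕ := m.natAbs + 1 with hn
  have hn0 : (n : ℝ) ≠ 0 := by positivity
  obtain ⟨m', hm'⟩ := hint v ((n : ℝ)⁻¹ • w)
  have h2 : w = (n : ℝ) • ((n : ℝ)⁻¹ • w) := by rw [smul_smul, mul_inv_cancel₀ hn0, one_smul]
  have h3 : (m : ℝ) = n * m' := by
    rw [← hm, ← hm', h2, hnsmul, ← h2, smul_apply, smul_eq_mul, map_smul, smul_eq_mul, mul_add,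
      mul_inv_cancel_left₀ hn0]
  have h4 : m = n * m' := by exact_mod_cast h3
  have h5 : m = 0 := by
    refine Int.eq_zero_of_abs_lt_dvd (m := (n : ℤ)) ⟨m', h4⟩ ?_
    rw [hn, Int.abs_eq_natAbs]
    push_cast
    omega
  rw [h5, Int.cast_zero] at hm
  linarith

variable [TopologicalSpace K]

/-- The logarithm of a bicharacter in its first variable. -/
theorem exists_log_bicharacter (he : IsAlternatingBicharacter e)
    (hn : IsNondegenerateBicharacter e) (hE : Continuous E)
    (hadd : ∀ v w, E (v + w) = E v * E w) :
    ∃ l : K → (V →L[ℝ] ℝ), (∀ k k', l (k * k') = l k + l k') ∧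
      ∀ v k, e (E v) k = Circle.exp (2 * Real.pi * l k v) := by
  obtain ⟨flat, hflat⟩ := hn
  have h1 : ∀ k, ∃ l : V →L[ℝ] ℝ, ∀ v, e (E v) k = Circle.exp (2 * Real.pi * l v) := fun k => by
    refine exists_linear_of_character ?_ fun v w => by rw [hadd, he.mul_left]
    have : (fun v => e (E v) k) = fun v => flat k (E v) := funext fun v => (hflat _ _).symm
    rw [this]
    exact (map_continuous (flat k)).comp hE
  choose l hl using h1
  refine ⟨l, fun k k' => linear_eq_of_exp_eq fun v => ?_, fun v k => hl k v⟩
  rw [← hl, he.mul_right, hl, hl, add_apply, mul_add, Circle.exp_add]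

/-- If an open homomorphism from a vector space kills a vector, then it can be replaced by one from
a space of smaller dimension. -/
theorem exists_openHom_of_finrank_lt [FiniteDimensional ℝ V] (hE : Continuous E)
    (ho : IsOpenMap E) (hadd : ∀ v w, E (v + w) = E v * E w) {v : V} (hv0 : v ≠ 0)
    (hv : ∀ t : ℝ, E (t • v) = 1) :
    ∃ (W : Submodule ℝ V), Module.finrank ℝ W < Module.finrank ℝ V ∧
      Continuous (fun w : W => E w) ∧ IsOpenMap (fun w : W => E w) := by
  obtain ⟨W, hW⟩ := Submodule.exists_isCompl (ℝ ∙ v)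
  refine ⟨W, ?_, hE.comp continuous_subtype_val, ?_⟩
  · have h1 := Submodule.finrank_add_eq_of_isCompl hW
    rw [finrank_span_singleton hv0] at h1
    omega
  · intro U hU
    -- `E` is invariant along `v`, so it factors through this projection and the image of `U` equals
    -- the image of the open set `p ⁻¹' U`.
    let p : V →ₗ[ℝ] W := W.projectionOnto (ℝ ∙ v) hW.symm
    have hp : Continuous p := p.continuous_of_finiteDimensional
    have h2 : ∀ x, E (p x) = E x := by
      intro x
      have hx : x - p x ∈ ℝ ∙ v := by
        rw [← Submodule.projectionOnto_apply_eq_zero_iff hW.symm, map_sub,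
          Submodule.projectionOnto_apply_left, sub_self]
      obtain ⟨t, ht⟩ := Submodule.mem_span_singleton.1 hx
      have : x = p x + t • v := by rw [ht]; abel
      conv_rhs => rw [this, hadd, hv, mul_one]
    have h3 : (fun w : W => E w) '' U = E '' (p ⁻¹' U) := by
      ext k
      constructor
      · rintro ⟨w, hw, rfl⟩
        refine ⟨w, ?_, rfl⟩
        have : p w = w := Submodule.projectionOnto_apply_left hW.symm w
        rw [mem_preimage, this]
        exact hw
      · rintro ⟨x, hx, rfl⟩
        exact ⟨p x, hx, h2 x⟩
    rw [h3]
    exact ho _ (hU.preimage hp)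

/-- A nonzero discrete group of linear forms contains a form that takes the value `1` at a vector on
which all its forms are integral. -/
theorem exists_integral_vector [FiniteDimensional ℝ V] (M : Submodule ℤ (V →L[ℝ] ℝ))
    [DiscreteTopology M] (hM : M ≠ ⊥) :
    ∃ (v : V) (l : V →L[ℝ] ℝ), l ∈ M ∧ l v = 1 ∧ ∀ l' ∈ M, ∃ m : ℤ, l' v = m := by
  let b := Module.Free.chooseBasis ℤ M
  set ι := Module.Free.ChooseBasisIndex ℤ M
  let c : ι → (V →L[ℝ] ℝ) := fun i => b i
  have hspan : Submodule.span ℤ (range c) = M := by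
    have h1 : range c = M.subtype '' range b := by
      rw [← range_comp]; rfl
    rw [h1, ← Submodule.map_span, b.span_eq, Submodule.map_top, Submodule.range_subtype]
  -- By discreteness, an integral basis of `M` is linearly independent over ℝ; hence some vector is
  -- killed by all basis forms but one.
  have hli : LinearIndependent ℝ c := by
    rw [linearIndependent_iff_card_eq_finrank_span,
      Real.finrank_eq_int_finrank_of_discrete (by rw [hspan]; infer_instance), Set.finrank, hspan,
      Module.finrank_eq_card_basis b]
  have hne : Nonempty ι := by
    by_contra h
    rw [not_nonempty_iff] at h
    refine hM ?_
    rw [← hspan, range_eq_empty, Submodule.span_empty]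
  obtain ⟨i⟩ := hne
  obtain ⟨v, hv0, hvi⟩ : ∃ v, (∀ j, j ≠ i → c j v = 0) ∧ c i v ≠ 0 := by
    by_contra! h
    have h1 : (c i : V →ₗ[ℝ] ℝ) ∈ Submodule.span ℝ
        (range fun j : {j // j ≠ i} => (c j : V →ₗ[ℝ] ℝ)) := by
      refine mem_span_of_iInf_ker_le_ker fun v hv => ?_
      simp only [Submodule.mem_iInf, LinearMap.mem_ker] at hv ⊢
      exact h v fun j hj => hv ⟨j, hj⟩
    have h2 : LinearIndependent ℝ fun j => (c j : V →ₗ[ℝ] ℝ) :=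
      hli.map' (ContinuousLinearMap.coeLM ℝ)
        (LinearMap.ker_eq_bot.2 ContinuousLinearMap.coe_injective)
    refine h2.notMem_span_image (s := {j | j ≠ i}) (x := i) (by simp) ?_
    convert h1 using 2
    ext x
    simp
  refine ⟨(c i v)⁻¹ • v, c i, (b i).2, by rw [map_smul, smul_eq_mul, inv_mul_cancel₀ hvi],
    fun l' hl' => ?_⟩
  rw [← hspan] at hl'
  induction hl' using Submodule.span_induction with
  | mem x hx =>
    obtain ⟨j, rfl⟩ := hx
    by_cases hj : j = i
    · exact ⟨1, by rw [hj, map_smul, smul_eq_mul, inv_mul_cancel₀ hvi, Int.cast_one]⟩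
    · exact ⟨0, by rw [map_smul, hv0 j hj, smul_zero, Int.cast_zero]⟩
  | zero => exact ⟨0, by simp⟩
  | add x y _ _ hx hy =>
    obtain ⟨m, hm⟩ := hx
    obtain ⟨m', hm'⟩ := hy
    exact ⟨m + m', by rw [add_apply, hm, hm', Int.cast_add]⟩
  | smul a x _ hx =>
    obtain ⟨m, hm⟩ := hx
    exact ⟨a * m, by rw [smul_apply, hm, zsmul_eq_mul, Int.cast_mul]⟩

end Exponential

/-! ### Polarization by induction on the dimension of the exponential map -/

section Polarization

open Topology Set

/-- A nonzero form l_k takes the value 1/2 at some v. Replacing v by a vector of norm at most `R`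
with the same image under `E` changes this value by an integer; but a form of norm below 1/(4R) is
at most 1/4 in absolute value there. -/
theorem discreteTopology_log_range {K : Type u} [CommGroup K] {e : K → K → Circle}
    {V : Type} [NormedAddCommGroup V] [NormedSpace ℝ V] {E : V → K} {l : K → (V →L[ℝ] ℝ)}
    (hl : ∀ v k, e (E v) k = Circle.exp (2 * Real.pi * l k v)) {R : ℝ} (hR : 0 < R)
    (hER : ∀ v, ∃ w, ‖w‖ ≤ R ∧ E w = E v) (M : Submodule ℤ (V →L[ℝ] ℝ))
    (hM : ∀ f ∈ M, ∃ k, l k = f) : DiscreteTopology M := by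
  refine DiscreteTopology.of_forall_le_dist (r := 1 / (4 * R)) (by positivity) fun x y hxy => ?_
  by_contra! hlt
  obtain ⟨k, hk⟩ := hM (x - y) (M.sub_mem x.2 y.2)
  have hd : ‖l k‖ < 1 / (4 * R) := by
    rw [hk]
    exact (dist_eq_norm (x : V →L[ℝ] ℝ) y).symm.trans_lt hlt
  obtain ⟨v, hv⟩ : ∃ v, l k v ≠ 0 := by
    by_contra! h0
    refine hxy (Subtype.ext (sub_eq_zero.1 ?_))
    rw [← hk]
    exact ContinuousLinearMap.ext h0
  obtain ⟨w, hw, hEw⟩ := hER ((2 * l k v)⁻¹ • v)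
  have h1 := hl w k
  rw [hEw, hl, map_smul, smul_eq_mul] at h1
  obtain ⟨m, hm⟩ := Circle.exp_eq_exp.1 h1
  have h2 : (1 / 2 : ℝ) = l k w + m := by
    have h3 : (2 * l k v)⁻¹ * l k v = 1 / 2 := by field_simp
    rw [h3] at hm
    refine mul_left_cancel₀ (by positivity : (2 * Real.pi) ≠ 0) ?_
    linarith
  have h4 : |l k w| ≤ 1 / 4 := by
    calc |l k w| ≤ ‖l k‖ * ‖w‖ := (l k).le_opNorm w
      _ ≤ 1 / (4 * R) * R := by gcongr
      _ = 1 / 4 := by field_simp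
  rw [abs_le] at h4
  have h5 : (0 : ℝ) < m := by linarith
  have h6 : (m : ℝ) < 1 := by linarith
  have h7 : 0 < m := by exact_mod_cast h5
  have h8 : m < 1 := by exact_mod_cast h6
  omega

/-- The homomorphism `ℝ → K` through a vector. -/
def rayHom {K : Type u} [CommGroup K] [TopologicalSpace K] {V : Type} [NormedAddCommGroup V]
    [NormedSpace ℝ V] {E : V → K} (hE : Continuous E) (hadd : ∀ v w, E (v + w) = E v * E w)
    (v : V) : Multiplicative ℝ →ₜ* K :=
  ⟨MonoidHom.mk' (fun t => E (t.toAdd • v)) fun s t => by rw [toAdd_mul, add_smul, hadd],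
    hE.comp (continuous_toAdd.smul continuous_const)⟩

theorem hasPolarization_of_openHom (n : ℕ) : ∀ (K : Type u) [CommGroup K] [TopologicalSpace K]
    [IsTopologicalGroup K] (e : K → K → Circle), IsAlternatingBicharacter e →
    IsNondegenerateBicharacter e → ∀ (V : Type) [NormedAddCommGroup V] [NormedSpace ℝ V]
    [FiniteDimensional ℝ V] (E : V → K), Continuous E → IsOpenMap E →
    (∀ v w, E (v + w) = E v * E w) → Module.finrank ℝ V < n → HasPolarization.{u, v} e := by
  induction n with
  | zero => intro K _ _ _ e he hn V _ _ _ E hE ho hadd hrank; omega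
  | succ n ih =>
    intro K _ _ _ e he hn V _ _ _ E hE ho hadd hrank
    have hE0 : E 0 = 1 := by simpa using hadd 0 0
    obtain ⟨l, hladd, hl⟩ := exists_log_bicharacter he hn hE hadd
    have hanti := log_bicharacter_antisymm he hadd hladd hl
    -- The inductive step: if the image of one of the split factors contains the ray through a
    -- nonzero `v`, the projection to the complement kills that ray, and the dimension drops.
    have hsplit : ∀ (A B : Type) [CommGroup A] [TopologicalSpace A] [IsTopologicalGroup A]
        [CommGroup B] [TopologicalSpace B] [IsTopologicalGroup B] (δ : B ≃ₜ* PontryaginDual A)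
        (δ' : A ≃ₜ* PontryaginDual B), (∀ a b, δ' a b = δ b a) → IsEuclideanTimesDiscrete A →
        HasLifts.{u, v} A → HasLifts.{u, v} B → ∀ (α : A →ₜ* K) (β : B →ₜ* K),
        (∀ a b, e (α a) (β b) = δ b a) → (∀ a a', e (α a) (α a') = 1) →
        (∀ b b', e (β b) (β b') = 1) → ∀ v, v ≠ 0 →
        (∀ t : ℝ, (∃ a, E (t • v) = α a) ∨ ∃ b, E (t • v) = β b) → HasPolarization.{u, v} e := by
      intro A B _ _ _ _ _ _ δ δ' hδ hA hlA hlB α β hαβ hα hβ v hv0 hv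
      obtain ⟨H, r, hrs, hro, hrα, hrβ, hHn, hH⟩ :=
        exists_orthogonal_complement.{u, v} he hn δ δ' hδ hA hlA hlB α β hαβ hα hβ
      refine hH ?_
      obtain ⟨W, hW, hWc, hWo⟩ := exists_openHom_of_finrank_lt (E := fun v => r (E v))
        ((map_continuous r).comp hE) (hro.comp ho) (fun v w => by rw [hadd, map_mul]) hv0
        fun t => by
          rcases hv t with ⟨a, ha⟩ | ⟨b, hb⟩
          · rw [ha, hrα]
          · rw [hb, hrβ]
      refine ih H _ (he.restrict H) hHn W (fun w => r (E w)) hWc hWo (fun v w => ?_) (by omega)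
      rw [Submodule.coe_add, hadd, map_mul]
    by_cases hω : ∃ v w, l (E w) v ≠ 0
    · obtain ⟨v', w, hv'⟩ := hω
      obtain ⟨v, hv⟩ : ∃ v, l (E w) v = 1 :=
        ⟨(l (E w) v')⁻¹ • v', by rw [map_smul, smul_eq_mul, inv_mul_cancel₀ hv']⟩
      -- Homogeneity in `y` is not given; antisymmetry transfers it from the linear variable.
      have hform : ∀ (s t : ℝ) (x y : V), l (E (t • y)) (s • x) = s * t * l (E y) x := by
        intro s t x y
        rw [hanti, map_smul, smul_eq_mul, ← mul_neg, ← hanti (s • x) y, map_smul, smul_eq_mul]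
        ring
      have hself : ∀ x, l (E x) x = 0 := fun x => by linarith [hanti x x]
      obtain ⟨δ, hδ⟩ := exists_dualEquiv_real
      refine hsplit (Multiplicative ℝ) (Multiplicative ℝ) δ δ
        (fun s t => by rw [hδ, hδ, mul_comm s.toAdd])
        isEuclideanTimesDiscrete_real hasLifts_real hasLifts_real (rayHom hE hadd v)
        (rayHom hE hadd w) (fun s t => ?_) (fun s t => ?_) (fun s t => ?_) v ?_
        fun t => Or.inl ⟨Multiplicative.ofAdd t, rfl⟩
      · change e (E (s.toAdd • v)) (E (t.toAdd • w)) = _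
        rw [hl, hform, hv, hδ, mul_one, mul_comm s.toAdd]
      · change e (E (s.toAdd • v)) (E (t.toAdd • v)) = _
        rw [hl, hform, hself, mul_zero, mul_zero, Circle.exp_zero]
      · change e (E (s.toAdd • w)) (E (t.toAdd • w)) = _
        rw [hl, hform, hself, mul_zero, mul_zero, Circle.exp_zero]
      · rintro rfl
        rw [map_zero] at hv
        exact zero_ne_one hv
    · push Not at hω
      have hEE : ∀ v w, e (E v) (E w) = 1 := fun v w => by
        rw [hl, hω, mul_zero, Circle.exp_zero]
      let K₀ : Subgroup K :=
        { carrier := range E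
          one_mem' := ⟨0, hE0⟩
          mul_mem' := by
            rintro _ _ ⟨v, rfl⟩ ⟨w, rfl⟩
            exact ⟨v + w, hadd v w⟩
          inv_mem' := by
            rintro _ ⟨v, rfl⟩
            refine ⟨-v, eq_inv_of_mul_eq_one_left ?_⟩
            rw [← hadd, neg_add_cancel, hE0] }
      have hK₀ : IsOpen (K₀ : Set K) := ho.isOpen_range
      have hcpt : IsCompact (range E) := by
        -- The open subgroup E(V) is isotropic, so it is a closed subset of its own compact
        -- annihilator.
        refine (isCompact_annihilator hn hK₀).of_isClosed_subset (K₀.isClosed_of_isOpen hK₀) ?_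
        rintro _ ⟨v, rfl⟩ _ ⟨w, rfl⟩
        exact hEE w v
      obtain ⟨R, hR, hER⟩ : ∃ R : ℝ, 0 < R ∧ ∀ v, ∃ w, ‖w‖ ≤ R ∧ E w = E v := by
        -- Since `E` is open, the images of balls form an open cover of the compact image, so one
        -- ball already maps onto it.
        obtain ⟨N, hN⟩ := hcpt.elim_directed_cover (fun N : ℕ => E '' Metric.ball 0 N)
          (fun N => ho _ Metric.isOpen_ball) (by
            rintro _ ⟨v, rfl⟩
            obtain ⟨N, hN⟩ := exists_nat_gt ‖v‖
            exact mem_iUnion.2 ⟨N, v, mem_ball_zero_iff.2 hN, rfl⟩)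
          (directed_of_isDirected_le fun a b hab =>
            image_mono (Metric.ball_subset_ball (Nat.cast_le.2 hab)))
        refine ⟨N + 1, by positivity, fun v => ?_⟩
        obtain ⟨w, hw, hwv⟩ := hN ⟨v, rfl⟩
        exact ⟨w, (mem_ball_zero_iff.1 hw).le.trans (by linarith), hwv⟩
      have hl1 : l 1 = 0 := by simpa using hladd 1 1
      let M : Submodule ℤ (V →L[ℝ] ℝ) := AddSubgroup.toIntSubmodule
        { carrier := range l
          zero_mem' := ⟨1, hl1⟩
          add_mem' := by
            rintro _ _ ⟨k, rfl⟩ ⟨k', rfl⟩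
            exact ⟨k * k', hladd k k'⟩
          neg_mem' := by
            rintro _ ⟨k, rfl⟩
            refine ⟨k⁻¹, eq_neg_of_add_eq_zero_left ?_⟩
            rw [← hladd, inv_mul_cancel, hl1] }
      have hE1 : ∀ v, (∀ k, e (E v) k = 1) → E v = 1 := fun v hv => by
        obtain ⟨flat, hflat⟩ := hn
        refine flat.injective (PontryaginDual.ext fun k => ?_)
        rw [hflat, map_one, PontryaginDual.one_apply, he.swap (E v), hv, inv_one]
      have : DiscreteTopology M := discreteTopology_log_range hl hR hER M fun f hf => hf
      by_cases hM : M = ⊥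
      · have hl0 : ∀ k, l k = 0 := fun k => by
          have : l k ∈ M := ⟨k, rfl⟩
          rwa [hM, Submodule.mem_bot] at this
        have htriv : ∀ v, E v = 1 := fun v => hE1 v fun k => by
          rw [hl, hl0, zero_apply, mul_zero, Circle.exp_zero]
        have h1 : IsOpen ({1} : Set K) := by
          have : range E = {1} := by
            ext k
            constructor
            · rintro ⟨v, rfl⟩
              exact htriv v
            · rintro rfl
              exact ⟨0, hE0⟩
          rw [← this]
          exact ho.isOpen_range
        have := discreteTopology_of_isOpen_singleton_one h1
        have := finite_of_discreteTopology_of_nondegenerate hn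
        exact hasPolarization_of_finite (Nat.card K) K e he hn le_rfl
      · obtain ⟨v, _, ⟨k, rfl⟩, hkv, hint⟩ := exists_integral_vector M hM
        -- Integrality of all forms at `v` means that `E v` pairs trivially with everything, so the
        -- ray through `v` closes up to a circle.
        have hEv : E v = 1 := hE1 v fun k' => by
          obtain ⟨m, hm⟩ := hint (l k') ⟨k', rfl⟩
          rw [hl, hm]
          exact Circle.exp_eq_one.2 ⟨m, mul_comm _ _⟩
        have hpi : (2 * Real.pi) ≠ 0 := by positivity
        obtain ⟨β, hβ⟩ := exists_circleHom (τ := fun t => E ((t / (2 * Real.pi)) • v))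
          (hE.comp (by fun_prop)) (fun s t => by rw [add_div, add_smul, hadd])
          (by simp only [div_self hpi, one_smul, hEv])
        -- The inverse of `k` compensates for the sign from exchanging the arguments, since `l` is
        -- the logarithm in the first variable.
        let α : Multiplicative ℤ →ₜ* K := ⟨zpowersHom K k⁻¹, continuous_of_discreteTopology⟩
        have hα : ∀ a, α a = k⁻¹ ^ a.toAdd := fun a => rfl
        obtain ⟨δ, δ', hδ, hδ'⟩ := exists_dualEquiv_int_circle
        refine hsplit (Multiplicative ℤ) Circle δ δ' (fun a b => by rw [hδ, hδ'])
          (isEuclideanTimesDiscrete_of_discrete _) hasLifts_int hasLifts_circle α β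
          (fun a z => ?_) (fun a b => ?_) (fun z z' => ?_) v ?_ fun t => Or.inr
          ⟨Circle.exp (2 * Real.pi * t), ?_⟩
        · obtain ⟨t, rfl⟩ := Circle.exp_surjective z
          rw [hα, hβ, hδ, he.zpow_left, he.inv_left, ← he.swap, hl, map_smul, hkv, smul_eq_mul,
            mul_one, mul_div_cancel₀ _ hpi]
        · rw [hα, hα, he.zpow_left, he.zpow_right, he.alternating, one_zpow, one_zpow]
        · obtain ⟨t, rfl⟩ := Circle.exp_surjective z
          obtain ⟨s, rfl⟩ := Circle.exp_surjective z'
          rw [hβ, hβ, hEE]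
        · rintro rfl
          rw [map_zero] at hkv
          exact zero_ne_one hkv
        · rw [hβ, mul_div_cancel_left₀ _ hpi]

end Polarization

/-! ### Elementary groups are Lie groups -/

section LieGroup

open Topology Set

variable {A : Type} [CommGroup A] [TopologicalSpace A]

theorem IsEuclideanTimesDiscrete.isTopologicalGroup (hA : IsEuclideanTimesDiscrete A) :
    IsTopologicalGroup A := by
  obtain ⟨V, _, _, _, D, _, _, _, _, ⟨f⟩⟩ := hA
  exact f.isInducing.topologicalGroup f

theorem IsEuclideanTimesDiscrete.t2Space (hA : IsEuclideanTimesDiscrete A) : T2Space A := by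
  obtain ⟨V, _, _, _, D, _, _, _, _, ⟨f⟩⟩ := hA
  exact T2Space.of_injective_continuous f.injective (map_continuous f)

theorem IsEuclideanTimesDiscrete.locallyCompactSpace (hA : IsEuclideanTimesDiscrete A) :
    LocallyCompactSpace A := by
  obtain ⟨V, _, _, _, D, _, _, _, _, ⟨f⟩⟩ := hA
  have : LocallyCompactSpace (Multiplicative V) := inferInstanceAs (LocallyCompactSpace V)
  exact f.toHomeomorph.isClosedEmbedding.locallyCompactSpace

theorem IsEuclideanTimesDiscrete.countable_connectedComponents (hA : IsEuclideanTimesDiscrete A) :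
    Countable (ConnectedComponents A) := by
  obtain ⟨V, _, _, _, D, _, _, _, _, ⟨f⟩⟩ := hA
  refine Function.Surjective.countable
    (f := fun d : D => (ConnectedComponents.mk (f.symm (1, d)) : ConnectedComponents A)) ?_
  intro c
  obtain ⟨a, rfl⟩ := ConnectedComponents.surjective_coe c
  refine ⟨(f a).2, ?_⟩
  rw [ConnectedComponents.coe_eq_coe']
  have h1 : IsPreconnected (range fun v : V => f.symm (Multiplicative.ofAdd v, (f a).2)) :=
    isPreconnected_range ((map_continuous f.symm).comp
      (continuous_ofAdd.prodMk continuous_const))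
  refine h1.subset_connectedComponent ⟨(f a).1.toAdd, ?_⟩ ⟨0, rfl⟩
  exact f.symm_apply_apply a

/-- One chart for each element of `D`, all restricting the same homomorphism `φ` to the Euclidean
space. Coordinate changes are the identity, and the group operations become addition and negation.
-/
theorem IsEuclideanTimesDiscrete.isLieGroup (hA : IsEuclideanTimesDiscrete A) : IsLieGroup A := by
  refine ⟨hA.t2Space, hA.countable_connectedComponents, ?_⟩
  have := hA.isTopologicalGroup
  obtain ⟨V, _, _, _, D, _, _, _, _, ⟨f⟩⟩ := hA
  let X := EuclideanSpace ℝ (Fin (Module.finrank ℝ V))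
  let L : V ≃L[ℝ] X := ContinuousLinearEquiv.ofFinrankEq (by simp [X])
  let φ : A → X := fun a => L (f a).1.toAdd
  let ψ : D → X → A := fun d x => f.symm (Multiplicative.ofAdd (L.symm x), d)
  have hφ : Continuous φ :=
    L.continuous.comp (continuous_toAdd.comp (map_continuous f).fst)
  have hψ : ∀ d, Continuous (ψ d) := fun d => (map_continuous f.symm).comp
    ((continuous_ofAdd.comp L.symm.continuous).prodMk continuous_const)
  have hφψ : ∀ d x, φ (ψ d x) = x := fun d x => by simp [φ, ψ]
  have hφmul : ∀ a b, φ (a * b) = φ a + φ b := fun a b => by simp [φ]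
  have hφinv : ∀ a, φ a⁻¹ = -φ a := fun a => by simp [φ]
  let c : D → OpenPartialHomeomorph A X := fun d =>
    { toFun := φ
      invFun := ψ d
      source := {a | (f a).2 = d}
      target := univ
      map_source' := fun _ _ => mem_univ _
      map_target' := fun x _ => by simp [ψ]
      left_inv' := fun a ha => by
        change (f a).2 = d at ha
        subst ha
        simp [φ, ψ]
      right_inv' := fun x _ => hφψ d x
      open_source := (isOpen_discrete {d}).preimage (map_continuous f).snd
      open_target := isOpen_univ
      continuousOn_toFun := hφ.continuousOn
      continuousOn_invFun := (hψ d).continuousOn }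
  let cs : ChartedSpace X A :=
    { atlas := range c
      chartAt := fun a => c (f a).2
      mem_chart_source := fun a => rfl
      chart_mem_atlas := fun a => ⟨_, rfl⟩ }
  refine ⟨_, cs, ?_⟩
  have hext : ∀ a : A, (extChartAt (𝓡 (Module.finrank ℝ V)) a : A → X) = φ := fun a => rfl
  have hman : IsManifold (𝓡 (Module.finrank ℝ V)) ∞ A := by
    refine isManifold_of_contDiffOn _ _ _ ?_
    rintro _ _ ⟨d, rfl⟩ ⟨d', rfl⟩
    exact contDiffOn_id.congr fun x _ => hφψ d x
  have hφs : ContMDiff (𝓡 (Module.finrank ℝ V)) 𝓘(ℝ, X) ∞ φ := fun a => by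
    have := contMDiffAt_extChartAt (I := 𝓡 (Module.finrank ℝ V)) (n := ∞) (x := a)
    rwa [hext] at this
  refine { contMDiff_mul := fun p => ?_, contMDiff_inv := fun a => ?_ }
  · rw [contMDiffAt_iff_target]
    refine ⟨continuous_mul.continuousAt, ?_⟩
    rw [hext]
    have : (φ ∘ fun p : A × A => p.1 * p.2) = fun p => φ p.1 + φ p.2 :=
      funext fun p => hφmul _ _
    rw [this]
    exact ((hφs.comp contMDiff_fst).add (hφs.comp contMDiff_snd)) p
  · rw [contMDiffAt_iff_target]
    refine ⟨continuous_inv.continuousAt, ?_⟩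
    rw [hext]
    have : (φ ∘ fun a : A => a⁻¹) = fun a => -φ a := funext hφinv
    rw [this]
    exact hφs.neg a

end LieGroup

/-! ### The topology of the standard Heisenberg group -/

theorem Circle.dist_eq_norm_sub (z w : Circle) : dist z w = ‖(z : ℂ) - w‖ :=
  dist_eq_norm (z : ℂ) w

open Filter Topology in
theorem PontryaginDual.tendsto_iff {A ι : Type*} [CommGroup A] [TopologicalSpace A] {l : Filter ι}
    {F : ι → PontryaginDual A} {χ : PontryaginDual A} :
    Tendsto F l (𝓝 χ) ↔ ∀ C : Set A, IsCompact C → ∀ ε > 0, ∀ᶠ i in l, ∀ y ∈ C,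
      dist (χ y) (F i y) < ε := by
  have hind : IsInducing (fun χ : PontryaginDual A => (⟨χ, map_continuous χ⟩ : C(A, Circle))) :=
    ContinuousMonoidHom.isInducing_toContinuousMap A Circle
  rw [hind.tendsto_nhds_iff, ContinuousMap.tendsto_iff_forall_isCompact_tendstoUniformlyOn]
  exact forall₂_congr fun C _ => Metric.tendstoUniformlyOn_iff

namespace Heisenberg

open Filter Topology

variable {A : Type*} [CommGroup A] [TopologicalSpace A] [IsTopologicalGroup A]
  [LocallyCompactSpace A] [MeasurableSpace A] [BorelSpace A]

theorem operator_apply (z : Circle) (x : A) (χ : PontryaginDual A) (f : L2 A) :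
    operator z x χ f = (z : ℂ) • translation x (modulation χ f) := rfl

theorem norm_circle_smul (z : Circle) (f : L2 A) : ‖(z : ℂ) • f‖ = ‖f‖ := by
  rw [norm_smul, Circle.norm_coe, one_mul]

theorem operator_mul_left (w z : Circle) (x : A) (χ : PontryaginDual A) (f : L2 A) :
    operator (w * z) x χ f = (w : ℂ) • operator z x χ f := by
  rw [operator_apply, operator_apply, smul_smul, Circle.coe_mul]

/-- The Weyl commutation relation, through which the bicharacter is read off from the operators. -/
theorem operator_operator (p q : Circle × A × PontryaginDual A) (f : L2 A) :
    operator p.1 p.2.1 p.2.2 (operator q.1 q.2.1 q.2.2 f) =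
      ((p.2.2 q.2.1 * (q.2.2 p.2.1)⁻¹ : Circle) : ℂ) •
        operator q.1 q.2.1 q.2.2 (operator p.1 p.2.1 p.2.2 f) := by
  have h1 : operator p.1 p.2.1 p.2.2 (operator q.1 q.2.1 q.2.2 f) =
    (operator p.1 p.2.1 p.2.2 * operator q.1 q.2.1 q.2.2) f := rfl
  have h2 : operator q.1 q.2.1 q.2.2 (operator p.1 p.2.1 p.2.2 f) =
    (operator q.1 q.2.1 q.2.2 * operator p.1 p.2.1 p.2.2) f := rfl
  rw [h1, h2, operator_mul, operator_mul, ← operator_mul_left, mul_comm q.2.1, mul_comm q.2.2]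
  congr 2
  rw [mul_comm (q.1 * p.1) (q.2.2 _), mul_assoc (p.2.2 _), inv_mul_cancel_left, mul_comm q.1,
    mul_comm (p.2.2 _)]

theorem continuous_translation {Z : Type*} [TopologicalSpace Z] {x : Z → A} {f : Z → L2 A}
    (hx : Continuous x) (hf : Continuous f) : Continuous fun z => translation (x z) (f z) := by
  let g : Z → C(A, A) := fun z => ⟨fun y => (x z)⁻¹ * y, by fun_prop⟩
  have hg : Continuous g :=
    ContinuousMap.continuous_of_continuous_uncurry g (by
      change Continuous fun p : Z × A => (x p.1)⁻¹ * p.2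
      fun_prop)
  exact hf.compMeasurePreservingLp hg
    (fun z => measurePreserving_mul_left (Measure.haar : Measure A) (x z)⁻¹) (by norm_num)

theorem continuous_modulation [NormalSpace A] (f : L2 A) :
    Continuous fun χ => modulation χ f := by
  rw [continuous_iff_continuousAt]
  intro χ₀
  rw [ContinuousAt, Metric.tendsto_nhds]
  intro ε hε
  -- On a compactly supported function, modulation is controlled by uniform closeness of characters
  -- on the support; three errors of at most `ε / 4` remain.
  obtain ⟨g, hgs, hfg, hgc, hg⟩ := (Lp.memLp f).exists_hasCompactSupport_eLpNorm_sub_le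
    (by norm_num) (ε := ENNReal.ofReal (ε / 4)) (by simpa using hε)
  have hfG : ‖f - hg.toLp g‖ ≤ ε / 4 := by
    rw [← Lp.toLp_coeFn f (Lp.memLp f), ← MemLp.toLp_sub, Lp.norm_toLp]
    exact ENNReal.toReal_le_of_le_ofReal (by positivity) hfg
  set G := hg.toLp g with hG
  have hev := PontryaginDual.tendsto_iff.1 (tendsto_id (x := 𝓝 χ₀)) (tsupport g) hgs
    (ε / (4 * (‖G‖ + 1))) (by positivity)
  filter_upwards [hev] with χ hχ
  have h1 : ‖modulation χ G - modulation χ₀ G‖ ≤ ε / (4 * (‖G‖ + 1)) * ‖G‖ := by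
    refine Lp.norm_le_mul_norm_of_ae_le_mul ?_
    filter_upwards [Lp.coeFn_sub (modulation χ G) (modulation χ₀ G), coeFn_modulation χ G,
      coeFn_modulation χ₀ G, hg.coeFn_toLp] with y h2 h3 h4 h5
    rw [h2, Pi.sub_apply, h3, h4, ← sub_mul, norm_mul]
    by_cases hy : y ∈ tsupport g
    · refine mul_le_mul_of_nonneg_right ?_ (norm_nonneg _)
      have h6 := (hχ y hy).le
      rwa [dist_comm, Circle.dist_eq_norm_sub] at h6
    · rw [hG, h5, image_eq_zero_of_notMem_tsupport hy, norm_zero, mul_zero, mul_zero]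
  have h2 : ε / (4 * (‖G‖ + 1)) * ‖G‖ ≤ ε / 4 := by
    rw [div_mul_eq_mul_div, div_le_div_iff₀ (by positivity) (by positivity)]
    nlinarith [norm_nonneg G]
  have h3 : modulation χ f - modulation χ₀ f = modulation χ (f - G) +
      (modulation χ G - modulation χ₀ G) - modulation χ₀ (f - G) := by
    rw [map_sub, map_sub]
    abel
  rw [dist_eq_norm, h3]
  calc _ ≤ ‖modulation χ (f - G)‖ + ‖modulation χ G - modulation χ₀ G‖ +
        ‖modulation χ₀ (f - G)‖ := (norm_sub_le _ _).trans (by gcongr; exact norm_add_le _ _)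
    _ ≤ ε / 4 + ε / 4 + ε / 4 := by
      rw [LinearIsometryEquiv.norm_map, LinearIsometryEquiv.norm_map]
      gcongr
      exact h1.trans h2
    _ < ε := by linarith

theorem continuous_operator [NormalSpace A] (f : L2 A) :
    Continuous fun p : Circle × A × PontryaginDual A => operator p.1 p.2.1 p.2.2 f :=
  (continuous_subtype_val.comp continuous_fst).smul (continuous_translation continuous_snd.fst
    ((continuous_modulation f).comp continuous_snd.snd))

theorem exists_ne_zero : ∃ f : L2 A, f ≠ 0 := by
  obtain ⟨C, hC, hC1⟩ := exists_compact_mem_nhds (1 : A)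
  have hfin : (Measure.haar : Measure A) (interior C) ≠ ⊤ :=
    (measure_mono interior_subset).trans_lt hC.measure_lt_top |>.ne
  refine ⟨indicatorConstLp 2 isOpen_interior.measurableSet hfin 1, ?_⟩
  rw [← norm_ne_zero_iff, norm_indicatorConstLp (by norm_num) (by norm_num), norm_one, one_mul]
  refine (Real.rpow_pos_of_pos (ENNReal.toReal_pos ?_ hfin) _).ne'
  exact (isOpen_interior.measure_pos _ ⟨1, mem_interior_iff_mem_nhds.2 hC1⟩).ne'

/-- Commuting the operators past a fixed Weyl operator `W` gives scalars that are values of the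
characters `flat (p i).2`. Strong convergence makes these converge uniformly on compact sets, and
the inverse of `flat` returns convergence in `A × Â`. The circle component follows by comparing the
operators on one nonzero vector. -/
theorem tendsto_of_tendsto_operator [NormalSpace A]
    (hn : IsNondegenerateBicharacter fun p q : A × PontryaginDual A => q.2 p.1 * (p.2 q.1)⁻¹)
    {ι : Type*} {l : Filter ι} {p : ι → Circle × A × PontryaginDual A}
    {p₀ : Circle × A × PontryaginDual A}
    (h : ∀ f : L2 A, Tendsto (fun i => operator (p i).1 (p i).2.1 (p i).2.2 f) l
      (𝓝 (operator p₀.1 p₀.2.1 p₀.2.2 f))) : Tendsto p l (𝓝 p₀) := by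
  obtain ⟨f, hf⟩ := exists_ne_zero (A := A)
  have hf0 : 0 < ‖f‖ := norm_pos_iff.2 hf
  obtain ⟨flat, hflat⟩ := hn
  have hflat' : Tendsto (fun i => flat (p i).2) l (𝓝 (flat p₀.2)) := by
    rw [PontryaginDual.tendsto_iff]
    intro C hC ε hε
    have hloc : TendstoLocallyUniformlyOn (fun i q => flat (p i).2 q)
        (fun q => flat p₀.2 q) l C := by
      refine Metric.tendstoLocallyUniformlyOn_iff.2 ?_
      intro ε hε q₀ _
      -- Norm continuity of this orbit map makes convergence at the two vectors `f` and `V q₀`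
      -- sufficient for a whole neighbourhood of `q₀`.
      let V : A × PontryaginDual A → L2 A := fun q => operator 1 q.1 q.2 f
      have hV : Continuous V :=
        (continuous_operator f).comp (f := fun q : A × PontryaginDual A => ((1 : Circle), q))
          (continuous_const.prodMk continuous_id)
      refine ⟨{q | dist (V q) (V q₀) < ε * ‖f‖ / 4}, mem_nhdsWithin_of_mem_nhds
        (Metric.tendsto_nhds.1 hV.continuousAt _ (by positivity)), ?_⟩
      filter_upwards [Metric.tendsto_nhds.1 (h f) (ε * ‖f‖ / 4) (by positivity),
        Metric.tendsto_nhds.1 (h (V q₀)) (ε * ‖f‖ / 4) (by positivity)] with i h1 h2 q hq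
      change dist (V q) (V q₀) < ε * ‖f‖ / 4 at hq
      set U := operator (p i).1 (p i).2.1 (p i).2.2
      set U₀ := operator p₀.1 p₀.2.1 p₀.2.2
      set W := operator (1 : Circle) q.1 q.2
      have hU : U (V q) = (flat (p i).2 q : ℂ) • W (U f) := by
        rw [hflat]
        exact operator_operator (p i) (1, q) f
      have hU₀ : U₀ (V q) = (flat p₀.2 q : ℂ) • W (U₀ f) := by
        rw [hflat]
        exact operator_operator p₀ (1, q) f
      have h3 : dist (flat p₀.2 q) (flat (p i).2 q) * ‖f‖ =
          ‖(flat p₀.2 q : ℂ) • W (U₀ f) - (flat (p i).2 q : ℂ) • W (U₀ f)‖ := by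
        rw [← sub_smul, norm_smul, LinearIsometryEquiv.norm_map, LinearIsometryEquiv.norm_map,
          Circle.dist_eq_norm_sub]
      have h4 : (flat p₀.2 q : ℂ) • W (U₀ f) - (flat (p i).2 q : ℂ) • W (U₀ f) =
          (U₀ (V q - V q₀) - U (V q - V q₀)) - (U (V q₀) - U₀ (V q₀)) +
            (flat (p i).2 q : ℂ) • W (U f - U₀ f) := by
        rw [← hU₀, map_sub, map_sub, map_sub, smul_sub, ← hU]
        abel
      have h5 : dist (flat p₀.2 q) (flat (p i).2 q) * ‖f‖ < ε * ‖f‖ := by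
        rw [h3, h4]
        rw [dist_eq_norm] at h1 h2 hq
        calc _ ≤ ((‖U₀ (V q - V q₀)‖ + ‖U (V q - V q₀)‖) + ‖U (V q₀) - U₀ (V q₀)‖) +
              ‖(flat (p i).2 q : ℂ) • W (U f - U₀ f)‖ := by
              refine (norm_add_le _ _).trans ?_
              gcongr
              refine (norm_sub_le _ _).trans ?_
              gcongr
              exact norm_sub_le _ _
          _ < ((ε * ‖f‖ / 4 + ε * ‖f‖ / 4) + ε * ‖f‖ / 4) + ε * ‖f‖ / 4 := by
              rw [norm_circle_smul, LinearIsometryEquiv.norm_map, LinearIsometryEquiv.norm_map,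
                LinearIsometryEquiv.norm_map]
              gcongr
          _ = ε * ‖f‖ := by ring
      exact lt_of_mul_lt_mul_right h5 hf0.le
    exact Metric.tendstoUniformlyOn_iff.1
      ((tendstoLocallyUniformlyOn_iff_tendstoUniformlyOn_of_compact hC).1 hloc) ε hε
  have h2 : Tendsto (fun i => (p i).2) l (𝓝 p₀.2) := by
    have := ((map_continuous flat.symm).tendsto _).comp hflat'
    rw [ContinuousMulEquiv.symm_apply_apply] at this
    refine this.congr fun i => ?_
    exact flat.symm_apply_apply _
  refine Tendsto.prodMk_nhds ?_ h2
  have hV : Continuous fun q : A × PontryaginDual A => operator 1 q.1 q.2 f :=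
    (continuous_operator f).comp (f := fun q : A × PontryaginDual A => ((1 : Circle), q))
      (continuous_const.prodMk continuous_id)
  have h3 : Tendsto (fun i => operator (1 : Circle) (p i).2.1 (p i).2.2 f) l
    (𝓝 (operator 1 p₀.2.1 p₀.2.2 f)) := (hV.tendsto _).comp h2
  rw [Metric.tendsto_nhds]
  intro ε hε
  filter_upwards [Metric.tendsto_nhds.1 (h f) (ε * ‖f‖ / 2) (by positivity),
    Metric.tendsto_nhds.1 h3 (ε * ‖f‖ / 2) (by positivity)] with i h4 h5
  rw [dist_eq_norm] at h4 h5
  set g := operator (1 : Circle) (p i).2.1 (p i).2.2 f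
  set g₀ := operator (1 : Circle) p₀.2.1 p₀.2.2 f with hg₀
  have h6 : ∀ q : Circle × A × PontryaginDual A, operator q.1 q.2.1 q.2.2 f =
      (q.1 : ℂ) • operator 1 q.2.1 q.2.2 f := fun q => by rw [← operator_mul_left, mul_one]
  rw [h6, h6] at h4
  have h7 : dist (p i).1 p₀.1 * ‖f‖ = ‖((p i).1 : ℂ) • g₀ - (p₀.1 : ℂ) • g₀‖ := by
    rw [← sub_smul, norm_smul, hg₀, LinearIsometryEquiv.norm_map, Circle.dist_eq_norm_sub]
  have h8 : ((p i).1 : ℂ) • g₀ - (p₀.1 : ℂ) • g₀ =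
      (((p i).1 : ℂ) • g - (p₀.1 : ℂ) • g₀) - ((p i).1 : ℂ) • (g - g₀) := by
    rw [smul_sub]
    abel
  have h9 : dist (p i).1 p₀.1 * ‖f‖ < ε * ‖f‖ := by
    rw [h7, h8]
    refine (norm_sub_le _ _).trans_lt ?_
    rw [norm_circle_smul]
    linarith
  exact lt_of_mul_lt_mul_right h9 hf0.le

theorem exists_homeomorph_standardGroup [T4Space A]
    (hn : IsNondegenerateBicharacter fun p q : A × PontryaginDual A => q.2 p.1 * (p.2 q.1)⁻¹) :
    ∃ Θ : Circle × A × PontryaginDual A ≃ₜ standardGroup A,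
      ∀ z x χ, Θ (z, x, χ) = element z x χ := by
  let θ : Circle × A × PontryaginDual A → standardGroup A := fun p => element p.1 p.2.1 p.2.2
  have hind : IsInducing fun (U : standardGroup A) (f : L2 A) =>
      (U : L2 A ≃ₗᵢ[ℂ] L2 A) f :=
    IsInducing.comp (g := fun (U : L2 A ≃ₗᵢ[ℂ] L2 A) (f : L2 A) => U f) ⟨rfl⟩ ⟨rfl⟩
  have hθ : Continuous θ := by
    rw [hind.continuous_iff, continuous_pi_iff]
    exact fun f => continuous_operator f
  have hinj : Function.Injective θ := by
    intro p q hpq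
    have h1 : ∀ f : L2 A, operator p.1 p.2.1 p.2.2 f = operator q.1 q.2.1 q.2.2 f := fun f =>
      congrArg (fun U : standardGroup A => (U : L2 A ≃ₗᵢ[ℂ] L2 A) f) hpq
    -- Injectivity is the case of a constant sequence.
    have h2 : Tendsto (fun _ : ℕ => p) atTop (𝓝 q) := tendsto_of_tendsto_operator hn fun f => by
      rw [h1]
      exact tendsto_const_nhds
    exact tendsto_nhds_unique tendsto_const_nhds h2
  have hsurj : Function.Surjective θ := by
    rintro ⟨_, z, x, χ, rfl⟩
    exact ⟨(z, x, χ), rfl⟩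
  let θ' := Equiv.ofBijective θ ⟨hinj, hsurj⟩
  refine ⟨⟨θ', hθ, ?_⟩, fun z x χ => rfl⟩
  rw [continuous_iff_continuousAt]
  intro U
  refine tendsto_of_tendsto_operator hn fun f => ?_
  have h1 : ∀ U, operator (θ'.symm U).1 (θ'.symm U).2.1 (θ'.symm U).2.2 f =
      (U : L2 A ≃ₗᵢ[ℂ] L2 A) f := fun U =>
    congrArg (fun U : standardGroup A => (U : L2 A ≃ₗᵢ[ℂ] L2 A) f) (θ'.apply_symm_apply U)
  simp only [Equiv.invFun_as_coe, h1]
  exact ((continuous_apply f).comp hind.continuous).tendsto U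

end Heisenberg

/-! ### Assembling the polarization and the Heisenberg isomorphism -/

section

open Topology

/-- Normality is required for the approximation in L² used in `Heisenberg.continuous_modulation`. -/
theorem IsEuclideanTimesDiscrete.t4Space {A : Type} [CommGroup A] [TopologicalSpace A]
    (hA : IsEuclideanTimesDiscrete A) : T4Space A := by
  have := hA.t2Space
  have := hA.locallyCompactSpace
  obtain ⟨V, _, _, _, D, _, _, _, _, ⟨f⟩⟩ := hA
  have : SecondCountableTopology (Multiplicative V) :=
    inferInstanceAs (SecondCountableTopology V)
  have : SecondCountableTopology A := f.toHomeomorph.secondCountableTopology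
  infer_instance

theorem IsAlternatingBicharacter.flip {K : Type*} [CommGroup K] {e : K → K → Circle}
    (he : IsAlternatingBicharacter e) :
    IsAlternatingBicharacter fun k l => e l k :=
  ⟨fun k k' l => he.mul_right l k k', fun k l l' => he.mul_left l l' k, he.alternating⟩

section Bicharacter

variable {K : Type*} [CommGroup K] [TopologicalSpace K] {e : K → K → Circle}

theorem IsNondegenerateBicharacter.flip (hn : IsNondegenerateBicharacter e)
    (he : IsAlternatingBicharacter e) : IsNondegenerateBicharacter fun k l => e l k := by
  obtain ⟨flat, hflat⟩ := hn
  refine ⟨{ toFun := fun l => (flat l)⁻¹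
            invFun := fun χ => flat.symm χ⁻¹
            left_inv := fun l => by simp only [inv_inv, flat.symm_apply_apply]
            right_inv := fun χ => by simp only [flat.apply_symm_apply, inv_inv]
            map_mul' := fun k l => by rw [map_mul, mul_inv]
            continuous_toFun := (map_continuous flat).inv
            continuous_invFun := (map_continuous flat.symm).comp continuous_inv }, fun k l => ?_⟩
  change (flat l k)⁻¹ = e l k
  rw [hflat, he.swap k l]

theorem IsNondegenerateBicharacter.comp {L : Type*} [CommGroup L] [TopologicalSpace L]
    (hn : IsNondegenerateBicharacter e) (φ : L ≃ₜ* K) :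
    IsNondegenerateBicharacter fun k l => e (φ k) (φ l) := by
  obtain ⟨flat, hflat⟩ := hn
  let φ₁ : L →ₜ* K := φ
  let φ₂ : K →ₜ* L := φ.symm
  have h₁ : ∀ k, φ₁ (φ₂ k) = k := φ.apply_symm_apply
  have h₂ : ∀ k, φ₂ (φ₁ k) = k := φ.symm_apply_apply
  refine ⟨{ toFun := fun l => PontryaginDual.map φ₁ (flat (φ l))
            invFun := fun χ => φ.symm (flat.symm (PontryaginDual.map φ₂ χ))
            left_inv := fun l => ?_
            right_inv := fun χ => ?_
            map_mul' := fun k l => by rw [map_mul, map_mul, map_mul]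
            continuous_toFun :=
              (map_continuous _).comp ((map_continuous flat).comp (map_continuous φ))
            continuous_invFun := (map_continuous φ.symm).comp
              ((map_continuous flat.symm).comp (map_continuous _)) }, fun k l => hflat _ _⟩
  · rw [ContinuousMulEquiv.symm_apply_eq, ContinuousMulEquiv.symm_apply_eq]
    refine PontryaginDual.ext fun k => ?_
    rw [PontryaginDual.map_apply, PontryaginDual.map_apply, h₁]
  · simp only [ContinuousMulEquiv.apply_symm_apply]
    refine PontryaginDual.ext fun k => ?_
    rw [PontryaginDual.map_apply, PontryaginDual.map_apply, h₂]

/-- A non-degenerate alternating bicharacter on a Lie group admits a polarization. -/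
theorem IsLieGroup.hasPolarization {K : Type u} [CommGroup K] [TopologicalSpace K]
    (hK : IsLieGroup K) {e : K → K → Circle} (he : IsAlternatingBicharacter e)
    (hn : IsNondegenerateBicharacter e) : HasPolarization.{u, v} e := by
  obtain ⟨_, n, E, hE, ho, hadd⟩ := hK.exists_exponential
  exact hasPolarization_of_openHom _ K e he hn _ E hE ho hadd (Nat.lt_succ_self _)

/-- Replaces the second factor of `A × B` by the dual of `A`. -/
noncomputable def ContinuousMulEquiv.prodDual {A B : Type*} [CommGroup A] [TopologicalSpace A]
    [CommGroup B] [TopologicalSpace B] (δ : B ≃ₜ* PontryaginDual A) (φ : A × B ≃ₜ* K) :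
    (A × PontryaginDual A) ≃ₜ* K where
  toFun p := φ (p.1, δ.symm p.2)
  invFun k := ((φ.symm k).1, δ (φ.symm k).2)
  left_inv p := by simp
  right_inv k := by simp
  map_mul' p q := by
    rw [Prod.fst_mul, Prod.snd_mul, map_mul, ← Prod.mk_mul_mk, map_mul]
  continuous_toFun := (map_continuous φ).comp
    (continuous_fst.prodMk ((map_continuous δ.symm).comp continuous_snd))
  continuous_invFun := (map_continuous φ.symm).fst.prodMk
    ((map_continuous δ).comp (map_continuous φ.symm).snd)

end Bicharacter

section CentralExtension

variable {G K : Type*} [Group G] [CommGroup K]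

/-- Commutators are central here, which turns the usual commutator identities into multiplicativity
in each variable. -/
theorem IsCommutatorForm.isAlternatingBicharacter [TopologicalSpace G] [TopologicalSpace K]
    {S : GroupExtension Circle G K} {e : K → K → Circle} (he : IsCommutatorForm S e)
    (hS : IsTopologicalCentralExtension S) : IsAlternatingBicharacter e := by
  have hinl := S.inl_injective
  have hcomm : ∀ g h, g * h * g⁻¹ = S.inl (e (S.rightHom g) (S.rightHom h)) * h := fun g h => by
    rw [he, inv_mul_cancel_right]
  refine ⟨fun k k' l => hinl ?_, fun k l l' => hinl ?_, fun k => hinl ?_⟩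
  · obtain ⟨g, rfl⟩ := S.rightHom_surjective k
    obtain ⟨g', rfl⟩ := S.rightHom_surjective k'
    obtain ⟨h, rfl⟩ := S.rightHom_surjective l
    rw [← map_mul, he, mul_inv_rev, map_mul]
    calc g * g' * h * (g'⁻¹ * g⁻¹) * h⁻¹ = g * (g' * h * g'⁻¹) * g⁻¹ * h⁻¹ := by group
      _ = g * S.inl (e (S.rightHom g') (S.rightHom h)) * h * g⁻¹ * h⁻¹ := by
        rw [hcomm g' h, ← mul_assoc]
      _ = S.inl (e (S.rightHom g') (S.rightHom h)) * (g * h * g⁻¹) * h⁻¹ := by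
        rw [← hS.central]
        group
      _ = _ := by
        rw [hcomm, mul_assoc, mul_inv_cancel_right, ← map_mul, ← map_mul, mul_comm]
  · obtain ⟨g, rfl⟩ := S.rightHom_surjective k
    obtain ⟨h, rfl⟩ := S.rightHom_surjective l
    obtain ⟨h', rfl⟩ := S.rightHom_surjective l'
    rw [← map_mul, he, mul_inv_rev, map_mul]
    calc g * (h * h') * g⁻¹ * (h'⁻¹ * h⁻¹) = (g * h * g⁻¹) * (g * h' * g⁻¹) * h'⁻¹ * h⁻¹ := by
          group
      _ = S.inl (e (S.rightHom g) (S.rightHom h)) *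
          (h * S.inl (e (S.rightHom g) (S.rightHom h'))) * h⁻¹ := by
        rw [hcomm, hcomm]
        group
      _ = _ := by rw [← hS.central]; group
  · obtain ⟨g, rfl⟩ := S.rightHom_surjective k
    rw [he, map_one]
    group

theorem IsCommutatorForm.mul_comm_mul [TopologicalSpace G] [TopologicalSpace K]
    {S : GroupExtension Circle G K} {e : K → K → Circle} (he : IsCommutatorForm S e) (g h : G) :
    g * h = S.inl (e (S.rightHom g) (S.rightHom h)) * (h * g) := by
  rw [he]
  group

/-- A topological central extension with compatible sections over two complementary factors of the
quotient is the product of the circle with both factors. -/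
theorem IsTopologicalCentralExtension.exists_homeomorph [TopologicalSpace G]
    [IsTopologicalGroup G] [T2Space G] [TopologicalSpace K] {S : GroupExtension Circle G K}
    (hS : IsTopologicalCentralExtension S) {A B : Type*} [CommGroup A] [TopologicalSpace A]
    [CommGroup B] [TopologicalSpace B] (φ : A × B ≃ₜ* K) {σ : A → G} {τ : B → G}
    (hσ : Continuous σ) (hτ : Continuous τ) (hστ : ∀ x b, S.rightHom (σ x * τ b) = φ (x, b)) :
    ∃ Φ : Circle × A × B ≃ₜ G, ∀ z x b, Φ (z, x, b) = S.inl z * (σ x * τ b) := by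
  let s : K → G := fun k => σ (φ.symm k).1 * τ (φ.symm k).2
  have hs : Continuous s := by
    have := map_continuous φ.symm
    exact (hσ.comp this.fst).mul (hτ.comp this.snd)
  have hπs : ∀ k, S.rightHom (s k) = k := fun k => by
    rw [hστ]
    exact φ.apply_symm_apply k
  have hker : ∀ g, ∃ z, S.inl z = g * (s (S.rightHom g))⁻¹ := fun g =>
    S.exists_inl_eq (by rw [map_mul, map_inv, hπs, mul_inv_cancel])
  choose ζ hζ using hker
  have hπ : Continuous S.rightHom := hS.isOpenQuotientMap_rightHom.continuous
  -- Continuity of the circle coordinate can be tested in `G`, since the inclusion of the circle is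
  -- an embedding.
  have hζc : Continuous ζ := by
    rw [hS.isClosedEmbedding_inl.isInducing.continuous_iff]
    refine Continuous.congr ?_ fun g => (hζ g).symm
    exact continuous_id.mul (hs.comp hπ).inv
  have hπz : ∀ z x b, S.rightHom (S.inl z * (σ x * τ b)) = φ (x, b) := fun z x b => by
    rw [map_mul, S.rightHom_inl_eq_one, one_mul, hστ]
  refine ⟨{ toFun := fun p => S.inl p.1 * (σ p.2.1 * τ p.2.2)
            invFun := fun g => (ζ g, φ.symm (S.rightHom g))
            left_inv := ?_
            right_inv := fun g => ?_
            continuous_toFun := (hS.continuous_inl.comp continuous_fst).mul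
              ((hσ.comp continuous_snd.fst).mul (hτ.comp continuous_snd.snd))
            continuous_invFun := hζc.prodMk ((map_continuous φ.symm).comp hπ) },
    fun z x b => rfl⟩
  · rintro ⟨z, x, b⟩
    refine Prod.ext (S.inl_injective ?_) ?_
    · rw [hζ, hπz]
      simp only [s, φ.symm_apply_apply, mul_inv_cancel_right]
    · change φ.symm (S.rightHom (S.inl z * (σ x * τ b))) = (x, b)
      rw [hπz, φ.symm_apply_apply]
  · change S.inl (ζ g) * s (S.rightHom g) = g
    rw [hζ, inv_mul_cancel_right]

end CentralExtension

theorem Heisenberg.element_mul {A : Type*} [CommGroup A] [TopologicalSpace A]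
    [IsTopologicalGroup A] [LocallyCompactSpace A] [MeasurableSpace A] [BorelSpace A]
    (z z' : Circle) (x x' : A) (χ χ' : PontryaginDual A) :
    element z x χ * element z' x' χ' = element (z * z' * χ x') (x * x') (χ * χ') :=
  Subtype.ext (operator_mul z z' x x' χ χ')

theorem IsHeisenbergGroup.exists_equiv_standardGroup {K : Type u} [CommGroup K]
    [TopologicalSpace K] (hK : IsLieGroup K) {G : Type v} [Group G] [TopologicalSpace G]
    [IsTopologicalGroup G] [T2Space G] [LocallyCompactSpace G] {S : GroupExtension Circle G K}
    (hG : IsHeisenbergGroup S) :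
    ∃ (A : Type) (_ : CommGroup A) (_ : TopologicalSpace A) (_ : IsTopologicalGroup A)
      (_ : LocallyCompactSpace A) (_ : MeasurableSpace A) (_ : BorelSpace A), IsLieGroup A ∧
      ∃ (φ : (A × PontryaginDual A) ≃ₜ* K) (Ψ : Heisenberg.standardGroup A ≃ₜ* G),
        (∀ z : Circle, Ψ (Heisenberg.element z 1 1) = S.inl z) ∧
        ∀ (z : Circle) (x : A) (χ : PontryaginDual A),
          S.rightHom (Ψ (Heisenberg.element z x χ)) = φ (x, χ) := by
  obtain ⟨hS, e, hcomm, hn⟩ := hG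
  have := hK.exists_exponential.1
  have he := hcomm.isAlternatingBicharacter hS
  -- The commutator form of H(A) is χ(x')χ'(x)⁻¹, the inverse of the form in the first part, so the
  -- polarization is taken for the flipped bicharacter.
  obtain ⟨A, B, _, _, _, _, _, _, δ, φ, hA, hlA, hlB, hφ⟩ :=
    hK.hasPolarization.{u, v} he.flip (hn.flip he)
  have := hA.t4Space
  have := hA.locallyCompactSpace
  let _ : MeasurableSpace A := borel A
  have : BorelSpace A := ⟨rfl⟩
  replace hφ : ∀ x x' b b', e (φ (x', b')) (φ (x, b)) = δ b' x * (δ b x')⁻¹ := hφ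
  have hcommute : ∀ g h, e (S.rightHom g) (S.rightHom h) = 1 → Commute g h := fun g h hgh => by
    have := hcomm.mul_comm_mul g h
    rwa [hgh, map_one, one_mul] at this
  obtain ⟨σ, hσ⟩ := hlA K G S hS ((φ : A × B →ₜ* K).comp (ContinuousMonoidHom.inl A B))
    fun a b g h hg hh => hcommute _ _ (by
      rw [hg, hh]
      exact (hφ b a 1 1).trans (by simp))
  obtain ⟨τ, hτ⟩ := hlB K G S hS ((φ : A × B →ₜ* K).comp (ContinuousMonoidHom.inr A B))
    fun a b g h hg hh => hcommute _ _ (by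
      rw [hg, hh]
      exact (hφ 1 1 b a).trans (by simp))
  have hσ' : ∀ a, S.rightHom (σ a) = φ (a, 1) := hσ
  have hτ' : ∀ b, S.rightHom (τ b) = φ (1, b) := hτ
  let φ' := ContinuousMulEquiv.prodDual δ φ
  have hφ' : ∀ x χ, φ' (x, χ) = φ (x, δ.symm χ) := fun _ _ => rfl
  -- Non-degeneracy on A × Â is transported from `K` instead of being deduced from Pontryagin
  -- duality for `A`.
  have hn' : IsNondegenerateBicharacter
      fun p q : A × PontryaginDual A => q.2 p.1 * (p.2 q.1)⁻¹ := by
    have h1 := (hn.flip he).comp φ'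
    have h2 : (fun p q => e (φ' q) (φ' p)) =
        fun p q : A × PontryaginDual A => q.2 p.1 * (p.2 q.1)⁻¹ := by
      funext p q
      rw [hφ', hφ', hφ, δ.apply_symm_apply, δ.apply_symm_apply]
    rwa [h2] at h1
  obtain ⟨Θ, hΘ⟩ := Heisenberg.exists_homeomorph_standardGroup hn'
  obtain ⟨Φ, hΦ⟩ := hS.exists_homeomorph φ' (map_continuous σ)
    ((map_continuous τ).comp (map_continuous δ.symm)) fun x χ => by
      rw [map_mul, hσ', Function.comp_apply, hτ', ← map_mul, Prod.mk_mul_mk, mul_one, one_mul]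
      rfl
  -- This matches M_χT_x = χ(x)T_xM_χ and is all that multiplicativity of `F` needs beyond
  -- centrality.
  have hτσ : ∀ (χ : PontryaginDual A) x,
      τ (δ.symm χ) * σ x = S.inl (χ x) * (σ x * τ (δ.symm χ)) := fun χ x => by
    have h1 := hcomm.mul_comm_mul (τ (δ.symm χ)) (σ x)
    rwa [hσ', hτ', hφ, map_one, inv_one, mul_one,
      δ.apply_symm_apply] at h1
  let F := Θ.symm.trans Φ
  have hF : ∀ z x χ, F (Heisenberg.element z x χ) = S.inl z * (σ x * τ (δ.symm χ)) :=
    fun z x χ => by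
      rw [← hΘ]
      exact (congrArg Φ (Θ.symm_apply_apply _)).trans (hΦ z x χ)
  have hFmul : ∀ U U', F (U * U') = F U * F U' := by
    rintro ⟨_, z, x, χ, rfl⟩ ⟨_, z', x', χ', rfl⟩
    change F (Heisenberg.element z x χ * Heisenberg.element z' x' χ') =
      F (Heisenberg.element z x χ) * F (Heisenberg.element z' x' χ')
    rw [Heisenberg.element_mul, hF, hF, hF, map_mul σ, map_mul δ.symm, map_mul τ, map_mul S.inl,
      map_mul S.inl]
    calc S.inl z * S.inl z' * S.inl (χ x') * (σ x * σ x' * (τ (δ.symm χ) * τ (δ.symm χ'))) =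
          S.inl z * (S.inl z' * (S.inl (χ x') * σ x) * (σ x' * τ (δ.symm χ)) *
            τ (δ.symm χ')) := by simp only [mul_assoc]
      _ = S.inl z * (S.inl z' * σ x * (S.inl (χ x') * (σ x' * τ (δ.symm χ))) *
            τ (δ.symm χ')) := by rw [hS.central (χ x') (σ x)]; simp only [mul_assoc]
      _ = S.inl z * (S.inl z' * (σ x * τ (δ.symm χ)) * (σ x' * τ (δ.symm χ'))) := by
        rw [← hτσ]; simp only [mul_assoc]
      _ = _ := by rw [hS.central z' (σ x * τ (δ.symm χ))]; simp only [mul_assoc]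
  let Ψ : Heisenberg.standardGroup A ≃ₜ* G :=
    { F with
      map_mul' := hFmul }
  have hΨ : ∀ z x χ, Ψ (Heisenberg.element z x χ) = S.inl z * (σ x * τ (δ.symm χ)) := hF
  refine ⟨A, inferInstance, inferInstance, inferInstance, inferInstance, inferInstance,
    inferInstance, hA.isLieGroup, φ', Ψ, fun z => ?_, fun z x χ => ?_⟩
  · rw [hΨ, map_one, map_one, map_one, mul_one, mul_one]
  · rw [hΨ, map_mul, S.rightHom_inl_eq_one, one_mul, map_mul, hσ', hτ', ← map_mul, Prod.mk_mul_mk,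
      mul_one, one_mul]
    rfl

theorem IsLieGroup.exists_equiv_prod_pontryaginDual {K : Type u} [CommGroup K]
    [TopologicalSpace K] (hK : IsLieGroup K) {e : K → K → Circle}
    (he : IsAlternatingBicharacter e) (hn : IsNondegenerateBicharacter e) :
    ∃ (A : Type) (_ : CommGroup A) (_ : TopologicalSpace A), IsLieGroup A ∧
      ∃ φ : (A × PontryaginDual A) ≃ₜ* K, ∀ (x x' : A) (χ χ' : PontryaginDual A),
        e (φ (x, χ)) (φ (x', χ')) = χ' x * (χ x')⁻¹ := by
  -- The second universe concerns only the lifting clauses, which are discarded here.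
  obtain ⟨A, B, _, _, _, _, _, _, δ, φ, hA, -, -, hφ⟩ := hK.hasPolarization.{u, 0} he hn
  refine ⟨A, inferInstance, inferInstance, hA.isLieGroup, ContinuousMulEquiv.prodDual δ φ,
    fun x x' χ χ' => (hφ x x' _ _).trans ?_⟩
  rw [δ.apply_symm_apply, δ.apply_symm_apply]

end

theorem theoremA {K : Type*} [CommGroup K] [TopologicalSpace K] (hK : IsLieGroup K) :
    (∀ e : K → K → Circle, IsAlternatingBicharacter e → IsNondegenerateBicharacter e →
      ∃ (A : Type) (_ : CommGroup A) (_ : TopologicalSpace A), IsLieGroup A ∧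
        ∃ φ : (A × PontryaginDual A) ≃ₜ* K, ∀ (x x' : A) (χ χ' : PontryaginDual A),
          e (φ (x, χ)) (φ (x', χ')) = χ' x * (χ x')⁻¹) ∧
    (∀ (G : Type*) [Group G] [TopologicalSpace G] [IsTopologicalGroup G] [T2Space G]
      [LocallyCompactSpace G] (S : GroupExtension Circle G K), IsHeisenbergGroup S →
      ∃ (A : Type) (_ : CommGroup A) (_ : TopologicalSpace A) (_ : IsTopologicalGroup A)
        (_ : LocallyCompactSpace A) (_ : MeasurableSpace A) (_ : BorelSpace A), IsLieGroup A ∧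
        ∃ (φ : (A × PontryaginDual A) ≃ₜ* K) (Ψ : Heisenberg.standardGroup A ≃ₜ* G),
          (∀ z : Circle, Ψ (Heisenberg.element z 1 1) = S.inl z) ∧
          ∀ (z : Circle) (x : A) (χ : PontryaginDual A),
            S.rightHom (Ψ (Heisenberg.element z x χ)) = φ (x, χ)) :=
  ⟨fun _ he hn => hK.exists_equiv_prod_pontryaginDual he hn,
    fun _ _ _ _ _ _ _ hG => hG.exists_equiv_standardGroup hK⟩
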